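/- Work in the ring $\mathbb{Q}[[p_1,p_2,p_3,\dots]]$ of (degreewise completed) symmetric functions in the power sums $p_k$ ($\deg p_k=k$), or in $\mathbb{Q}[t][[p_1,p_2,\dots]]$ when a parameter $t$ occurs. Let $\circ$ denote plethysm, $f\circ g=f(p_1\circ g,p_2\circ g,\dots)$ for $g$ without constant term, where $p_k\circ -$ is the ring endomorphism with $p_k\circ p_j=p_{kj}$ and $p_k\circ t=t^k$. For $f$ without constant term put $$\Sigma_t f=-\tfrac1t f(-tp_1,-t^2p_2,-t^3p_3,\dots),$$ and put $\Sigma f=-f(-p_1,-p_2,-p_3,\dots)$. Let $$\mathrm{Assoc}=\frac{p_1}{1-p_1},\qquad \mathrm{Comm}=\exp\Big(\sum_{k\ge1}\frac{p_k}{k}\Big)-1,$$ let $\mathrm{Lie}=\sum_{n\ge1}\mathrm{ch}(\mathrm{Lie}(n))$, where $\mathrm{Lie}(n)$ is the $\mathfrak{S}_n$-module given by the multilinear part of the free Lie algebra over $\mathbb{Q}$ on $n$ generators, and let $\mathrm{PreLie}=\sum_{n\ge1}\mathrm{ch}(\mathrm{PreLie}(n))$, where $\mathrm{PreLie}(n)$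 is the permutation representation of $\mathfrak{S}_n$ on the rooted trees with vertex set $\{1,\dots,n\}$; here $\mathrm{ch}$ is the Frobenius characteristic. Let $\mathsf{HAL}^{pa}$ be the unique symmetric function with parameter $t$ and without constant term such that $$\mathsf{HAL}^{pa}=p_1\cdot\big([\Sigma_t\mathrm{Assoc}]\circ\mathrm{Comm}\circ[p_1-t\,\mathsf{HAL}^{pa}]\big),$$ and put $$\mathsf{HAL}^{p}=p_1\cdot\big([\Sigma_t\mathrm{Lie}]\circ\mathrm{Comm}\circ[p_1-t\,\mathsf{HAL}^{pa}]\big),\quad \mathsf{HAL}^{a}=[\mathrm{Comm}-p_1]\circ[p_1-t\,\mathsf{HAL}^{pa}],\quad \mathsf{HAL}=\mathsf{HAL}^{p}+\mathsf{HAL}^{a}-\mathsf{HAL}^{pa}.$$ Let $\overline{\mathsf{HAL}}$ be the specialization of $\mathsf{HAL}$ at $t=1$. **Proposition.** One has $$\mathrm{Comm}\circ\Sigma\,\mathrm{PreLie}=p_1-\big(p_1\,\partial_{p_1}\overline{\mathsf{HAL}}-\overline{\mathsf{HAL}}\big).$$ Moreover, this Euler characteristic describes, at the level of symmetric functions, the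 generators of the free pre-Lie algebras as Lie algebras: a symmetric function $G$ without constant term satisfies $\mathrm{Lie}\circ G=\mathrm{PreLie}$ if and only if $\Sigma G=\mathrm{Comm}\circ\Sigma\,\mathrm{PreLie}$. -/

import Mathlib

namespace PreLieHAL

open MvPowerSeries

noncomputable section

/-! ### Symmetric functions

The ring of (degreewise completed) symmetric functions with coefficients in a `ℚ`-algebra `R` is
`R[[p₁, p₂, p₃, …]]`, where `p_k` is the `k`-th power sum, of degree `k`. -/

/-- Symmetric functions with coefficients in `R`, as power series in the power sums `p_k`. -/
abbrev SymFun (R : Type) [CommRing R] : Type := MvPowerSeries ℕ+ R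

/-- The power sum `p_k`. -/
abbrev p {R : Type} [CommRing R] (k : ℕ+) : SymFun R := X k

/-- The degree of a monomial in the power sums, where `p_k` has degree `k`. -/
abbrev degree (m : ℕ+ →₀ ℕ) : ℕ := Finsupp.weight (fun k : ℕ+ => (k : ℕ)) m

/-- The plethysm `g ↦ p_k ∘ g`: it sends `p_j` to `p_{kj}` and acts on the coefficients by the
ring endomorphism `ψ k`. -/
def adams {R : Type} [CommRing R] (ψ : ℕ+ → R →+* R) (k : ℕ+) (g : SymFun R) : SymFun R :=
  rename (mulLeftEmbedding k) (map (ψ k) g)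

/-- The plethysm `f ∘ g`, i.e. `f(p₁ ∘ g, p₂ ∘ g, …)`, meaningful when `g` has no constant term. -/
def plethysmWith {R : Type} [CommRing R] (ψ : ℕ+ → R →+* R) (f g : SymFun R) : SymFun R :=
  subst (fun k => adams ψ k g) f

/-- Plethysm of symmetric functions over `ℚ`. -/
def plethysm (f g : SymFun ℚ) : SymFun ℚ := plethysmWith (fun _ => RingHom.id ℚ) f g

/-- Plethysm of symmetric functions with a parameter `t`, which satisfies `p_k ∘ t = t ^ k`. -/
def plethysmT (f g : SymFun (Polynomial ℚ)) : SymFun (Polynomial ℚ) :=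
  plethysmWith (fun k => (Polynomial.expand ℚ k).toRingHom) f g

/-- The parameter `t`, as a constant symmetric function. -/
def t : SymFun (Polynomial ℚ) := C Polynomial.X

/-- A symmetric function over `ℚ`, seen as a symmetric function with a parameter `t`. -/
def extend (f : SymFun ℚ) : SymFun (Polynomial ℚ) := map Polynomial.C f

/-- The substitution `t = 1`. -/
def atOne (f : SymFun (Polynomial ℚ)) : SymFun ℚ := map (Polynomial.evalRingHom 1) f

/-- The suspension `Σ f = - f(-p₁, -p₂, -p₃, …)`. -/
def suspension (f : SymFun ℚ) : SymFun ℚ := -rescale (fun _ => (-1 : ℚ)) f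

/-- The suspension `Σ_t f = -(1/t) f(-t p₁, -t² p₂, -t³ p₃, …)` of a symmetric function `f` without
constant term. Every coefficient of `f(-t p₁, -t² p₂, …)` is then divisible by `t`, and
`Polynomial.divX` is the division by `t`. -/
def suspensionT (f : SymFun ℚ) : SymFun (Polynomial ℚ) := fun m =>
  -(coeff m (rescale (fun k : ℕ+ => -(Polynomial.X : Polynomial ℚ) ^ (k : ℕ)) (extend f))).divX

/-! ### Frobenius characteristic -/

/-- The monomial `p_{λ₁} p_{λ₂} ⋯` where the `λ_i` are the lengths of the cycles of `σ`, fixed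
points included; it is given by its exponents. -/
def cycleMonomial {n : ℕ} (σ : Equiv.Perm (Fin n)) : ℕ+ →₀ ℕ :=
  (Multiset.toFinsupp σ.partition.parts).comapDomain (fun k : ℕ+ => (k : ℕ))
    PNat.coe_injective.injOn

/-- The Frobenius characteristic `(1/n!) ∑_σ χ(σ) p_{cycle type of σ}` of a finite-dimensional
representation of the symmetric group on `n` letters. -/
def frobenius {n : ℕ} {V : Type} [AddCommGroup V] [Module ℚ V]
    (ρ : Representation ℚ (Equiv.Perm (Fin n)) V) : SymFun ℚ :=
  ((n.factorial : ℚ)⁻¹) • ∑ σ : Equiv.Perm (Fin n), monomial (cycleMonomial σ) (ρ.character σ)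

/-- The symmetric function `∑_n ch(V_n)` of a sequence of finite-dimensional representations of
the symmetric groups; only `ch(V_n)` contributes to degree `n`. -/
def frobeniusSeries {V : ℕ → Type} [∀ n, AddCommGroup (V n)] [∀ n, Module ℚ (V n)]
    (ρ : ∀ n, Representation ℚ (Equiv.Perm (Fin n)) (V n)) : SymFun ℚ :=
  fun m => coeff m (frobenius (ρ (degree m)))

/-! ### The associative and commutative operads -/

/-- `Assoc = p₁ / (1 - p₁)`. -/
def Assoc : SymFun ℚ := p 1 * (1 - p 1)⁻¹

/-- The infinite sum `∑_{k ≥ 1} p_k / k`. -/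
def powerSumSeries : SymFun ℚ := fun m =>
  ∑ᶠ k : ℕ+, coeff m (((k : ℚ)⁻¹) • (p k : SymFun ℚ))

/-- `Comm = exp(∑_{k ≥ 1} p_k / k) - 1`. -/
def Comm : SymFun ℚ := (PowerSeries.exp ℚ).subst powerSumSeries - 1

/-! ### The Lie operad -/

/-- `IsBracketing S x` means that `x` is an iterated bracket, in the free Lie algebra over `ℚ` on
`α`, in which the elements of `S` occur exactly once each and no other generator occurs. -/
inductive IsBracketing {α : Type} [DecidableEq α] : Finset α → FreeLieAlgebra ℚ α → Prop
  | of (i : α) : IsBracketing {i} (FreeLieAlgebra.of ℚ i)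
  | lie {S T : Finset α} {x y : FreeLieAlgebra ℚ α} (h : Disjoint S T)
      (hx : IsBracketing S x) (hy : IsBracketing T y) : IsBracketing (S ∪ T) ⁅x, y⁆

/-- The multilinear part of the free Lie algebra on `n` generators, that is, the component
`Lie(n)` of the operad `Lie`. -/
def lieOperad (n : ℕ) : Submodule ℚ (FreeLieAlgebra ℚ (Fin n)) :=
  Submodule.span ℚ {x | IsBracketing Finset.univ x}

/-- The action of a permutation of the generators on the free Lie algebra. -/
def relabelLie {α : Type} (σ : Equiv.Perm α) : FreeLieAlgebra ℚ α →ₗ⁅ℚ⁆ FreeLieAlgebra ℚ α :=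
  FreeLieAlgebra.lift ℚ (fun i => FreeLieAlgebra.of ℚ (σ i))

theorem relabelLie_of {α : Type} (σ : Equiv.Perm α) (i : α) :
    relabelLie σ (FreeLieAlgebra.of ℚ i) = FreeLieAlgebra.of ℚ (σ i) :=
  FreeLieAlgebra.lift_of_apply _ i

theorem relabelLie_one {α : Type} (x : FreeLieAlgebra ℚ α) :
    relabelLie (1 : Equiv.Perm α) x = x := by
  have h : relabelLie (1 : Equiv.Perm α) = LieHom.id :=
    FreeLieAlgebra.hom_ext (fun i => by rw [relabelLie_of]; rfl)
  rw [h]; rfl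

theorem relabelLie_mul {α : Type} (σ τ : Equiv.Perm α) (x : FreeLieAlgebra ℚ α) :
    relabelLie (σ * τ) x = relabelLie σ (relabelLie τ x) := by
  have h : relabelLie (σ * τ) = (relabelLie σ).comp (relabelLie τ) :=
    FreeLieAlgebra.hom_ext (fun i => by
      rw [relabelLie_of, LieHom.comp_apply, relabelLie_of, relabelLie_of]; rfl)
  rw [h]; rfl

theorem IsBracketing.relabel {α : Type} [DecidableEq α] (σ : Equiv.Perm α) {S : Finset α}
    {x : FreeLieAlgebra ℚ α} (h : IsBracketing S x) :
    IsBracketing (S.map σ.toEmbedding) (relabelLie σ x) := by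
  induction h with
  | of i => rw [relabelLie_of, Finset.map_singleton]; exact IsBracketing.of _
  | lie h _ _ ihx ihy =>
    rw [LieHom.map_lie, Finset.map_union]
    exact IsBracketing.lie ((Finset.disjoint_map _).2 h) ihx ihy

theorem relabelLie_mem {n : ℕ} (σ : Equiv.Perm (Fin n)) :
    ∀ x ∈ lieOperad n, (relabelLie σ : FreeLieAlgebra ℚ (Fin n) →ₗ[ℚ] _) x ∈ lieOperad n := by
  intro x hx
  refine (Submodule.span_le (p := (lieOperad n).comap
    (relabelLie σ : FreeLieAlgebra ℚ (Fin n) →ₗ[ℚ] FreeLieAlgebra ℚ (Fin n)))).2 ?_ hx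
  intro y hy
  refine Submodule.subset_span ?_
  have := IsBracketing.relabel σ hy
  rwa [Finset.map_univ_equiv] at this

/-- The action of the symmetric group on `Lie(n)` by permutation of the generators. -/
def lieRep (n : ℕ) : Representation ℚ (Equiv.Perm (Fin n)) (lieOperad n) where
  toFun σ := (relabelLie σ : FreeLieAlgebra ℚ (Fin n) →ₗ[ℚ] _).restrict (relabelLie_mem σ)
  map_one' := by
    ext x
    exact relabelLie_one x.1
  map_mul' σ τ := by
    ext x
    exact relabelLie_mul σ τ x.1

/-- The symmetric function of the operad `Lie`. -/
def Lie : SymFun ℚ := frobeniusSeries lieRep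

/-! ### The pre-Lie operad -/

/-- A rooted tree with vertex set `α`, encoded by its root and by the map which sends every other
vertex to its parent (the next vertex on the path to the root) and fixes the root. -/
@[ext]
structure RootedTree (α : Type) where
  root : α
  parent : α → α
  parent_root : parent root = root
  reaches_root : ∀ x, ∃ k : ℕ, parent^[k] x = root

/-- Relabelling of the vertices of a rooted tree. -/
def RootedTree.relabel {α : Type} (σ : Equiv.Perm α) (T : RootedTree α) : RootedTree α where
  root := σ T.root
  parent x := σ (T.parent (σ.symm x))
  parent_root := by simp [T.parent_root]
  reaches_root x := by
    obtain ⟨k, hk⟩ := T.reaches_root (σ.symm x)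
    refine ⟨k, ?_⟩
    have h : Function.Semiconj σ T.parent (fun x => σ (T.parent (σ.symm x))) := fun y => by simp
    have := (h.iterate_right k) (σ.symm x)
    rw [hk, Equiv.apply_symm_apply] at this
    exact this.symm

instance {α : Type} : MulAction (Equiv.Perm α) (RootedTree α) where
  smul σ T := T.relabel σ
  one_smul _ := rfl
  mul_smul _ _ _ := rfl

/-- The symmetric function of the operad `PreLie`: the Frobenius characteristic of the permutation
representations of the symmetric groups on the rooted trees with vertex set `{1, …, n}`. -/
def PreLie : SymFun ℚ :=
  frobeniusSeries fun n =>
    Representation.ofMulAction ℚ (Equiv.Perm (Fin n)) (RootedTree (Fin n))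

/-! ### Auxiliary facts: existence and uniqueness of the solution of a plethystic equation -/

section FixedPoint

variable {R : Type} [CommRing R]

/-- Two symmetric functions agree in degrees less than `n`. -/
def Agree (n : ℕ) (f g : SymFun R) : Prop := ∀ m, degree m < n → coeff m f = coeff m g

theorem degree_add (a b : ℕ+ →₀ ℕ) : degree (a + b) = degree a + degree b := map_add _ a b

theorem Agree.mul {n : ℕ} {f f' g g' : SymFun R} (hf : Agree n f f') (hg : Agree n g g') :
    Agree n (f * g) (f' * g') := by
  classical
  intro m hm
  rw [coeff_mul, coeff_mul]
  refine Finset.sum_congr rfl fun x hx => ?_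
  have h := degree_add x.1 x.2
  rw [Finset.HasAntidiagonal.mem_antidiagonal.1 hx] at h
  rw [hf _ (by omega), hg _ (by omega)]

theorem Agree.pow {n : ℕ} {f f' : SymFun R} (hf : Agree n f f') (k : ℕ) :
    Agree n (f ^ k) (f' ^ k) := by
  induction k with
  | zero => intro m _; simp
  | succ k ih => rw [pow_succ, pow_succ]; exact ih.mul hf

theorem Agree.prod {n : ℕ} {ι : Type} (s : Finset ι) {f f' : ι → SymFun R}
    (h : ∀ i ∈ s, Agree n (f i) (f' i)) : Agree n (∏ i ∈ s, f i) (∏ i ∈ s, f' i) := by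
  classical
  induction s using Finset.induction_on with
  | empty => intro m _; simp
  | insert a s ha ih =>
    rw [Finset.prod_insert ha, Finset.prod_insert ha]
    exact (h a (Finset.mem_insert_self _ _)).mul
      (ih fun i hi => h i (Finset.mem_insert_of_mem hi))

theorem degree_mapDomain (k : ℕ+) (y : ℕ+ →₀ ℕ) :
    degree (y.mapDomain (mulLeftEmbedding k)) = k * degree y := by
  simp only [degree, Finsupp.weight_apply]
  rw [Finsupp.sum_mapDomain_index (by simp) (by intros; simp [add_mul]), Finsupp.mul_sum]
  refine Finsupp.sum_congr fun i _ => ?_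
  simp [mulLeftEmbedding]
  ring

theorem Agree.adams (ψ : ℕ+ → R →+* R) {n : ℕ} {g g' : SymFun R} (h : Agree n g g') (k : ℕ+) :
    Agree n (adams ψ k g) (adams ψ k g') := by
  intro m hm
  unfold PreLieHAL.adams
  rw [coeff_rename, coeff_rename]
  refine Finset.sum_congr rfl fun y hy => ?_
  have hy' : y.mapDomain (mulLeftEmbedding k) = m := by simpa using hy
  have h1 := degree_mapDomain k y
  rw [hy'] at h1
  have h2 : degree y < n :=
    lt_of_le_of_lt (h1 ▸ Nat.le_mul_of_pos_left _ k.pos) hm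
  rw [coeff_map, coeff_map, h y h2]

theorem constantCoeff_adams (ψ : ℕ+ → R →+* R) (k : ℕ+) {g : SymFun R}
    (hg : constantCoeff g = 0) : constantCoeff (adams ψ k g) = 0 := by
  unfold adams
  rw [constantCoeff_rename, constantCoeff_map, hg, map_zero]

theorem hasSubst_adams (ψ : ℕ+ → R →+* R) {g : SymFun R} (hg : constantCoeff g = 0) :
    HasSubst (fun k => adams ψ k g) where
  const_coeff k := by rw [constantCoeff_adams ψ k hg]; exact IsNilpotent.zero
  coeff_zero d := by
    refine (Set.finite_Iic (Nat.succPNat (degree d))).subset fun k hk => ?_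
    rw [Set.mem_Iic, ← PNat.coe_le_coe]
    by_contra hlt
    rw [not_le, Nat.succPNat_coe] at hlt
    apply hk
    unfold adams
    rw [coeff_rename]
    refine Finset.sum_eq_zero fun y hy => ?_
    have hy' : y.mapDomain (mulLeftEmbedding k) = d := by simpa using hy
    have h1 := degree_mapDomain k y
    rw [hy'] at h1
    have h0 : degree y = 0 := by
      by_contra h0
      have := Nat.le_mul_of_pos_right (k : ℕ) (Nat.pos_of_ne_zero h0)
      omega
    have hz : y = 0 := by
      ext i
      have := Finsupp.le_weight (fun k : ℕ+ => (k : ℕ)) (s := i) i.pos.ne' y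
      simp only [degree] at h0
      simp; omega
    rw [hz, coeff_map, coeff_zero_eq_constantCoeff_apply, hg, map_zero]

theorem Agree.plethysmWith (ψ : ℕ+ → R →+* R) (f : SymFun R) {n : ℕ} {g g' : SymFun R}
    (hg : constantCoeff g = 0) (hg' : constantCoeff g' = 0) (h : Agree n g g') :
    Agree n (plethysmWith ψ f g) (plethysmWith ψ f g') := by
  intro m hm
  unfold PreLieHAL.plethysmWith
  rw [coeff_subst (hasSubst_adams ψ hg), coeff_subst (hasSubst_adams ψ hg')]
  refine finsum_congr fun d => ?_
  rw [Finsupp.prod, Finsupp.prod,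
    Agree.prod d.support (fun i _ => (h.adams ψ i).pow (d i)) m hm]

theorem constantCoeff_plethysmWith (ψ : ℕ+ → R →+* R) {f g : SymFun R}
    (hf : constantCoeff f = 0) (hg : constantCoeff g = 0) :
    constantCoeff (plethysmWith ψ f g) = 0 :=
  constantCoeff_subst_eq_zero (hasSubst_adams ψ hg) (fun k => constantCoeff_adams ψ k hg) hf

theorem Agree.p_mul {n : ℕ} {f g : SymFun R} (h : Agree n f g) :
    Agree (n + 1) (p 1 * f) (p 1 * g) := by
  classical
  intro m hm
  rw [coeff_mul, coeff_mul]
  refine Finset.sum_congr rfl fun x hx => ?_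
  by_cases h1 : x.1 = Finsupp.single 1 1
  · have h2 := degree_add x.1 x.2
    rw [Finset.HasAntidiagonal.mem_antidiagonal.1 hx, h1] at h2
    have h3 : degree (Finsupp.single 1 1) = 1 := by simp [degree, Finsupp.weight_single]
    rw [h _ (by omega)]
  · rw [coeff_X, if_neg h1, zero_mul, zero_mul]

/-- A map that commutes with truncation and raises the order of agreement has a unique fixed
point. -/
theorem existsUnique_fixedPoint (Φ : SymFun R → SymFun R)
    (h0 : ∀ H, constantCoeff H = 0 → constantCoeff (Φ H) = 0)
    (hΦ : ∀ n H H', constantCoeff H = 0 → constantCoeff H' = 0 → Agree n H H' →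
      Agree (n + 1) (Φ H) (Φ H')) :
    ∃! H : SymFun R, constantCoeff H = 0 ∧ H = Φ H := by
  have hc : ∀ n, constantCoeff (Φ^[n] 0) = 0 := by
    intro n
    induction n with
    | zero => simp
    | succ n ih => rw [Function.iterate_succ_apply']; exact h0 _ ih
  have hstep : ∀ n, Agree n (Φ^[n] 0) (Φ^[n + 1] 0) := by
    intro n
    induction n with
    | zero => intro m hm; omega
    | succ n ih =>
      rw [Function.iterate_succ_apply', Function.iterate_succ_apply']
      exact hΦ n _ _ (hc n) (hc (n + 1)) ih
  have hmono : ∀ n k, Agree n (Φ^[n] 0) (Φ^[n + k] 0) := by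
    intro n k
    induction k with
    | zero => intro m _; rfl
    | succ k ih =>
      intro m hm
      rw [ih m hm]
      exact hstep (n + k) m (by omega)
  set L : SymFun R := fun m => coeff m (Φ^[degree m + 1] 0) with hL
  have hLa : ∀ n, Agree n L (Φ^[n] 0) := by
    intro n m hm
    obtain ⟨k, rfl⟩ := Nat.exists_eq_add_of_le (Nat.succ_le_of_lt hm)
    exact hmono (degree m + 1) k m (Nat.lt_succ_self _)
  have hL0 : constantCoeff L = 0 := by
    rw [← coeff_zero_eq_constantCoeff_apply, hLa 1 0 (by simp [degree]),
      coeff_zero_eq_constantCoeff_apply, hc]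
  refine ⟨L, ⟨hL0, ?_⟩, ?_⟩
  · ext m
    have h1 := hΦ (degree m) L _ hL0 (hc _) (hLa (degree m)) m (Nat.lt_succ_self _)
    rw [← Function.iterate_succ_apply' Φ] at h1
    rw [h1]
    exact hLa (degree m + 1) m (Nat.lt_succ_self _)
  · rintro H ⟨hH0, hH⟩
    have key : ∀ n, Agree n H L := by
      intro n m hm
      rw [hLa n m hm]
      revert m
      induction n with
      | zero => intro m hm; omega
      | succ n ih =>
        intro m hm
        rw [hH, Function.iterate_succ_apply']
        exact hΦ n _ _ hH0 (hc n) ih m hm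
    ext m
    exact key (degree m + 1) m (Nat.lt_succ_self _)

theorem existsUnique_plethystic (ψ : ℕ+ → R →+* R) (f g c : SymFun R) (hg : constantCoeff g = 0) :
    ∃! H : SymFun R, constantCoeff H = 0 ∧
      H = p 1 * plethysmWith ψ f (plethysmWith ψ g (p 1 - c * H)) := by
  have hs : ∀ H : SymFun R, constantCoeff H = 0 → constantCoeff (p 1 - c * H) = 0 := by
    intro H hH
    rw [map_sub, map_mul, hH, mul_zero, constantCoeff_X, sub_zero]
  refine existsUnique_fixedPoint
    (fun H => p 1 * plethysmWith ψ f (plethysmWith ψ g (p 1 - c * H))) ?_ ?_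
  · intro H _
    rw [map_mul, constantCoeff_X, zero_mul]
  · intro n H H' hH hH' h
    refine Agree.p_mul (Agree.plethysmWith ψ f (constantCoeff_plethysmWith ψ hg (hs H hH))
      (constantCoeff_plethysmWith ψ hg (hs H' hH'))
      (Agree.plethysmWith ψ g (hs H hH) (hs H' hH') ?_))
    intro m hm
    have h1 : Agree n (c * H) (c * H') := Agree.mul (fun _ _ => rfl) h
    rw [map_sub, map_sub, h1 m hm]

end FixedPoint

theorem constantCoeff_powerSumSeries : constantCoeff powerSumSeries = 0 := by
  rw [← coeff_zero_eq_constantCoeff_apply]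
  change (∑ᶠ k : ℕ+, coeff 0 (((k : ℚ)⁻¹) • (p k : SymFun ℚ))) = 0
  rw [finsum_congr (g := fun _ => 0), finsum_zero]
  intro k
  rw [coeff_smul, coeff_zero_X, mul_zero]

theorem constantCoeff_Comm : constantCoeff Comm = 0 := by
  have hs : PowerSeries.HasSubst powerSumSeries :=
    PowerSeries.HasSubst.of_constantCoeff_zero constantCoeff_powerSumSeries
  have h : Comm = (PowerSeries.exp ℚ - 1).subst powerSumSeries := by
    have h1 : (1 : PowerSeries ℚ).subst powerSumSeries = (1 : SymFun ℚ) := by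
      rw [← PowerSeries.coe_substAlgHom hs, map_one]
    rw [PowerSeries.subst_sub hs, h1, Comm]
  rw [h]
  exact PowerSeries.constantCoeff_subst_eq_zero constantCoeff_powerSumSeries _ (by simp)

/-! ### The symmetric functions `HAL` -/

theorem existsUnique_HALpa : ∃! H : SymFun (Polynomial ℚ), constantCoeff H = 0 ∧
    H = p 1 * plethysmT (suspensionT Assoc) (plethysmT (extend Comm) (p 1 - t * H)) :=
  existsUnique_plethystic _ _ _ _ (by
    rw [extend, constantCoeff_map, constantCoeff_Comm, map_zero])

/-- `HAL^{pa}`, the unique solution without constant term of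
`HAL^{pa} = p₁ · ([Σ_t Assoc] ∘ Comm ∘ [p₁ - t HAL^{pa}])`. -/
def HALpa : SymFun (Polynomial ℚ) := existsUnique_HALpa.choose

/-- `HAL^p = p₁ · ([Σ_t Lie] ∘ Comm ∘ [p₁ - t HAL^{pa}])`. -/
def HALp : SymFun (Polynomial ℚ) :=
  p 1 * plethysmT (suspensionT Lie) (plethysmT (extend Comm) (p 1 - t * HALpa))

/-- `HAL^a = [Comm - p₁] ∘ [p₁ - t HAL^{pa}]`. -/
def HALa : SymFun (Polynomial ℚ) :=
  plethysmT (extend Comm - p 1) (p 1 - t * HALpa)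

/-- `HAL = HAL^p + HAL^a - HAL^{pa}`. -/
def HAL : SymFun (Polynomial ℚ) := HALp + HALa - HALpa

/-- The specialization of `HAL` at `t = 1`. -/
def HALbar : SymFun ℚ := atOne HAL

end

end PreLieHAL

open PreLieHAL

/-!
Write `Exp g = 1 + Comm ∘ g`. Up to its constant term, a series `E` is determined by `euler E / E`,
where the derivation `euler` multiplies by the degree, and `Exp g` is characterized by
`euler E / E = ∑_k p_k ∘ euler g`.

*Pre-Lie.* A rooted tree is a forest grafted on a root. In a forest fixed by a permutation, the
trees whose roots form one orbit of length `k` are the translates of one tree, which is fixed by the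
`k`-th power of the permutation; pointing a forest at a root thus gives the equation of
`Exp PreLie`, and `PreLie = p₁ Exp PreLie`. Hence `P = Σ PreLie` satisfies `P Exp P = p₁`.

*Lie.* By elimination, the multilinear part on `κ ⊕ β`, with `κ` nonempty, is the tensor product of
the one on `κ` and of the space spanned by the families `(u_c)` of lists indexed by `κ` in which
each element of `β` occurs once; a dimension count suffices to exclude relations. If `κ` is a cycle
of length `d` of a permutation, the fixed families are given by lists fixed by the `d`-th power, and
`euler Lie = ∑_d c_d p_d / (1 - p_d)` for some numbers `c_d`. The symmetric group has no nonzero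
invariants in `Lie(n)` for `n > 1`, since every bracketing contains a bracket `⁅x_i, x_j⁆` that a
transposition negates; this forces `∑_{d ∣ n} c_d = 0` for `n > 1`. The resulting equation for
`Exp (Σ Lie)` has the solution `1 + p₁`, that is `Comm ∘ Σ Lie = p₁`.

*Conclusion.* `Σ Lie` is inverse to `Comm` for plethysm, which gives the equivalence. At `t = 1` the
equation of `HALpa` is that of `p₁ - P`, so `HALbar = p₁ P + Comm ∘ P - p₁`, and the identity
results from applying `∂/∂p₁` to `P Exp P = p₁`.
-/

namespace PreLieHAL

open MvPowerSeries Equiv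

noncomputable section

/-! ### Comparison of coefficients by degree -/

section Degree

variable {R : Type} [CommRing R] {f g : SymFun R}

theorem degree_eq_zero_iff {m : ℕ+ →₀ ℕ} : degree m = 0 ↔ m = 0 :=
  have := Finsupp.nonTorsionWeight_of (R := ℕ) (w := fun k : ℕ+ => (k : ℕ)) fun k => k.pos.ne'
  Finsupp.weight_eq_zero_iff_eq_zero _

theorem degree_single (k : ℕ+) (a : ℕ) : degree (Finsupp.single k a) = a * k := by
  simp [degree, Finsupp.weight_single]

theorem Agree.refl (n : ℕ) (f : SymFun R) : Agree n f f := fun _ _ => rfl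

theorem Agree.mul_of_constantCoeff_eq_zero {n : ℕ} (h : Agree n f g) {u : SymFun R}
    (hu : constantCoeff u = 0) : Agree (n + 1) (f * u) (g * u) := by
  classical
  intro m hm
  rw [coeff_mul, coeff_mul]
  refine Finset.sum_congr rfl fun x hx => ?_
  have hdeg := degree_add x.1 x.2
  rw [Finset.HasAntidiagonal.mem_antidiagonal.1 hx] at hdeg
  rcases eq_or_ne x.2 0 with hx2 | hx2
  · rw [hx2, coeff_zero_eq_constantCoeff_apply, hu, mul_zero, mul_zero]
  · have := mt degree_eq_zero_iff.1 hx2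
    rw [h x.1 (by omega)]

theorem eq_of_agree_degree (h : ∀ m, Agree (degree m) f g → coeff m f = coeff m g) : f = g := by
  have agree : ∀ n, Agree n f g := by
    intro n
    induction n with
    | zero => exact fun m hm => absurd hm (Nat.not_lt_zero _)
    | succ n ih => exact fun m hm => h m fun m' hm' => ih m' (by omega)
  ext m
  exact agree (degree m + 1) m (Nat.lt_succ_self _)

theorem coeff_pow_eq_zero (hf : constantCoeff f = 0) {d : ℕ} {m : ℕ+ →₀ ℕ} (hm : degree m < d) :
    coeff m (f ^ d) = 0 := by
  refine coeff_of_lt_order (lt_of_lt_of_le ?_ (le_order_pow_of_constantCoeff_eq_zero d hf))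
  refine lt_of_le_of_lt (Nat.cast_le.2 ?_) (Nat.cast_lt.2 hm)
  rw [degree, Finsupp.weight_apply, Finsupp.degree]
  exact Finset.sum_le_sum fun k _ => Nat.le_mul_of_pos_right _ k.pos

theorem agree_subst_trunc (F : PowerSeries R) (hf : constantCoeff f = 0) (n : ℕ) :
    Agree n (F.subst f) (Polynomial.aeval f (PowerSeries.trunc n F)) := by
  intro m hm
  have hs : PowerSeries.HasSubst f := PowerSeries.HasSubst.of_constantCoeff_zero hf
  rw [← PowerSeries.subst_coe hs, PowerSeries.coeff_subst hs, PowerSeries.coeff_subst hs]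
  refine finsum_congr fun d => ?_
  rw [Polynomial.coeff_coe, PowerSeries.coeff_trunc]
  split_ifs with hd
  · rfl
  · rw [coeff_pow_eq_zero hf (by omega), smul_zero, smul_zero]

end Degree

/-! ### Derivations -/

section Derivations

variable {R : Type} [CommRing R]

/-- The Euler derivation, which multiplies every homogeneous component by its degree. -/
def euler : Derivation R (SymFun R) (SymFun R) :=
  Derivation.mk'
    { toFun := fun f m => (degree m : R) * coeff m f
      map_add' := fun f g => funext fun m => by
        exact (by rw [map_add, mul_add] : (degree m : R) * coeff m (f + g) = _)
      map_smul' := fun r f => funext fun m => by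
        exact (by rw [coeff_smul, mul_left_comm] :
          (degree m : R) * coeff m (r • f) = r * (degree m * coeff m f)) }
    (fun f g => by
      classical
      ext m
      change (degree m : R) * coeff m (f * g) = coeff m (f * _ + g * _)
      rw [mul_comm g, map_add, coeff_mul, coeff_mul, coeff_mul, ← Finset.sum_add_distrib,
        Finset.mul_sum]
      refine Finset.sum_congr rfl fun x hx => ?_
      rw [← Finset.HasAntidiagonal.mem_antidiagonal.1 hx, degree_add]
      change _ = coeff x.1 f * (degree x.2 * coeff x.2 g) + (degree x.1 * coeff x.1 f) * coeff x.2 g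
      push_cast
      ring)

theorem coeff_euler (m : ℕ+ →₀ ℕ) (f : SymFun R) :
    coeff m (euler f) = degree m * coeff m f := rfl

theorem constantCoeff_euler (f : SymFun R) : constantCoeff (euler f) = 0 := by
  rw [← coeff_zero_eq_constantCoeff_apply, coeff_euler]
  simp [degree]

theorem euler_p (k : ℕ+) : euler (p k : SymFun R) = (k : R) • p k := by
  classical
  ext m
  rw [coeff_euler, coeff_smul, coeff_X]
  split_ifs with h
  · rw [h, degree_single, one_mul]
  · rw [mul_zero, mul_zero]

theorem coeff_eq_of_coeff_euler_eq [NoZeroDivisors R] [CharZero R] {f g : SymFun R}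
    (h0 : constantCoeff f = constantCoeff g) {m : ℕ+ →₀ ℕ}
    (h : coeff m (euler f) = coeff m (euler g)) : coeff m f = coeff m g := by
  rcases eq_or_ne m 0 with rfl | hm
  · simpa using h0
  · rw [coeff_euler, coeff_euler] at h
    exact mul_left_cancel₀ (Nat.cast_ne_zero.2 (mt degree_eq_zero_iff.1 hm)) h

theorem eq_of_euler_eq [NoZeroDivisors R] [CharZero R] {f g : SymFun R} (h : euler f = euler g)
    (h0 : constantCoeff f = constantCoeff g) : f = g := by
  ext m
  exact coeff_eq_of_coeff_euler_eq h0 (congrArg (coeff m) h)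

theorem eq_of_euler_eq_mul [NoZeroDivisors R] [CharZero R] {E E' u : SymFun R}
    (hu : constantCoeff u = 0) (hE : euler E = E * u) (hE' : euler E' = E' * u)
    (h0 : constantCoeff E = constantCoeff E') : E = E' := by
  refine eq_of_agree_degree fun m hm => coeff_eq_of_coeff_euler_eq h0 ?_
  rw [hE, hE']
  exact hm.mul_of_constantCoeff_eq_zero hu m (Nat.lt_succ_self _)

/-- A derivation of the ring of symmetric functions which lowers degrees by at most one. This
replaces continuity: it is all that the chain rule `derivation_subst` needs. -/
def LowersDegreeByAtMostOne (δ : Derivation R (SymFun R) (SymFun R)) : Prop :=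
  ∀ n f g, Agree (n + 1) f g → Agree n (δ f) (δ g)

theorem lowersDegreeByAtMostOne_euler : LowersDegreeByAtMostOne (euler (R := R)) := by
  intro n f g h m hm
  rw [coeff_euler, coeff_euler, h m (by omega)]

theorem lowersDegreeByAtMostOne_pderiv : LowersDegreeByAtMostOne (pderiv R (1 : ℕ+)) := by
  intro n f g h m hm
  rw [coeff_pderiv, coeff_pderiv, h]
  rw [degree_add, degree_single, PNat.one_coe, mul_one]
  omega

theorem derivation_subst {δ : Derivation R (SymFun R) (SymFun R)}
    (hδ : LowersDegreeByAtMostOne δ) (F : PowerSeries R) {f : SymFun R}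
    (hf : constantCoeff f = 0) :
    δ (F.subst f) = (PowerSeries.derivative R F).subst f * δ f := by
  ext m
  rw [hδ _ _ _ (agree_subst_trunc F hf (degree m + 1 + 1)) m (by omega),
    Derivation.comp_aeval_eq (a := f) δ, smul_eq_mul, ← PowerSeries.trunc_derivative]
  exact ((agree_subst_trunc _ hf (degree m + 1)).mul (Agree.refl _ _) m (by omega)).symm

end Derivations

/-! ### Plethysm by the power sums -/

section Adams

variable {R : Type} [CommRing R]

/-- The plethysm `f ↦ p_k ∘ f` for the trivial action of `p_k` on the coefficients, as an algebra
endomorphism. -/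
abbrev adamsHom (k : ℕ+) : SymFun R →ₐ[R] SymFun R := rename (mulLeftEmbedding k)

theorem adams_id (k : ℕ+) (f : SymFun R) : adams (fun _ => RingHom.id R) k f = adamsHom k f := by
  simp [adams, map_id]

theorem hasSubst_adamsHom {f : SymFun R} (hf : constantCoeff f = 0) :
    HasSubst (fun k => adamsHom k f) := by
  simpa only [adams_id] using hasSubst_adams (fun _ => RingHom.id R) hf

theorem coeff_mapDomain_adamsHom (k : ℕ+) (f : SymFun R) (m : ℕ+ →₀ ℕ) :
    coeff (m.mapDomain (mulLeftEmbedding k)) (adamsHom k f) = coeff m f := by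
  rw [← Finsupp.embDomain_eq_mapDomain, coeff_embDomain_rename]

theorem coeff_adamsHom_eq_zero {k : ℕ+} (f : SymFun R) {m : ℕ+ →₀ ℕ}
    (hm : m ∉ Set.range (Finsupp.mapDomain (mulLeftEmbedding k))) : coeff m (adamsHom k f) = 0 :=
  coeff_rename_eq_zero _ _ hm

theorem adamsHom_one (f : SymFun R) : adamsHom 1 f = f := by
  have : (mulLeftEmbedding (1 : ℕ+) : ℕ+ → ℕ+) = id := funext one_mul
  simp [adamsHom, this]

theorem adamsHom_adamsHom (j k : ℕ+) (f : SymFun R) :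
    adamsHom j (adamsHom k f) = adamsHom (j * k) f := by
  have : (mulLeftEmbedding j : ℕ+ → ℕ+) ∘ mulLeftEmbedding k = mulLeftEmbedding (j * k) :=
    funext fun i => (mul_assoc j k i).symm
  simp [adamsHom, this]

theorem euler_adamsHom (k : ℕ+) (f : SymFun R) :
    euler (adamsHom k f) = (k : R) • adamsHom k (euler f) := by
  ext m
  rw [coeff_euler, coeff_smul]
  by_cases hm : m ∈ Set.range (Finsupp.mapDomain (mulLeftEmbedding k))
  · obtain ⟨m, rfl⟩ := hm
    rw [coeff_mapDomain_adamsHom, coeff_mapDomain_adamsHom, degree_mapDomain, coeff_euler,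
      Nat.cast_mul, mul_assoc]
  · rw [coeff_adamsHom_eq_zero f hm, coeff_adamsHom_eq_zero _ hm, mul_zero, mul_zero]

theorem Agree.coeff_adamsHom_eq {f g : SymFun R} {m : ℕ+ →₀ ℕ} (h : Agree (degree m) f g)
    (h0 : constantCoeff f = constantCoeff g) {k : ℕ+} (hk : k ≠ 1) :
    coeff m (adamsHom k f) = coeff m (adamsHom k g) := by
  by_cases hm : m ∈ Set.range (Finsupp.mapDomain (mulLeftEmbedding k))
  · obtain ⟨m, rfl⟩ := hm
    rw [coeff_mapDomain_adamsHom, coeff_mapDomain_adamsHom]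
    rcases eq_or_ne m 0 with rfl | hm0
    · simpa using h0
    · refine h m ?_
      rw [degree_mapDomain]
      exact lt_mul_of_one_lt_left (Nat.pos_of_ne_zero (mt degree_eq_zero_iff.1 hm0))
        (PNat.coe_lt_coe 1 k |>.2 (one_le.lt_of_ne hk.symm))
  · rw [coeff_adamsHom_eq_zero f hm, coeff_adamsHom_eq_zero g hm]

/-- The infinite sum `∑_{k ≥ 1} p_k ∘ f`, meaningful when `f` has no constant term. -/
def adamsSum (f : SymFun R) : SymFun R := fun m => ∑ᶠ k : ℕ+, coeff m (adamsHom k f)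

theorem coeff_adamsSum (f : SymFun R) (m : ℕ+ →₀ ℕ) :
    coeff m (adamsSum f) = ∑ᶠ k : ℕ+, coeff m (adamsHom k f) := rfl

theorem constantCoeff_adamsSum {f : SymFun R} (hf : constantCoeff f = 0) :
    constantCoeff (adamsSum f) = 0 := by
  rw [← coeff_zero_eq_constantCoeff_apply, coeff_adamsSum]
  simp [constantCoeff_rename, hf]

theorem finite_support_coeff_adamsHom {f : SymFun R} (hf : constantCoeff f = 0) (m : ℕ+ →₀ ℕ) :
    (Function.support fun k : ℕ+ => coeff m (adamsHom k f)).Finite :=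
  (hasSubst_adamsHom hf).coeff_zero m

theorem adamsSum_injOn : Set.InjOn adamsSum {f : SymFun R | constantCoeff f = 0} := by
  intro f hf g hg h
  refine eq_of_agree_degree fun m hm => ?_
  have hsum := congrArg (coeff m) h
  rw [coeff_adamsSum, coeff_adamsSum, ← sub_eq_zero,
    ← finsum_sub_distrib (finite_support_coeff_adamsHom hf m) (finite_support_coeff_adamsHom hg m),
    finsum_eq_single _ 1, adamsHom_one, adamsHom_one, sub_eq_zero] at hsum
  · exact hsum
  · exact fun k hk => sub_eq_zero.2 (hm.coeff_adamsHom_eq (hf.trans hg.symm) hk)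

theorem pderiv_one_adamsHom {k : ℕ+} (hk : k ≠ 1) (f : SymFun R) :
    pderiv R 1 (adamsHom k f) = 0 := by
  ext m
  rw [coeff_pderiv, coeff_adamsHom_eq_zero, zero_mul, map_zero]
  rintro ⟨y, hy⟩
  have h1 : y.mapDomain (mulLeftEmbedding k) 1 = 0 := by
    refine Finsupp.mapDomain_of_notMem_range _ _ ?_
    rintro ⟨j, hj : k * j = 1⟩
    exact hk ((PNat.dvd_one_iff k).1 ⟨j, hj.symm⟩)
  rw [hy] at h1
  simp at h1

end Adams

/-! ### Plethysm over `ℚ` -/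

section Plethysm

variable {f g h : SymFun ℚ}

theorem plethysm_eq (f g : SymFun ℚ) : plethysm f g = subst (fun k => adamsHom k g) f := by
  simp only [plethysm, plethysmWith, adams_id]

theorem constantCoeff_plethysm (hf : constantCoeff f = 0) (hg : constantCoeff g = 0) :
    constantCoeff (plethysm f g) = 0 :=
  constantCoeff_plethysmWith _ hf hg

theorem plethysm_p_one (hf : constantCoeff f = 0) : plethysm (p 1) f = f := by
  rw [plethysm_eq, subst_X (hasSubst_adamsHom hf), adamsHom_one]

theorem adamsHom_plethysm (k : ℕ+) (f : SymFun ℚ) (hg : constantCoeff g = 0) :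
    adamsHom k (plethysm f g) = plethysm (adamsHom k f) g := by
  rw [plethysm_eq, plethysm_eq, adamsHom, rename_eq_subst, rename_eq_subst,
    subst_comp_subst_apply (hasSubst_adamsHom hg) (HasSubst.X_comp _),
    subst_comp_subst_apply (HasSubst.X_comp _) (hasSubst_adamsHom hg)]
  congr 1
  funext j
  rw [← rename_eq_subst, Function.comp_apply, subst_X (hasSubst_adamsHom hg)]
  exact adamsHom_adamsHom k j g

theorem plethysm_assoc (f : SymFun ℚ) (hg : constantCoeff g = 0) (hh : constantCoeff h = 0) :
    plethysm f (plethysm g h) = plethysm (plethysm f g) h := by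
  rw [plethysm_eq f (plethysm g h), plethysm_eq (plethysm f g), plethysm_eq f g,
    subst_comp_subst_apply (hasSubst_adamsHom hg) (hasSubst_adamsHom hh)]
  congr 1
  funext k
  rw [adamsHom_plethysm k g hh, plethysm_eq]

theorem coeff_powerSumSeries_single (k : ℕ+) :
    coeff (Finsupp.single k 1) powerSumSeries = (k : ℚ)⁻¹ := by
  classical
  change ∑ᶠ j : ℕ+, coeff (Finsupp.single k 1) ((j : ℚ)⁻¹ • (p j : SymFun ℚ)) = _
  rw [finsum_eq_single _ k fun j hj => ?_]
  · simp
  · rw [coeff_smul, coeff_X,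
      if_neg fun h => hj ((Finsupp.single_left_inj one_ne_zero).1 h).symm, mul_zero]

theorem coeff_powerSumSeries_eq_zero {m : ℕ+ →₀ ℕ}
    (hm : m ∉ Set.range fun k : ℕ+ => Finsupp.single k 1) : coeff m powerSumSeries = 0 := by
  classical
  change ∑ᶠ j : ℕ+, coeff m ((j : ℚ)⁻¹ • (p j : SymFun ℚ)) = 0
  refine finsum_eq_zero_of_forall_eq_zero fun k => ?_
  rw [coeff_smul, coeff_X, if_neg fun h => hm ⟨k, h.symm⟩, mul_zero]

theorem finsum_coeff_powerSumSeries_mul (φ : (ℕ+ →₀ ℕ) → ℚ) :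
    ∑ᶠ m, coeff m powerSumSeries * φ m = ∑ᶠ k : ℕ+, (k : ℚ)⁻¹ * φ (Finsupp.single k 1) := by
  have hinj : Function.Injective fun k : ℕ+ => Finsupp.single k 1 :=
    fun _ _ h => (Finsupp.single_left_inj one_ne_zero).1 h
  simp only [← coeff_powerSumSeries_single]
  rw [← finsum_mem_range (f := fun m => coeff m powerSumSeries * φ m) hinj, finsum_mem_def]
  refine finsum_congr fun m => ?_
  by_cases hm : m ∈ Set.range fun k : ℕ+ => Finsupp.single k 1
  · rw [Set.indicator_of_mem hm]
  · rw [Set.indicator_of_notMem hm, coeff_powerSumSeries_eq_zero hm, zero_mul]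

theorem coeff_plethysm_powerSumSeries (hg : constantCoeff g = 0) (m : ℕ+ →₀ ℕ) :
    coeff m (plethysm powerSumSeries g) = ∑ᶠ k : ℕ+, (k : ℚ)⁻¹ * coeff m (adamsHom k g) := by
  simp only [plethysm_eq, coeff_subst (hasSubst_adamsHom hg), smul_eq_mul]
  rw [finsum_coeff_powerSumSeries_mul]
  refine finsum_congr fun k => ?_
  rw [Finsupp.prod_single_index (h := fun s e => adamsHom s g ^ e) (pow_zero _), pow_one]

theorem euler_plethysm_powerSumSeries (hg : constantCoeff g = 0) :
    euler (plethysm powerSumSeries g) = adamsSum (euler g) := by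
  ext m
  rw [coeff_euler, coeff_plethysm_powerSumSeries hg, coeff_adamsSum, ← smul_eq_mul, smul_finsum]
  refine finsum_congr fun k => ?_
  have hk := congrArg (coeff m) (euler_adamsHom k g)
  rw [coeff_euler, coeff_smul] at hk
  rw [smul_eq_mul, mul_left_comm, hk, inv_mul_cancel_left₀ (Nat.cast_ne_zero.2 k.pos.ne')]

theorem pderiv_one_plethysm_powerSumSeries (hg : constantCoeff g = 0) :
    pderiv ℚ 1 (plethysm powerSumSeries g) = pderiv ℚ 1 g := by
  ext m
  rw [coeff_pderiv, coeff_pderiv, coeff_plethysm_powerSumSeries hg, finsum_eq_single _ 1,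
    adamsHom_one]
  · simp
  · intro k hk
    have hzero := congrArg (coeff m) (pderiv_one_adamsHom hk g)
    rw [coeff_pderiv, map_zero] at hzero
    rw [(mul_eq_zero_iff_right (by positivity)).1 hzero, mul_zero]

/-- The plethystic exponential `exp (∑_{k ≥ 1} (p_k ∘ g) / k)`, that is `1 + Comm ∘ g`. -/
def plethysticExp (g : SymFun ℚ) : SymFun ℚ := 1 + plethysm Comm g

theorem plethysticExp_eq_exp_subst (hg : constantCoeff g = 0) :
    plethysticExp g = (PowerSeries.exp ℚ).subst (plethysm powerSumSeries g) := by
  have hs : PowerSeries.HasSubst powerSumSeries :=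
    PowerSeries.HasSubst.of_constantCoeff_zero constantCoeff_powerSumSeries
  have hg' := hasSubst_adamsHom hg
  rw [plethysticExp, plethysm_eq, Comm, subst_sub hg', ← coe_substAlgHom hg', map_one,
    coe_substAlgHom, add_sub_cancel, PowerSeries.subst, PowerSeries.subst,
    subst_comp_subst_apply hs.const hg']
  simp only [plethysm_eq]

theorem constantCoeff_plethysticExp (hg : constantCoeff g = 0) :
    constantCoeff (plethysticExp g) = 1 := by
  rw [plethysticExp, map_add, map_one, constantCoeff_plethysm constantCoeff_Comm hg, add_zero]

theorem plethysticExp_ne_zero (hg : constantCoeff g = 0) : plethysticExp g ≠ 0 := fun h => by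
  have := constantCoeff_plethysticExp hg
  rw [h, map_zero] at this
  exact zero_ne_one this

theorem derivation_plethysticExp {δ : Derivation ℚ (SymFun ℚ) (SymFun ℚ)}
    (hδ : LowersDegreeByAtMostOne δ) (hg : constantCoeff g = 0) :
    δ (plethysticExp g) = plethysticExp g * δ (plethysm powerSumSeries g) := by
  rw [plethysticExp_eq_exp_subst hg,
    derivation_subst hδ _ (constantCoeff_plethysm constantCoeff_powerSumSeries hg),
    PowerSeries.derivative_exp]

theorem euler_plethysticExp (hg : constantCoeff g = 0) :
    euler (plethysticExp g) = plethysticExp g * adamsSum (euler g) := by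
  rw [derivation_plethysticExp lowersDegreeByAtMostOne_euler hg, euler_plethysm_powerSumSeries hg]

theorem pderiv_one_plethysticExp (hg : constantCoeff g = 0) :
    pderiv ℚ 1 (plethysticExp g) = plethysticExp g * pderiv ℚ 1 g := by
  rw [derivation_plethysticExp lowersDegreeByAtMostOne_pderiv hg,
    pderiv_one_plethysm_powerSumSeries hg]

theorem eq_plethysticExp {E : SymFun ℚ} (hg : constantCoeff g = 0) (h0 : constantCoeff E = 1)
    (hE : euler E = E * adamsSum (euler g)) : E = plethysticExp g :=
  eq_of_euler_eq_mul (constantCoeff_adamsSum (constantCoeff_euler g)) hE (euler_plethysticExp hg)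
    (by rw [h0, constantCoeff_plethysticExp hg])

theorem plethysticExp_injOn : Set.InjOn plethysticExp {g | constantCoeff g = 0} := by
  intro f hf g hg h
  have hf' := euler_plethysticExp hf
  rw [h, euler_plethysticExp hg] at hf'
  refine eq_of_euler_eq ?_ (hf.trans hg.symm)
  exact adamsSum_injOn (constantCoeff_euler f) (constantCoeff_euler g)
    (mul_left_cancel₀ (plethysticExp_ne_zero hg) hf').symm

theorem plethysm_Comm_injOn : Set.InjOn (plethysm Comm) {g | constantCoeff g = 0} :=
  fun _ hf _ hg h => plethysticExp_injOn hf hg (congrArg (1 + ·) h)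

end Plethysm

/-! ### Suspension -/

section Suspension

section NegVars

variable {R : Type} [CommRing R]

/-- The substitution `p_k ↦ -p_k`, so that the suspension of `f` is `-negVars f`. -/
abbrev negVars : SymFun R →ₐ[R] SymFun R := rescaleAlgHom fun _ => (-1 : R)

theorem coeff_negVars (m : ℕ+ →₀ ℕ) (f : SymFun R) :
    coeff m (negVars f) = (m.prod fun _ e => (-1 : R) ^ e) * coeff m f := by
  rw [rescaleAlgHom_apply, coeff_rescale]

theorem constantCoeff_negVars (f : SymFun R) : constantCoeff (negVars f) = constantCoeff f := by
  rw [← coeff_zero_eq_constantCoeff_apply, coeff_negVars]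
  simp

theorem negVars_negVars (f : SymFun R) : negVars (negVars f) = f := by
  ext m
  rw [coeff_negVars, coeff_negVars, ← mul_assoc, ← Finsupp.prod_mul]
  simp [← mul_pow]

theorem negVars_p (k : ℕ+) : negVars (p k : SymFun R) = -p k := by
  classical
  ext m
  rw [coeff_negVars, map_neg, coeff_X]
  split_ifs with h
  · subst h; simp
  · simp

theorem negVars_euler (f : SymFun R) : negVars (euler f) = euler (negVars f) := by
  ext m
  rw [coeff_negVars, coeff_euler, coeff_euler, coeff_negVars, mul_left_comm]

theorem negVars_adamsHom (k : ℕ+) (f : SymFun R) :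
    negVars (adamsHom k f) = adamsHom k (negVars f) := by
  ext m
  rw [coeff_negVars]
  by_cases hm : m ∈ Set.range (Finsupp.mapDomain (mulLeftEmbedding k))
  · obtain ⟨m, rfl⟩ := hm
    rw [coeff_mapDomain_adamsHom, coeff_mapDomain_adamsHom, coeff_negVars,
      Finsupp.prod_mapDomain_index (fun _ => pow_zero _) fun _ _ _ => pow_add _ _ _]
  · rw [coeff_adamsHom_eq_zero f hm, coeff_adamsHom_eq_zero _ hm, mul_zero]

end NegVars

variable {f g : SymFun ℚ}

theorem suspension_eq_neg_negVars (f : SymFun ℚ) : suspension f = -negVars f := by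
  rw [suspension, rescaleAlgHom_apply]

theorem constantCoeff_suspension (hf : constantCoeff f = 0) :
    constantCoeff (suspension f) = 0 := by
  rw [suspension_eq_neg_negVars, map_neg, constantCoeff_negVars, hf, neg_zero]

theorem suspension_injective : Function.Injective suspension := by
  intro f g h
  rw [suspension_eq_neg_negVars, suspension_eq_neg_negVars, neg_inj] at h
  rw [← negVars_negVars f, h, negVars_negVars]

theorem adamsHom_suspension (k : ℕ+) (f : SymFun ℚ) :
    adamsHom k (suspension f) = suspension (adamsHom k f) := by
  rw [suspension_eq_neg_negVars, suspension_eq_neg_negVars, map_neg, negVars_adamsHom]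

theorem euler_suspension (f : SymFun ℚ) : euler (suspension f) = suspension (euler f) := by
  rw [suspension_eq_neg_negVars, suspension_eq_neg_negVars, map_neg, negVars_euler]

theorem suspension_plethysm (f : SymFun ℚ) (hg : constantCoeff g = 0) :
    suspension (plethysm f g) = plethysm (suspension f) (suspension g) := by
  have hg' := constantCoeff_suspension hg
  rw [plethysm_eq, plethysm_eq, suspension_eq_neg_negVars (subst _ f),
    suspension_eq_neg_negVars f, ← coe_substAlgHom (hasSubst_adamsHom hg'), map_neg,
    coe_substAlgHom, rescaleAlgHom_apply, rescaleAlgHom_apply, rescale_eq_subst, rescale_eq_subst,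
    subst_comp_subst_apply (hasSubst_adamsHom hg) (HasSubst.smul_X _),
    subst_comp_subst_apply (HasSubst.smul_X _) (hasSubst_adamsHom hg')]
  congr 2
  funext k
  rw [← rescale_eq_subst, ← rescaleAlgHom_apply, Pi.smul_apply',
    subst_smul (hasSubst_adamsHom hg'), subst_X (hasSubst_adamsHom hg'), neg_one_smul,
    adamsHom_suspension, suspension_eq_neg_negVars, neg_neg]

theorem adamsSum_suspension (f : SymFun ℚ) :
    adamsSum (suspension f) = suspension (adamsSum f) := by
  ext m
  rw [suspension_eq_neg_negVars (adamsSum f), map_neg, coeff_negVars, coeff_adamsSum,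
    coeff_adamsSum, ← neg_mul, ← smul_eq_mul, smul_finsum]
  refine finsum_congr fun k => ?_
  rw [adamsHom_suspension, suspension_eq_neg_negVars, map_neg, coeff_negVars, smul_eq_mul, neg_mul]

theorem plethysticExp_suspension_mul_negVars (hg : constantCoeff g = 0) :
    plethysticExp (suspension g) * negVars (plethysticExp g) = 1 := by
  have hg' := constantCoeff_suspension hg
  refine eq_of_euler_eq ?_ ?_
  · rw [Derivation.map_one_eq_zero, Derivation.leibniz, euler_plethysticExp hg', ← negVars_euler,
      euler_plethysticExp hg, euler_suspension, adamsSum_suspension,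
      suspension_eq_neg_negVars (adamsSum _), map_mul, smul_eq_mul, smul_eq_mul]
    ring
  · rw [map_mul, constantCoeff_negVars, constantCoeff_plethysticExp hg,
      constantCoeff_plethysticExp hg', mul_one, map_one]

/-- `Σ` turns `T = p₁ Exp(T)` into the equation that defines the inverse of `p₁ Exp(p₁)`. -/
theorem suspension_mul_plethysticExp (hg : constantCoeff g = 0) (h : g = p 1 * plethysticExp g) :
    suspension g * plethysticExp (suspension g) = p 1 := by
  have hs : suspension g = p 1 * negVars (plethysticExp g) := by
    conv_lhs => rw [h]
    rw [suspension_eq_neg_negVars, map_mul, negVars_p, neg_mul, neg_neg]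
  nth_rewrite 1 [hs]
  rw [mul_assoc, mul_comm (negVars _), plethysticExp_suspension_mul_negVars hg, mul_one]

end Suspension

/-! ### Cycle types -/

section CycleType

variable {α β : Type*}

theorem minimalPeriod_semiconj {f : α → α} {g : β → β} {φ : α → β} (h : Function.Semiconj φ f g)
    (hφ : Function.Injective φ) (x : α) :
    Function.minimalPeriod g (φ x) = Function.minimalPeriod f x := by
  rw [Function.minimalPeriod_eq_minimalPeriod_iff]
  intro n
  rw [Function.IsPeriodicPt, Function.IsPeriodicPt, Function.IsFixedPt, Function.IsFixedPt,
    ← (h.iterate_right n) x, hφ.eq_iff]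

theorem minimalPeriod_perm_pos [Finite α] (σ : Perm α) (x : α) :
    0 < Function.minimalPeriod σ x :=
  Function.minimalPeriod_pos_of_mem_periodicPts (σ.injective.mem_periodicPts x)

/-- The number of points lying on the cycles of length `k`. -/
def periodCount (σ : Perm α) (k : ℕ) : ℕ :=
  Nat.card {x // Function.minimalPeriod σ x = k}

theorem periodCount_permCongr (e : α ≃ β) (σ : Perm α) (k : ℕ) :
    periodCount (e.permCongr σ) k = periodCount σ k := by
  have h : Function.Semiconj e σ (e.permCongr σ) := fun y => by simp [Equiv.permCongr_apply]
  exact (Nat.card_congr (e.subtypeEquiv fun x => by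
    rw [minimalPeriod_semiconj h e.injective])).symm

theorem periodCount_eq_add [Finite α] (σ : Perm α) {q : α → Prop} (h : ∀ x, q (σ x) ↔ q x)
    (h' : ∀ x, ¬ q (σ x) ↔ ¬ q x) (k : ℕ) : periodCount σ k =
      periodCount (σ.subtypePerm h) k + periodCount (σ.subtypePerm (p := fun x => ¬ q x) h') k := by
  classical
  have hperiod : ∀ {r : α → Prop} (hr : ∀ x, r (σ x) ↔ r x) (x : {x // r x}),
      Function.minimalPeriod (σ.subtypePerm hr) x = Function.minimalPeriod σ (x : α) :=
    fun hr x => (minimalPeriod_semiconj (f := σ.subtypePerm hr) (g := σ) (fun _ => rfl)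
      Subtype.val_injective x).symm
  simp only [periodCount, hperiod]
  rw [← Nat.card_sum]
  refine Nat.card_congr ((Equiv.sumCompl fun x : {x // Function.minimalPeriod σ x = k} =>
    q x).symm.trans (Equiv.sumCongr ?_ ?_))
  · exact Equiv.subtypeSubtypeEquivSubtypeInter _ _ |>.trans
      ((Equiv.subtypeEquivRight fun _ => and_comm).trans
        (Equiv.subtypeSubtypeEquivSubtypeInter _ _).symm)
  · exact Equiv.subtypeSubtypeEquivSubtypeInter _ (fun x => ¬ q x) |>.trans
      ((Equiv.subtypeEquivRight fun _ => and_comm).trans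
        (Equiv.subtypeSubtypeEquivSubtypeInter _ _).symm)

theorem periodCount_eq_card_filter [Fintype α] (σ : Perm α) (k : ℕ) :
    periodCount σ k = (Finset.univ.filter fun x => Function.minimalPeriod σ x = k).card := by
  rw [periodCount, Nat.card_eq_fintype_card, Fintype.card_subtype]

section Parts

variable [Fintype α] [DecidableEq α] (σ : Perm α)

theorem minimalPeriod_eq_card_support_cycleOf {x : α} (hx : σ x ≠ x) :
    Function.minimalPeriod σ x = (σ.cycleOf x).support.card := by
  have hc : (σ.cycleOf x).IsCycle := Perm.isCycle_cycleOf σ hx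
  have hx' : σ.cycleOf x x ≠ x := by rwa [Perm.cycleOf_apply_self]
  refine Nat.dvd_right_iff_eq.1 fun n => ?_
  rw [← Function.isPeriodicPt_iff_minimalPeriod_dvd, ← hc.orderOf, orderOf_dvd_iff_pow_eq_one,
    hc.pow_eq_one_iff' hx', Perm.cycleOf_pow_apply_self, Function.IsPeriodicPt,
    Function.IsFixedPt, ← Perm.iterate_eq_pow]

theorem filter_minimalPeriod_eq_biUnion {k : ℕ} (hk : k ≠ 1) :
    (Finset.univ.filter fun x => Function.minimalPeriod σ x = k) =
      (σ.cycleFactorsFinset.filter fun c => k = c.support.card).biUnion fun c => c.support := by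
  ext x
  simp only [Finset.mem_filter, Finset.mem_univ, true_and, Finset.mem_biUnion]
  constructor
  · intro h
    have hx : σ x ≠ x := fun h1 => hk (h ▸ Function.minimalPeriod_eq_one_iff_isFixedPt.2 h1)
    refine ⟨σ.cycleOf x,
      ⟨Perm.cycleOf_mem_cycleFactorsFinset_iff.2 (Perm.mem_support.2 hx), ?_⟩, ?_⟩
    · rw [← minimalPeriod_eq_card_support_cycleOf σ hx, h]
    · rwa [Perm.mem_support, Perm.cycleOf_apply_self]
  · rintro ⟨c, ⟨hc, rfl⟩, hx⟩
    rw [Perm.cycle_is_cycleOf hx hc, minimalPeriod_eq_card_support_cycleOf σ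
      (Perm.mem_support.1 (Perm.mem_cycleFactorsFinset_support_le hc hx))]

theorem periodCount_one : periodCount σ 1 = σ.partition.parts.count 1 := by
  rw [periodCount_eq_card_filter, Perm.parts_partition, Multiset.count_add,
    Multiset.count_replicate, if_pos rfl, Multiset.count_eq_zero.2, zero_add, ← Finset.card_compl]
  · congr 1
    ext x
    simp [Function.minimalPeriod_eq_one_iff_isFixedPt, Function.IsFixedPt]
  · exact fun h => absurd (Perm.two_le_of_mem_cycleType h) (by norm_num)

theorem mul_count_parts (k : ℕ) (hk : 0 < k) :
    k * σ.partition.parts.count k = periodCount σ k := by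
  rcases eq_or_ne k 1 with rfl | h1
  · rw [periodCount_one, one_mul]
  rw [periodCount_eq_card_filter, filter_minimalPeriod_eq_biUnion σ h1, Finset.card_biUnion,
    Finset.sum_congr rfl fun c hc => (Finset.mem_filter.1 hc).2.symm, Finset.sum_const,
    smul_eq_mul, mul_comm, Perm.parts_partition, Multiset.count_add, Multiset.count_replicate,
    if_neg h1.symm, add_zero, Perm.cycleType_def, Multiset.count_map]
  · rfl
  · intro c hc d hd hcd
    exact (Perm.cycleFactorsFinset_pairwise_disjoint σ (Finset.mem_filter.1 hc).1
      (Finset.mem_filter.1 hd).1 hcd).disjoint_support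

end Parts

/-- The exponents of the monomial `p_{λ₁} p_{λ₂} ⋯` of the cycle type `λ` of `σ`: the extension
of `cycleMonomial` to the permutations of all finite sets. -/
def cycleExponents [Finite α] (σ : Perm α) : ℕ+ →₀ ℕ :=
  letI := Fintype.ofFinite α
  letI := Classical.decEq α
  (Multiset.toFinsupp σ.partition.parts).comapDomain (fun k : ℕ+ => (k : ℕ))
    PNat.coe_injective.injOn

theorem mul_cycleExponents [Finite α] (σ : Perm α) (k : ℕ+) :
    k * cycleExponents σ k = periodCount σ k := by
  let := Fintype.ofFinite α
  let := Classical.decEq α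
  exact mul_count_parts σ k k.pos

theorem cycleExponents_eq [Finite α] {σ : Perm α} {m : ℕ+ →₀ ℕ}
    (h : ∀ k : ℕ+, periodCount σ k = k * m k) : cycleExponents σ = m := by
  ext k
  exact Nat.eq_of_mul_eq_mul_left k.pos ((mul_cycleExponents σ k).trans (h k))

theorem cycleExponents_fin {n : ℕ} (σ : Perm (Fin n)) : cycleExponents σ = cycleMonomial σ :=
  cycleExponents_eq fun k => (mul_count_parts σ k k.pos).symm

theorem cycleExponents_permCongr [Finite α] [Finite β] (e : α ≃ β) (σ : Perm α) :
    cycleExponents (e.permCongr σ) = cycleExponents σ :=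
  cycleExponents_eq fun k => by rw [periodCount_permCongr, mul_cycleExponents]

theorem cycleExponents_eq_add [Finite α] (σ : Perm α) {q : α → Prop} (h : ∀ x, q (σ x) ↔ q x)
    (h' : ∀ x, ¬ q (σ x) ↔ ¬ q x) : cycleExponents σ =
      cycleExponents (σ.subtypePerm h) + cycleExponents (σ.subtypePerm (p := fun x => ¬ q x) h') :=
  cycleExponents_eq fun k => by
    rw [Finsupp.add_apply, mul_add, mul_cycleExponents, mul_cycleExponents, ← periodCount_eq_add]

theorem degree_cycleExponents [Finite α] (σ : Perm α) : degree (cycleExponents σ) = Nat.card α := by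
  classical
  let := Fintype.ofFinite α
  let period (x : α) : ℕ+ := ⟨Function.minimalPeriod σ x, minimalPeriod_perm_pos σ x⟩
  have hcount (k : ℕ+) : k * cycleExponents σ k = {x | period x = k}.ncard := by
    rw [mul_cycleExponents, periodCount, ← Nat.card_coe_set_eq]
    exact Nat.card_congr (Equiv.subtypeEquivRight fun x =>
      ⟨fun h => PNat.eq h, congrArg PNat.val⟩)
  rw [degree, Finsupp.weight_apply, Finsupp.sum, Nat.card_eq_fintype_card, ← Finset.card_univ,
    Finset.card_eq_sum_card_fiberwise (f := period) (t := (cycleExponents σ).support)]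
  · refine Finset.sum_congr rfl fun k _ => ?_
    rw [smul_eq_mul, mul_comm, hcount, ← Set.ncard_coe_finset]
    simp
  · intro x _
    rw [Finset.mem_coe, Finsupp.mem_support_iff]
    intro h0
    have hx := hcount (period x)
    rw [h0, mul_zero, eq_comm, Set.ncard_eq_zero] at hx
    exact (hx ▸ rfl : x ∈ (∅ : Set α))

end CycleType

/-! ### Cycle index series -/

section CycleIndex

/-- A rational number attached to every permutation of every set. -/
abbrev PermFun : Type 1 := ∀ α : Type, Perm α → ℚ

/-- Invariance under bijections. -/
def IsClassFun (F : PermFun) : Prop :=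
  ∀ (α β : Type) (e : α ≃ β) (σ : Perm α), F β (e.permCongr σ) = F α σ

/-- The sum of `F` over the permutations of cycle type `m`. -/
def cycleTypeSum (F : PermFun) (α : Type) [Fintype α] [DecidableEq α] (m : ℕ+ →₀ ℕ) : ℚ :=
  ∑ σ : Perm α, if cycleExponents σ = m then F α σ else 0

/-- The cycle index series `∑_n (1/n!) ∑_{σ ∈ 𝔖_n} F(σ) p_{cycle type of σ}`: the Frobenius
characteristic, for functions which need not be characters. -/
def cycleIndex (F : PermFun) : SymFun ℚ := fun m =>
  ((degree m).factorial : ℚ)⁻¹ * cycleTypeSum F (Fin (degree m)) m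

theorem coeff_cycleIndex (F : PermFun) (m : ℕ+ →₀ ℕ) :
    coeff m (cycleIndex F) =
      ((degree m).factorial : ℚ)⁻¹ * cycleTypeSum F (Fin (degree m)) m := rfl

theorem factorial_mul_coeff_cycleIndex (F : PermFun) {m : ℕ+ →₀ ℕ} {n : ℕ} (h : degree m = n) :
    (n.factorial : ℚ) * coeff m (cycleIndex F) = cycleTypeSum F (Fin n) m := by
  subst h
  rw [coeff_cycleIndex, mul_inv_cancel_left₀ (Nat.cast_ne_zero.2 (Nat.factorial_ne_zero _))]

theorem sum_eq_factorial_mul_sum_coeff_cycleIndex (F : PermFun) {n : ℕ} {S : Finset (ℕ+ →₀ ℕ)}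
    (hS : ∀ m ∈ S, degree m = n) (hS' : ∀ σ : Perm (Fin n), cycleExponents σ ∈ S) :
    ∑ σ : Perm (Fin n), F _ σ = (n.factorial : ℚ) * ∑ m ∈ S, coeff m (cycleIndex F) := by
  classical
  rw [Finset.mul_sum, Finset.sum_congr rfl fun m hm => factorial_mul_coeff_cycleIndex F (hS m hm)]
  simp only [cycleTypeSum]
  rw [Finset.sum_comm]
  exact Finset.sum_congr rfl fun σ _ => by rw [Finset.sum_ite_eq, if_pos (hS' σ)]

theorem IsClassFun.cycleTypeSum_eq {F : PermFun} (hF : IsClassFun F) (α : Type) [Fintype α]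
    [DecidableEq α] (m : ℕ+ →₀ ℕ) : cycleTypeSum F α m =
      if degree m = Fintype.card α then ((Fintype.card α).factorial : ℚ) * coeff m (cycleIndex F)
      else 0 := by
  split_ifs with h
  · rw [factorial_mul_coeff_cycleIndex F h]
    exact Fintype.sum_equiv (Fintype.equivFin α).permCongr _ _ fun σ => by
      rw [cycleExponents_permCongr, hF]
  · refine Finset.sum_eq_zero fun σ _ => if_neg ?_
    rintro rfl
    exact h (by rw [degree_cycleExponents, Nat.card_eq_fintype_card])

theorem euler_cycleIndex (F : PermFun) :
    euler (cycleIndex F) = cycleIndex fun α σ => Nat.card α * F α σ := by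
  ext m
  rw [coeff_euler, coeff_cycleIndex, coeff_cycleIndex, cycleTypeSum, cycleTypeSum, mul_left_comm,
    Finset.mul_sum]
  simp only [mul_ite, mul_zero, Nat.card_eq_fintype_card, Fintype.card_fin]

theorem cycleIndex_finset_sum {ι : Type*} (s : Finset ι) (F : ι → PermFun) :
    (cycleIndex fun α σ => ∑ i ∈ s, F i α σ) = ∑ i ∈ s, cycleIndex (F i) := by
  ext m
  rw [map_sum]
  simp only [coeff_cycleIndex, cycleTypeSum]
  rw [← Finset.mul_sum, Finset.sum_comm]
  congr 1
  refine Finset.sum_congr rfl fun σ _ => ?_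
  split_ifs
  · rfl
  · rw [Finset.sum_const_zero]

/-- The finite sets stable under a permutation. -/
abbrev StableFinset {α : Type*} (σ : Perm α) : Type _ := {s : Finset α // ∀ x, σ x ∈ s ↔ x ∈ s}

/-- The restriction of a permutation to a stable set. -/
abbrev StableFinset.perm {α : Type*} {σ : Perm α} (s : StableFinset σ) : Perm {x // x ∈ s.1} :=
  σ.subtypePerm s.2

/-- The restriction of a permutation to the complement of a stable set. -/
abbrev StableFinset.complPerm {α : Type*} {σ : Perm α} (s : StableFinset σ) :
    Perm {x // x ∉ s.1} :=
  σ.subtypePerm fun x => not_congr (s.2 x)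

/-- A permutation with a stable set is a pair of permutations of this set and of its complement. -/
def stableFinsetEquiv (α : Type*) [DecidableEq α] : (Σ σ : Perm α, StableFinset σ) ≃
    Σ s : Finset α, Perm {x // x ∈ s} × Perm {x // x ∉ s} where
  toFun x := ⟨x.2.1, x.2.perm, x.2.complPerm⟩
  invFun x := ⟨Perm.subtypeCongr x.2.1 x.2.2, x.1, fun y => by
    by_cases hy : y ∈ x.1
    · rw [Perm.subtypeCongr.left_apply _ _ hy]
      exact iff_of_true (x.2.1 ⟨y, hy⟩).2 hy
    · rw [Perm.subtypeCongr.right_apply _ _ hy]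
      exact iff_of_false (x.2.2 ⟨y, hy⟩).2 hy⟩
  left_inv := by
    rintro ⟨σ, s, hs⟩
    have hσ : Perm.subtypeCongr (StableFinset.perm ⟨s, hs⟩) (StableFinset.complPerm ⟨s, hs⟩)
        = σ := by
      ext x
      by_cases hx : x ∈ s
      · simp [Perm.subtypeCongr.left_apply _ _ hx]
      · simp [Perm.subtypeCongr.right_apply _ _ hx]
    exact Sigma.subtype_ext hσ rfl
  right_inv := by
    rintro ⟨s, τ, τ'⟩
    refine Sigma.ext rfl (heq_of_eq (Prod.ext ?_ ?_))
    · ext x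
      simp [Perm.subtypeCongr.left_apply _ _ x.2]
    · ext x
      simp [Perm.subtypeCongr.right_apply _ _ x.2]

/-- The product of functions of permutations whose cycle index series is the product of the
cycle index series: the character of an induced representation. -/
def prodFun (A B : PermFun) {α : Type} [Fintype α] [DecidableEq α] (σ : Perm α) : ℚ :=
  ∑ s : StableFinset σ, A _ s.perm * B _ s.complPerm

theorem sum_antidiagonal_cycleTypeSum (A B : PermFun) (α β : Type) [Fintype α] [DecidableEq α]
    [Fintype β] [DecidableEq β] (m : ℕ+ →₀ ℕ) :
    ∑ x ∈ Finset.HasAntidiagonal.antidiagonal m, cycleTypeSum A α x.1 * cycleTypeSum B β x.2 =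
      ∑ τ : Perm α × Perm β,
        if cycleExponents τ.1 + cycleExponents τ.2 = m then A α τ.1 * B β τ.2 else 0 := by
  simp only [cycleTypeSum, Finset.sum_mul_sum, ← Fintype.sum_prod_type']
  rw [Finset.sum_comm]
  refine Finset.sum_congr rfl fun τ _ => ?_
  simp only [ite_zero_mul_ite_zero, ← Prod.mk_inj, Prod.mk.eta]
  rw [Finset.sum_ite_eq]
  simp only [Finset.HasAntidiagonal.mem_antidiagonal]

theorem sum_prodFun (A B : PermFun) {α : Type} [Fintype α] [DecidableEq α] (m : ℕ+ →₀ ℕ) :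
    (∑ σ : Perm α, if cycleExponents σ = m then prodFun A B σ else 0) =
      ∑ s : Finset α, ∑ x ∈ Finset.HasAntidiagonal.antidiagonal m,
        cycleTypeSum A {x // x ∈ s} x.1 * cycleTypeSum B {x // x ∉ s} x.2 := by
  have hσ (σ : Perm α) : (if cycleExponents σ = m then prodFun A B σ else 0) =
      ∑ s : StableFinset σ, if cycleExponents σ = m then A _ s.perm * B _ s.complPerm else 0 := by
    split_ifs
    · rfl
    · rw [Finset.sum_const_zero]
  simp only [hσ, sum_antidiagonal_cycleTypeSum]
  rw [← Fintype.sum_sigma', ← Fintype.sum_sigma']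
  refine Fintype.sum_equiv (stableFinsetEquiv α) _ _ fun x => ?_
  rw [cycleExponents_eq_add x.1 x.2.2 fun y => not_congr (x.2.2 y)]
  rfl

theorem cycleTypeSum_mul_cycleTypeSum {A B : PermFun} (hA : IsClassFun A) (hB : IsClassFun B)
    {α : Type} [Fintype α] [DecidableEq α] {a b : ℕ+ →₀ ℕ}
    (hab : degree a + degree b = Fintype.card α) (s : Finset α) :
    cycleTypeSum A {x // x ∈ s} a * cycleTypeSum B {x // x ∉ s} b =
      if s.card = degree a then ((degree a).factorial * (degree b).factorial : ℚ) *
        (coeff a (cycleIndex A) * coeff b (cycleIndex B)) else 0 := by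
  have hs : s.card ≤ Fintype.card α := s.card_le_univ
  rw [hA.cycleTypeSum_eq, hB.cycleTypeSum_eq, Fintype.card_subtype_compl, Fintype.card_coe]
  by_cases h : s.card = degree a
  · rw [if_pos h.symm, if_pos h, if_pos (by omega), h,
      show Fintype.card α - degree a = degree b by omega, mul_mul_mul_comm]
  · rw [if_neg (Ne.symm h), if_neg h, zero_mul]

theorem factorial_mul_coeff_cycleIndex_mul {A B : PermFun} (hA : IsClassFun A)
    (hB : IsClassFun B) (m : ℕ+ →₀ ℕ) :
    ((degree m).factorial : ℚ) * coeff m (cycleIndex A * cycleIndex B) =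
      ∑ σ : Perm (Fin (degree m)), if cycleExponents σ = m then prodFun A B σ else 0 := by
  classical
  rw [sum_prodFun, Finset.sum_comm, coeff_mul, Finset.mul_sum]
  refine Finset.sum_congr rfl fun x hx => ?_
  have hd := degree_add x.1 x.2
  rw [Finset.HasAntidiagonal.mem_antidiagonal.1 hx] at hd
  have hchoose := Nat.add_choose_mul_factorial_mul_factorial (degree x.1) (degree x.2)
  rw [← Nat.choose_symm_add] at hchoose
  rw [Finset.sum_congr rfl fun s _ => cycleTypeSum_mul_cycleTypeSum hA hB
      (by rw [Fintype.card_fin, hd]) s, ← Finset.sum_filter, Finset.sum_const,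
    ← Finset.powerset_univ, ← Finset.powersetCard_eq_filter, Finset.card_powersetCard,
    Finset.card_univ, Fintype.card_fin, nsmul_eq_mul, ← mul_assoc, hd, ← hchoose]
  push_cast
  ring

theorem cycleIndex_eq_mul {A B F : PermFun} (hA : IsClassFun A) (hB : IsClassFun B)
    (hF : ∀ n (σ : Perm (Fin n)), F _ σ = prodFun A B σ) :
    cycleIndex F = cycleIndex A * cycleIndex B := by
  ext m
  refine mul_left_cancel₀ (Nat.cast_ne_zero (R := ℚ).2 (degree m).factorial_ne_zero) ?_
  rw [factorial_mul_coeff_cycleIndex F rfl, factorial_mul_coeff_cycleIndex_mul hA hB, cycleTypeSum]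
  simp only [hF]

end CycleIndex

/-! ### Cyclic colorings and plethysm by power sums -/

section CyclicColoring

variable {α β : Type*} {σ : Perm α} {d : ℕ+}

/-- The colorings in `ℤ/d` whose value increases by one along `σ`. -/
abbrev CyclicColoring (σ : Perm α) (d : ℕ+) : Type _ :=
  {c : α → ZMod d // ∀ x, c (σ x) = c x + 1}

theorem CyclicColoring.pow_apply (c : CyclicColoring σ d) (n : ℕ) (x : α) :
    c.1 ((σ ^ n) x) = c.1 x + n := by
  induction n with
  | zero => simp
  | succ n ih => rw [pow_succ', Perm.mul_apply, c.2, ih]; push_cast; ring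

/-- The permutation induced by `σ ^ d` on the points of color zero. -/
def CyclicColoring.rootPerm (c : CyclicColoring σ d) : Perm {x // c.1 x = 0} :=
  (σ ^ (d : ℕ)).subtypePerm fun x => by rw [c.pow_apply, ZMod.natCast_self, add_zero]

theorem CyclicColoring.coe_rootPerm_apply (c : CyclicColoring σ d) (x : {x // c.1 x = 0}) :
    (c.rootPerm x : α) = (σ ^ (d : ℕ)) x := rfl

theorem natCast_val_add_one (j : ZMod d) : ((j.val + 1 : ℕ) : ZMod d) = j + 1 := by
  push_cast
  rw [ZMod.natCast_zmod_val]

theorem val_add_one_of_ne_zero {j : ZMod d} (h : j + 1 ≠ 0) : (j + 1).val = j.val + 1 := by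
  rw [← natCast_val_add_one, ZMod.val_natCast, Nat.mod_eq_of_lt]
  refine (Nat.succ_le_of_lt j.val_lt).lt_of_ne fun hd => h ?_
  rw [← natCast_val_add_one, ← Nat.succ_eq_add_one, hd, ZMod.natCast_self]

theorem val_add_one_of_eq_zero {j : ZMod d} (h : j + 1 = 0) : j.val + 1 = d := by
  rw [← natCast_val_add_one, ZMod.natCast_eq_zero_iff] at h
  exact le_antisymm j.val_lt (Nat.le_of_dvd j.val.succ_pos h)

/-- The permutation of `β × ℤ/d` which moves cyclically the copies of `β` and whose `d`-th power
acts as `τ` on each of them. -/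
def cyclicPerm (τ : Perm β) (d : ℕ+) : Perm (β × ZMod d) where
  toFun x := (if x.2 + 1 = 0 then τ x.1 else x.1, x.2 + 1)
  invFun x := (if x.2 = 0 then τ.symm x.1 else x.1, x.2 - 1)
  left_inv x := by
    refine Prod.ext ?_ (by simp)
    by_cases h : x.2 + 1 = 0 <;> simp [h]
  right_inv x := by
    refine Prod.ext ?_ (by simp)
    by_cases h : x.2 = 0 <;> simp [h]

section CyclicPerm

variable (τ : Perm β) (d : ℕ+) (i : β) (j : ZMod d)

theorem cyclicPerm_apply :
    cyclicPerm τ d (i, j) = (if j + 1 = 0 then τ i else i, j + 1) := rfl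

theorem snd_cyclicPerm_pow (x : β × ZMod d) (n : ℕ) : ((cyclicPerm τ d ^ n) x).2 = x.2 + n :=
  CyclicColoring.pow_apply (σ := cyclicPerm τ d) ⟨Prod.snd, fun _ => rfl⟩ n x

theorem cyclicPerm_pow_of_lt {v : ℕ} (hv : v < d) :
    (cyclicPerm τ d ^ v) (i, 0) = (i, (v : ZMod d)) := by
  induction v with
  | zero => simp
  | succ v ih =>
    rw [pow_succ', Perm.mul_apply, ih (by omega), cyclicPerm_apply, if_neg, Nat.cast_succ]
    rw [← Nat.cast_succ, ZMod.natCast_eq_zero_iff]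
    exact Nat.not_dvd_of_pos_of_lt v.succ_pos hv

theorem cyclicPerm_pow_val : (cyclicPerm τ d ^ j.val) (i, 0) = (i, j) := by
  rw [cyclicPerm_pow_of_lt τ d i (ZMod.val_lt j), ZMod.natCast_zmod_val]

theorem cyclicPerm_pow_zero : (cyclicPerm τ d ^ (d : ℕ)) (i, 0) = (τ i, 0) := by
  have h : (-1 : ZMod d) + 1 = 0 := neg_add_cancel 1
  have hd : cyclicPerm τ d ^ (d : ℕ) = cyclicPerm τ d ^ ((-1 : ZMod d).val + 1) :=
    congrArg _ (val_add_one_of_eq_zero h).symm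
  rw [hd, pow_succ', Perm.mul_apply, cyclicPerm_pow_val, cyclicPerm_apply, if_pos h, h]

theorem cyclicPerm_pow_self : (cyclicPerm τ d ^ (d : ℕ)) (i, j) = (τ i, j) := by
  rw [← cyclicPerm_pow_val τ d i j, ← Perm.mul_apply, ← pow_add, add_comm, pow_add, Perm.mul_apply,
    cyclicPerm_pow_zero, cyclicPerm_pow_val]

theorem cyclicPerm_pow_mul (n : ℕ) :
    (cyclicPerm τ d ^ ((d : ℕ) * n)) (i, j) = ((τ ^ n) i, j) := by
  induction n with
  | zero => simp
  | succ n ih =>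
    rw [mul_add, mul_one, add_comm, pow_add, Perm.mul_apply, ih, cyclicPerm_pow_self, pow_succ',
      Perm.mul_apply]

theorem minimalPeriod_cyclicPerm (x : β × ZMod d) :
    Function.minimalPeriod (cyclicPerm τ d) x = d * Function.minimalPeriod τ x.1 := by
  obtain ⟨i, j⟩ := x
  refine Nat.dvd_right_iff_eq.1 fun n => ?_
  rw [← Function.isPeriodicPt_iff_minimalPeriod_dvd, Function.IsPeriodicPt, Function.IsFixedPt,
    Perm.iterate_eq_pow]
  by_cases hd : (d : ℕ) ∣ n
  · obtain ⟨q, rfl⟩ := hd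
    rw [cyclicPerm_pow_mul, Nat.mul_dvd_mul_iff_left d.pos,
      ← Function.isPeriodicPt_iff_minimalPeriod_dvd, Function.IsPeriodicPt, Function.IsFixedPt,
      Perm.iterate_eq_pow, Prod.mk_inj, and_iff_left rfl]
  · refine iff_of_false (fun h => hd ?_) fun h => hd ((Dvd.intro _ rfl).trans h)
    rw [← ZMod.natCast_eq_zero_iff]
    simpa [snd_cyclicPerm_pow] using congrArg Prod.snd h

theorem cycleExponents_cyclicPerm [Finite β] :
    cycleExponents (cyclicPerm τ d) = (cycleExponents τ).mapDomain (mulLeftEmbedding d) := by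
  rw [← Finsupp.embDomain_eq_mapDomain]
  refine cycleExponents_eq fun k => ?_
  by_cases hk : k ∈ Set.range (mulLeftEmbedding d)
  · obtain ⟨k, rfl⟩ := hk
    have hdk : ((mulLeftEmbedding d k : ℕ+) : ℕ) = d * k := rfl
    rw [Finsupp.embDomain_apply_self, hdk, mul_assoc, mul_cycleExponents, periodCount, periodCount]
    simp only [minimalPeriod_cyclicPerm, Nat.mul_right_inj d.pos.ne']
    rw [← Nat.card_congr (Equiv.prodSubtypeFstEquivSubtypeProd
        (p := fun x => Function.minimalPeriod τ x = k) (β := ZMod d)).symm,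
      Nat.card_prod, Nat.card_zmod, mul_comm]
  · rw [Finsupp.embDomain_of_notMem_range _ _ _ hk, mul_zero, periodCount, Nat.card_eq_zero]
    refine .inl ⟨?_⟩
    rintro ⟨x, hx⟩
    rw [minimalPeriod_cyclicPerm] at hx
    exact hk ⟨⟨_, minimalPeriod_perm_pos τ x.1⟩, PNat.coe_injective hx⟩

end CyclicPerm

namespace CyclicColoring

theorem apply_pow_val (c : CyclicColoring σ d) (x : {x // c.1 x = 0}) (j : ZMod d) :
    c.1 ((σ ^ j.val) x) = j := by
  rw [c.pow_apply, x.2, zero_add, ZMod.natCast_zmod_val]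

/-- The coordinates given by a cyclic coloring and an enumeration of the points of color zero. -/
def coords (c : CyclicColoring σ d) (e : β ≃ {x // c.1 x = 0}) : β × ZMod d ≃ α :=
  Equiv.ofBijective (fun x => (σ ^ x.2.val) (e x.1)) (by
    constructor
    · rintro ⟨i, j⟩ ⟨i', j'⟩ h
      obtain rfl : j = j' := by simpa only [apply_pow_val] using congrArg c.1 h
      exact Prod.ext (e.injective (Subtype.ext (by simpa using h))) rfl
    · intro y
      have h0 : c.1 ((σ ^ (c.1 y).val).symm y) = 0 := by
        have := c.pow_apply (c.1 y).val ((σ ^ (c.1 y).val).symm y)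
        rw [Equiv.apply_symm_apply, ZMod.natCast_zmod_val] at this
        simpa using this
      exact ⟨(e.symm ⟨_, h0⟩, c.1 y), by simp⟩)

variable (c : CyclicColoring σ d) (e : β ≃ {x // c.1 x = 0})

theorem coords_apply (i : β) (j : ZMod d) : c.coords e (i, j) = (σ ^ j.val) (e i) := rfl

theorem apply_coords (x : β × ZMod d) : c.1 (c.coords e x) = x.2 := c.apply_pow_val _ _

theorem permCongr_coords :
    (c.coords e).permCongr (cyclicPerm (e.symm.permCongr c.rootPerm) d) = σ := by
  ext y
  obtain ⟨⟨i, j⟩, rfl⟩ := (c.coords e).surjective y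
  rw [Equiv.permCongr_apply, Equiv.symm_apply_apply, cyclicPerm_apply, coords_apply, coords_apply,
    ← Perm.mul_apply, ← pow_succ']
  by_cases h : j + 1 = 0
  · rw [if_pos h, h, val_add_one_of_eq_zero h, ZMod.val_zero, pow_zero, Perm.one_apply,
      Equiv.permCongr_apply, Equiv.symm_symm, Equiv.apply_symm_apply, coe_rootPerm_apply]
  · rw [if_neg h, val_add_one_of_ne_zero h]

theorem cycleExponents_eq [Finite α] :
    cycleExponents σ = (cycleExponents c.rootPerm).mapDomain (mulLeftEmbedding d) := by
  conv_lhs => rw [← c.permCongr_coords (Equiv.refl _)]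
  rw [cycleExponents_permCongr, cycleExponents_cyclicPerm]
  rfl

end CyclicColoring

theorem permCongr_pow_apply (e : α ≃ β) (σ : Perm α) (n : ℕ) (x : α) :
    (e.permCongr σ ^ n) (e x) = e ((σ ^ n) x) := by
  have h : e.permCongr σ ^ n = e.permCongr (σ ^ n) := (map_pow e.permCongrHom σ n).symm
  rw [h, Equiv.permCongr_apply, Equiv.symm_apply_apply]

/-- The permutations with a cyclic coloring and an enumeration of the points of color zero. -/
abbrev EnumColoring (α β : Type*) (d : ℕ+) : Type _ :=
  Σ σ : Perm α, Σ c : CyclicColoring σ d, β ≃ {x // c.1 x = 0}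

namespace EnumColoring

/-- Coordinates in which the permutation is `cyclicPerm τ d`, together with `τ`. -/
def toPair (x : EnumColoring α β d) : (β × ZMod d ≃ α) × Perm β :=
  (x.2.1.coords x.2.2, x.2.2.symm.permCongr x.2.1.rootPerm)

theorem toPair_injective : Function.Injective (toPair : EnumColoring α β d → _) := by
  rintro ⟨σ, c, e⟩ ⟨σ', c', e'⟩ h
  have hcoords : c.coords e = c'.coords e' := congrArg Prod.fst h
  have hperm : e.symm.permCongr c.rootPerm = e'.symm.permCongr c'.rootPerm := congrArg Prod.snd h
  obtain rfl : σ = σ' := by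
    rw [← c.permCongr_coords e, hcoords, hperm, c'.permCongr_coords e']
  obtain rfl : c = c' := by
    refine Subtype.ext (funext fun y => ?_)
    obtain ⟨x, rfl⟩ := (c.coords e).surjective y
    conv_rhs => rw [hcoords]
    rw [c.apply_coords, c'.apply_coords]
  obtain rfl : e = e' := by
    refine Equiv.ext fun i => Subtype.ext ?_
    simpa [CyclicColoring.coords_apply] using Equiv.congr_fun hcoords (i, 0)
  rfl

/-- The enumerated cyclic coloring with given coordinates. -/
def ofPair (f : β × ZMod d ≃ α) (τ : Perm β) : EnumColoring α β d :=
  ⟨f.permCongr (cyclicPerm τ d),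
    ⟨fun y => (f.symm y).2, fun y => by
      simp only [Equiv.permCongr_apply, Equiv.symm_apply_apply]
      rfl⟩,
    { toFun := fun i => ⟨f (i, 0), congrArg Prod.snd (f.symm_apply_apply (i, 0))⟩
      invFun := fun y => (f.symm y).1
      left_inv := fun i => congrArg Prod.fst (f.symm_apply_apply (i, 0))
      right_inv := fun y => Subtype.ext (by
        rw [← Equiv.eq_symm_apply]
        exact Prod.ext rfl y.2.symm) }⟩

theorem toPair_ofPair (f : β × ZMod d ≃ α) (τ : Perm β) : toPair (ofPair f τ) = (f, τ) := by
  set x := ofPair f τ with hx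
  have he (i : β) : (x.2.2 i : α) = f (i, 0) := rfl
  refine Prod.ext (Equiv.ext ?_) (Equiv.ext fun i => x.2.2.injective (Subtype.ext ?_))
  · rintro ⟨i, j⟩
    change x.2.1.coords x.2.2 (i, j) = f (i, j)
    rw [CyclicColoring.coords_apply, he, hx, ofPair, permCongr_pow_apply, cyclicPerm_pow_val]
  · change (x.2.2 (x.2.2.symm.permCongr x.2.1.rootPerm i) : α) = x.2.2 (τ i)
    rw [Equiv.permCongr_apply, Equiv.symm_symm, Equiv.apply_symm_apply,
      CyclicColoring.coe_rootPerm_apply, he, he, hx, ofPair, permCongr_pow_apply,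
      cyclicPerm_pow_zero]

theorem toPair_bijective : Function.Bijective (toPair : EnumColoring α β d → _) :=
  ⟨toPair_injective, fun x => ⟨ofPair x.1 x.2, toPair_ofPair x.1 x.2⟩⟩

end EnumColoring

/-- The class function whose cycle index series is the plethysm `p_d ∘ F`. -/
def adamsFun (d : ℕ+) (F : PermFun) : PermFun := fun _ σ =>
  ∑ᶠ c : CyclicColoring σ d, F {x // c.1 x = 0} c.rootPerm

/-- Transport of cyclic colorings along a bijection. -/
def CyclicColoring.permCongr (e : α ≃ β) (σ : Perm α) (d : ℕ+) :
    CyclicColoring σ d ≃ CyclicColoring (e.permCongr σ) d :=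
  (Equiv.arrowCongr e (Equiv.refl (ZMod d))).subtypeEquiv fun c =>
    e.forall_congr fun x => by simp [Equiv.arrowCongr_apply]

theorem IsClassFun.adamsFun {F : PermFun} (hF : IsClassFun F) (d : ℕ+) :
    IsClassFun (adamsFun d F) := by
  intro α β e σ
  let f := CyclicColoring.permCongr e σ d
  refine (finsum_eq_of_bijective f f.bijective fun c => ?_).symm
  let e' : {x // c.1 x = 0} ≃ {y // (f c).1 y = 0} := e.subtypeEquiv fun x => by
    change _ ↔ c.1 (e.symm (e x)) = 0
    rw [Equiv.symm_apply_apply]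
  rw [← hF _ _ e' c.rootPerm]
  congr 1
  refine Equiv.ext fun y => Subtype.ext ?_
  obtain ⟨x, rfl⟩ := e'.surjective y
  rw [Equiv.permCongr_apply, Equiv.symm_apply_apply, (f c).coe_rootPerm_apply]
  exact (permCongr_pow_apply e σ d x).symm

theorem sum_enumColoring {α β : Type*} [Fintype α] [DecidableEq α] [Fintype β] [DecidableEq β]
    (d : ℕ+) [∀ σ : Perm α, Fintype (CyclicColoring σ d)]
    [∀ (σ : Perm α) (c : CyclicColoring σ d), Fintype {x // c.1 x = 0}]
    [∀ (σ : Perm α) (c : CyclicColoring σ d), DecidableEq {x // c.1 x = 0}]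
    (hα : Fintype.card α = d * Fintype.card β) (g : Perm β → ℚ) :
    ∑ σ : Perm α, ∑ c : CyclicColoring σ d, ∑ e : β ≃ {x // c.1 x = 0},
      g (e.symm.permCongr c.rootPerm) = (Fintype.card α).factorial * ∑ τ : Perm β, g τ := by
  have hcard : Fintype.card (β × ZMod d) = Fintype.card α := by
    rw [Fintype.card_prod, ZMod.card, hα, mul_comm]
  have hpair := Fintype.sum_bijective _ (EnumColoring.toPair_bijective (α := α) (β := β) (d := d))
    (fun x => g (x.2.2.symm.permCongr x.2.1.rootPerm)) (fun x => g x.2) fun _ => rfl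
  simp only [Fintype.sum_sigma] at hpair
  rw [hpair, Fintype.sum_prod_type]
  dsimp only
  rw [Finset.sum_const, Finset.card_univ, nsmul_eq_mul,
    Fintype.card_equiv (Fintype.equivOfCardEq hcard), hcard]

end CyclicColoring

theorem IsClassFun.sum_equiv_fin {F : PermFun} (hF : IsClassFun F) {γ : Type} [Fintype γ]
    [DecidableEq γ] (τ : Perm γ) (y : ℕ+ →₀ ℕ) :
    (∑ e : Fin (degree y) ≃ γ, if cycleExponents (e.symm.permCongr τ) = y then
        F _ (e.symm.permCongr τ) else 0) =
      (degree y).factorial * (if cycleExponents τ = y then F γ τ else 0) := by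
  simp only [cycleExponents_permCongr, hF _ _]
  rw [Finset.sum_const, nsmul_eq_mul, Finset.card_univ]
  split_ifs with h
  · have hγ : Fintype.card γ = degree y := by
      rw [← h, degree_cycleExponents, Nat.card_eq_fintype_card]
    rw [Fintype.card_equiv (Fintype.equivFinOfCardEq hγ).symm, Fintype.card_fin]
  · rw [mul_zero, mul_zero]

theorem ite_adamsFun (d : ℕ+) (F : PermFun) {α : Type} [Finite α] (σ : Perm α) (y : ℕ+ →₀ ℕ) :
    (if cycleExponents σ = y.mapDomain (mulLeftEmbedding d) then adamsFun d F α σ else 0) =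
      ∑ᶠ c : CyclicColoring σ d, if cycleExponents c.rootPerm = y then F _ c.rootPerm else 0 := by
  have hc (c : CyclicColoring σ d) :
      cycleExponents σ = y.mapDomain (mulLeftEmbedding d) ↔ cycleExponents c.rootPerm = y := by
    rw [c.cycleExponents_eq, (Finsupp.mapDomain_injective (mulLeftEmbedding d).injective).eq_iff]
  split_ifs with h
  · exact finsum_congr fun c => (if_pos ((hc c).1 h)).symm
  · exact (finsum_eq_zero_of_forall_eq_zero fun c => if_neg (mt (hc c).2 h)).symm

theorem cycleTypeSum_adamsFun {F : PermFun} (hF : IsClassFun F) (d : ℕ+)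
    {α : Type} [Fintype α] [DecidableEq α] {y : ℕ+ →₀ ℕ} (hα : Fintype.card α = d * degree y) :
    (degree y).factorial *
        cycleTypeSum (adamsFun d F) α (y.mapDomain (mulLeftEmbedding d)) =
      (Fintype.card α).factorial * cycleTypeSum F (Fin (degree y)) y := by
  classical
  have (σ : Perm α) : Fintype (CyclicColoring σ d) := Fintype.ofFinite _
  simp only [cycleTypeSum, ite_adamsFun, finsum_eq_sum_of_fintype, Finset.mul_sum,
    ← hF.sum_equiv_fin]
  rw [sum_enumColoring d (β := Fin (degree y)) (by rw [Fintype.card_fin, hα])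
    fun τ => if cycleExponents τ = y then F _ τ else 0, Finset.mul_sum]

theorem cycleIndex_adamsFun {F : PermFun} (hF : IsClassFun F) (d : ℕ+) :
    cycleIndex (adamsFun d F) = adamsHom d (cycleIndex F) := by
  ext m
  by_cases hm : m ∈ Set.range (Finsupp.mapDomain (mulLeftEmbedding d))
  · obtain ⟨y, rfl⟩ := hm
    rw [coeff_mapDomain_adamsHom]
    set m := y.mapDomain (mulLeftEmbedding d)
    have h := cycleTypeSum_adamsFun hF d (α := Fin (degree m)) (y := y)
      (by rw [Fintype.card_fin, degree_mapDomain])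
    rw [← factorial_mul_coeff_cycleIndex _ rfl, ← factorial_mul_coeff_cycleIndex _ rfl,
      Fintype.card_fin, mul_left_comm] at h
    have hfac (n : ℕ) : (n.factorial : ℚ) ≠ 0 := Nat.cast_ne_zero.2 n.factorial_ne_zero
    exact mul_left_cancel₀ (hfac _) (mul_left_cancel₀ (hfac _) h)
  · rw [coeff_adamsHom_eq_zero _ hm, coeff_cycleIndex, cycleTypeSum, Finset.sum_eq_zero, mul_zero]
    intro σ _
    split_ifs with h
    · exact finsum_eq_zero_of_forall_eq_zero fun c =>
        absurd ⟨_, c.cycleExponents_eq.symm.trans h⟩ hm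
    · rfl

/-! ### Characters and class functions -/

theorem frobeniusSeries_eq_cycleIndex {V : ℕ → Type} [∀ n, AddCommGroup (V n)]
    [∀ n, Module ℚ (V n)] (ρ : ∀ n, Representation ℚ (Equiv.Perm (Fin n)) (V n)) {F : PermFun}
    (h : ∀ n (σ : Perm (Fin n)), (ρ n).character σ = F _ σ) :
    frobeniusSeries ρ = cycleIndex F := by
  classical
  ext m
  change coeff m (frobenius (ρ (degree m))) = _
  rw [coeff_cycleIndex, frobenius, coeff_smul, map_sum, cycleTypeSum]
  congr 1
  refine Finset.sum_congr rfl fun σ _ => ?_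
  rw [coeff_monomial, cycleExponents_fin, h]
  simp only [eq_comm]

theorem trace_lmapDomain {X : Type*} [Finite X] (f : X → X) :
    LinearMap.trace ℚ (X →₀ ℚ) (Finsupp.lmapDomain ℚ ℚ f) = Nat.card {x // f x = x} := by
  classical
  have := Fintype.ofFinite X
  rw [LinearMap.trace_eq_matrix_trace ℚ Finsupp.basisSingleOne, Matrix.trace,
    Nat.card_eq_fintype_card, Fintype.card_subtype, Finset.card_filter, Nat.cast_sum]
  refine Finset.sum_congr rfl fun x _ => ?_
  rw [Matrix.diag_apply, LinearMap.toMatrix_apply]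
  simp [Finsupp.mapDomain_single, Finsupp.single_apply]

theorem IsClassFun.card_mul {F : PermFun} (hF : IsClassFun F) :
    IsClassFun fun α σ => Nat.card α * F α σ := fun α β e σ => by
  dsimp only
  rw [hF, Nat.card_congr e]

theorem natCard_eq_prodFun {X α : Type} [Finite X] [Fintype α] [DecidableEq α] {A B : PermFun}
    {σ : Perm α} (S : X → StableFinset σ)
    (h : ∀ s, (Nat.card {x // S x = s} : ℚ) = A _ s.perm * B _ s.complPerm) :
    (Nat.card X : ℚ) = prodFun A B σ := by
  rw [← Nat.card_congr (Equiv.sigmaFiberEquiv S), Nat.card_sigma, Nat.cast_sum, prodFun]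
  exact Finset.sum_congr rfl fun s _ => h s

theorem cycleExponents_one {α : Type*} [Finite α] :
    cycleExponents (1 : Perm α) = Finsupp.single 1 (Nat.card α) := by
  refine cycleExponents_eq fun k => ?_
  have h : ∀ x : α, Function.minimalPeriod (1 : Perm α) x = 1 := fun x =>
    Function.minimalPeriod_eq_one_iff_isFixedPt.2 rfl
  rw [periodCount, Finsupp.single_apply]
  simp only [h]
  split_ifs with hk
  · subst hk
    simp
  · rw [mul_zero, Nat.card_eq_zero]
    exact Or.inl ⟨fun x => hk (PNat.coe_injective x.2)⟩

/-- The character of the species of one-point sets: `1` on the permutation of a one-point set and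
`0` on all other permutations. -/
def pointFun : PermFun := fun α _ => if Nat.card α = 1 then 1 else 0

theorem isClassFun_pointFun : IsClassFun pointFun := fun α β e σ => by
  rw [pointFun, pointFun, Nat.card_congr e]

theorem cycleIndex_pointFun : cycleIndex pointFun = p 1 := by
  classical
  ext m
  rw [coeff_cycleIndex, coeff_X, cycleTypeSum]
  simp only [pointFun, Nat.card_eq_fintype_card, Fintype.card_fin]
  by_cases hm : degree m = 1
  · have : Subsingleton (Fin (degree m)) := by rw [hm]; infer_instance
    have hterm (σ : Perm (Fin (degree m))) : (if cycleExponents σ = m then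
        if degree m = 1 then (1 : ℚ) else 0 else 0) = if m = Finsupp.single 1 1 then 1 else 0 := by
      rw [Subsingleton.elim σ 1, cycleExponents_one, Nat.card_eq_fintype_card, Fintype.card_fin,
        if_pos hm, hm]
      simp only [eq_comm]
    rw [Finset.sum_congr rfl fun σ _ => hterm σ, Finset.sum_const, Finset.card_univ,
      Fintype.card_perm, Fintype.card_fin, hm]
    simp
  · rw [Finset.sum_eq_zero fun σ _ => by rw [if_neg hm, ite_self], mul_zero, if_neg]
    rintro rfl
    exact hm (by simp [degree, Finsupp.weight_single])

/-! ### Rooted trees and forests -/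

section Forests

variable {α β : Type*}

/-- A rooted forest on `α`, encoded as the function sending each vertex to its parent and each root
to itself. -/
def IsForest (f : α → α) : Prop := ∀ x, ∃ k : ℕ, f (f^[k] x) = f^[k] x

/-- A rooted tree on `α`, encoded as the function sending each vertex to its parent and the root to
itself. -/
def IsTree (f : α → α) : Prop := ∃ r, f r = r ∧ ∀ x, ∃ k : ℕ, f^[k] x = r

theorem IsTree.isForest {f : α → α} (h : IsTree f) : IsForest f := by
  obtain ⟨r, hr, h⟩ := h
  intro x
  obtain ⟨k, hk⟩ := h x
  exact ⟨k, by rw [hk, hr]⟩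

theorem IsTree.eq_of_fixed {f : α → α} (h : IsTree f) {a b : α} (ha : f a = a) (hb : f b = b) :
    a = b := by
  obtain ⟨r, -, h⟩ := h
  obtain ⟨k, hk⟩ := h a
  obtain ⟨l, hl⟩ := h b
  rw [Function.iterate_fixed ha] at hk
  rw [Function.iterate_fixed hb] at hl
  rw [hk, hl]

theorem IsTree.fixed_iff {f : α → α} (h : IsTree f) {r y : α} (hr : f r = r) :
    f y = y ↔ y = r :=
  ⟨fun hy => h.eq_of_fixed hy hr, fun hy => hy ▸ hr⟩

/-- The rooted trees on `α` fixed by a permutation of the vertices. -/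
abbrev FixedTree (σ : Perm α) : Type _ := {f : α → α // IsTree f ∧ Function.Commute f σ}

/-- The rooted forests on `α` fixed by a permutation of the vertices. -/
abbrev FixedForest (σ : Perm α) : Type _ := {f : α → α // IsForest f ∧ Function.Commute f σ}

/-- All the roots of a forest lie in one orbit of a permutation. -/
def HasOneRootOrbit (σ : Perm α) (f : α → α) : Prop :=
  ∀ r r', f r = r → f r' = r' → σ.SameCycle r r'

/-- The rooted forests fixed by a permutation which permutes their roots transitively. -/
abbrev FixedOrbitForest (σ : Perm α) : Type _ := {f : FixedForest σ // HasOneRootOrbit σ f.1}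

theorem arrowCongr_iterate (e : α ≃ β) (f : α → α) (k : ℕ) (x : α) :
    (e.arrowCongr e f)^[k] (e x) = e (f^[k] x) := by
  have : Function.Semiconj e f (e.arrowCongr e f) := fun y => by simp
  exact ((this.iterate_right k) x).symm

theorem isForest_arrowCongr (e : α ≃ β) (f : α → α) :
    IsForest f ↔ IsForest (e.arrowCongr e f) := by
  rw [IsForest, IsForest, ← e.forall_congr_right]
  simp only [arrowCongr_iterate]
  simp

theorem isTree_arrowCongr (e : α ≃ β) (f : α → α) : IsTree f ↔ IsTree (e.arrowCongr e f) := by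
  rw [IsTree, IsTree, ← e.exists_congr_right]
  refine exists_congr fun r => and_congr (by simp) ?_
  rw [← e.forall_congr_right]
  simp only [arrowCongr_iterate, e.injective.eq_iff]

theorem commute_arrowCongr (e : α ≃ β) (f : α → α) (σ : Perm α) :
    Function.Commute f σ ↔ Function.Commute (e.arrowCongr e f) (e.permCongr σ) := by
  change (∀ x, f (σ x) = σ (f x)) ↔ ∀ y, _ = _
  rw [← e.forall_congr_right]
  simp [Equiv.permCongr_apply]

theorem sameCycle_permCongr (e : α ≃ β) (σ : Perm α) (x y : α) :
    (e.permCongr σ).SameCycle (e x) (e y) ↔ σ.SameCycle x y := by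
  refine exists_congr fun i => ?_
  have h : (e.permCongr σ) ^ i = e.permCongr (σ ^ i) := (map_zpow e.permCongrHom σ i).symm
  rw [h, Equiv.permCongr_apply, Equiv.symm_apply_apply, e.injective.eq_iff]

theorem hasOneRootOrbit_arrowCongr (e : α ≃ β) (f : α → α) (σ : Perm α) :
    HasOneRootOrbit σ f ↔ HasOneRootOrbit (e.permCongr σ) (e.arrowCongr e f) := by
  rw [HasOneRootOrbit, HasOneRootOrbit, ← e.forall_congr_right]
  refine forall_congr' fun r => ?_
  rw [← e.forall_congr_right]
  simp [sameCycle_permCongr]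

/-- Transport of fixed forests along a bijection of the vertices. -/
def FixedForest.congr (e : α ≃ β) (σ : Perm α) : FixedForest σ ≃ FixedForest (e.permCongr σ) :=
  (e.arrowCongr e).subtypeEquiv fun f =>
    and_congr (isForest_arrowCongr e f) (commute_arrowCongr e f σ)

end Forests

/-- The number of rooted trees fixed by a permutation. -/
def treeFun : PermFun := fun _ σ => Nat.card (FixedTree σ)

/-- The number of rooted forests fixed by a permutation. -/
def forestFun : PermFun := fun _ σ => Nat.card (FixedForest σ)

/-- The number of rooted forests fixed by a permutation which permutes their roots transitively. -/
def orbitForestFun : PermFun := fun _ σ => Nat.card (FixedOrbitForest σ)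

theorem isClassFun_treeFun : IsClassFun treeFun := fun _ _ e σ =>
  congrArg Nat.cast (Nat.card_congr ((e.arrowCongr e).subtypeEquiv fun f =>
    and_congr (isTree_arrowCongr e f) (commute_arrowCongr e f σ))).symm

theorem isClassFun_forestFun : IsClassFun forestFun := fun _ _ e σ =>
  congrArg Nat.cast (Nat.card_congr (FixedForest.congr e σ)).symm

theorem isClassFun_orbitForestFun : IsClassFun orbitForestFun := fun _ _ e σ =>
  congrArg Nat.cast (Nat.card_congr ((FixedForest.congr e σ).subtypeEquiv fun f =>
    hasOneRootOrbit_arrowCongr e f.1 σ)).symm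

/-- Rooted trees are determined by their parent functions. -/
def rootedTreeEquiv (α : Type) : RootedTree α ≃ {f : α → α // IsTree f} where
  toFun T := ⟨T.parent, T.root, T.parent_root, T.reaches_root⟩
  invFun f := ⟨f.2.choose, f.1, f.2.choose_spec.1, f.2.choose_spec.2⟩
  left_inv T := by
    have h : IsTree T.parent := ⟨T.root, T.parent_root, T.reaches_root⟩
    exact RootedTree.ext (h.eq_of_fixed h.choose_spec.1 T.parent_root) rfl
  right_inv _ := rfl

theorem smul_eq_self_iff_commute {α : Type} (σ : Perm α) (T : RootedTree α) :
    σ • T = T ↔ Function.Commute T.parent σ := by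
  rw [← (rootedTreeEquiv α).injective.eq_iff, Subtype.ext_iff]
  change (fun x => σ (T.parent (σ.symm x))) = T.parent ↔ ∀ x, T.parent (σ x) = σ (T.parent x)
  rw [funext_iff, ← σ.forall_congr_right]
  simp only [Equiv.symm_apply_apply, eq_comm]

theorem PreLie_eq_cycleIndex : PreLie = cycleIndex treeFun := by
  refine frobeniusSeries_eq_cycleIndex _ fun n σ => ?_
  have : Finite (RootedTree (Fin n)) := Finite.of_equiv _ (rootedTreeEquiv (Fin n)).symm
  have h : Representation.ofMulAction ℚ (Perm (Fin n)) (RootedTree (Fin n)) σ =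
      (MonoidAlgebra.coeffLinearEquiv ℚ).symm.conj
        (Finsupp.lmapDomain ℚ ℚ fun T : RootedTree (Fin n) => σ • T) := by
    rw [Representation.ofMulAction_def]
    rfl
  rw [Representation.character, h, LinearMap.trace_conj', trace_lmapDomain, treeFun, Nat.cast_inj]
  exact Nat.card_congr (((rootedTreeEquiv (Fin n)).subtypeEquiv
    (q := fun f => Function.Commute f.1 σ) fun T => smul_eq_self_iff_commute σ T).trans
    (Equiv.subtypeSubtypeEquivSubtypeInter IsTree fun f => Function.Commute f σ))

/-! ### A rooted tree is a forest grafted on a root -/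

section Root

variable {α : Type*} {r : α}

open scoped Classical in
/-- Remove the root `r` of a tree; its children become the roots of a forest. -/
def removeRoot (r : α) (f : α → α) (y : {y // y ≠ r}) : {y // y ≠ r} :=
  if h : f y = r then y else ⟨f y, h⟩

open scoped Classical in
/-- Graft all the roots of a forest on a new root `r`. -/
def addRoot (g : {y // y ≠ r} → {y // y ≠ r}) (y : α) : α :=
  if h : y = r then r else if g ⟨y, h⟩ = ⟨y, h⟩ then r else g ⟨y, h⟩

theorem removeRoot_of_eq {f : α → α} {y : {y // y ≠ r}} (h : f y = r) : removeRoot r f y = y :=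
  dif_pos h

theorem removeRoot_of_ne {f : α → α} {y : {y // y ≠ r}} (h : f y ≠ r) :
    removeRoot r f y = ⟨f y, h⟩ :=
  dif_neg h

variable {g : {y // y ≠ r} → {y // y ≠ r}}

theorem addRoot_root : addRoot g r = r := dif_pos rfl

theorem addRoot_of_fixed {y : {y // y ≠ r}} (h : g y = y) : addRoot g y = r :=
  (dif_neg y.2).trans (if_pos h)

theorem addRoot_of_not_fixed {y : {y // y ≠ r}} (h : g y ≠ y) : addRoot g y = g y :=
  (dif_neg y.2).trans (if_neg h)

theorem isForest_removeRoot {f : α → α} (hf : IsTree f) (hfr : f r = r) :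
    IsForest (removeRoot r f) := by
  have main (k : ℕ) : ∀ y : {y // y ≠ r}, f^[k] y = r →
      ∃ j : ℕ, removeRoot r f ((removeRoot r f)^[j] y) = (removeRoot r f)^[j] y := by
    induction k with
    | zero => exact fun y hy => absurd hy y.2
    | succ k ih =>
      intro y hy
      by_cases h : f y = r
      · exact ⟨0, removeRoot_of_eq h⟩
      · obtain ⟨j, hj⟩ := ih ⟨f y, h⟩ hy
        exact ⟨j + 1, by rw [Function.iterate_succ_apply, removeRoot_of_ne h, hj]⟩
  obtain ⟨r', hr', h⟩ := hf
  intro y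
  obtain ⟨k, hk⟩ := h y
  exact main k y (hk.trans (IsTree.eq_of_fixed ⟨r', hr', h⟩ hr' hfr))

theorem isTree_addRoot (hg : IsForest g) : IsTree (addRoot g) := by
  have main (k : ℕ) : ∀ y : {y // y ≠ r}, g (g^[k] y) = g^[k] y →
      ∃ j : ℕ, (addRoot g)^[j] y = r := by
    induction k with
    | zero => exact fun y hy => ⟨1, addRoot_of_fixed hy⟩
    | succ k ih =>
      intro y hy
      by_cases h : g y = y
      · exact ⟨1, addRoot_of_fixed h⟩
      · obtain ⟨j, hj⟩ := ih (g y) hy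
        exact ⟨j + 1, by rw [Function.iterate_succ_apply, addRoot_of_not_fixed h, hj]⟩
  refine ⟨r, addRoot_root, fun y => ?_⟩
  by_cases hy : y = r
  · exact ⟨0, hy⟩
  · obtain ⟨k, hk⟩ := hg ⟨y, hy⟩
    exact main k ⟨y, hy⟩ hk

theorem addRoot_removeRoot {f : α → α} (hf : ∀ y, f y = y ↔ y = r) :
    addRoot (removeRoot r f) = f := by
  funext y
  by_cases hy : y = r
  · rw [hy, addRoot_root, (hf r).2 rfl]
  by_cases h : f y = r
  · exact (addRoot_of_fixed (y := ⟨y, hy⟩) (removeRoot_of_eq h)).trans h.symm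
  · have hstep : removeRoot r f ⟨y, hy⟩ = ⟨f y, h⟩ := removeRoot_of_ne h
    refine (addRoot_of_not_fixed (y := ⟨y, hy⟩) fun h' => hy ((hf y).1 ?_)).trans
      (congrArg Subtype.val hstep)
    exact congrArg Subtype.val (hstep.symm.trans h')

theorem removeRoot_addRoot : removeRoot r (addRoot g) = g := by
  funext y
  by_cases h : g y = y
  · rw [removeRoot_of_eq (addRoot_of_fixed h), h]
  · have hstep := addRoot_of_not_fixed h
    rw [removeRoot_of_ne (by rw [hstep]; exact (g y).2)]
    exact Subtype.ext hstep

variable {σ : Perm α} (hσ : ∀ y, σ y ≠ r ↔ y ≠ r)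

theorem commute_removeRoot {f : α → α} (hf : Function.Commute f σ) :
    Function.Commute (removeRoot r f) (σ.subtypePerm hσ) := by
  intro y
  have hy : f (σ.subtypePerm hσ y) = σ (f y) := hf y
  by_cases h : f y = r
  · have hσr : σ r = r := not_not.1 fun h' => (hσ r).1 h' rfl
    rw [removeRoot_of_eq h, removeRoot_of_eq (by rw [hy, h, hσr])]
  · rw [removeRoot_of_ne h, removeRoot_of_ne (by rw [hy]; exact (hσ _).2 h)]
    exact Subtype.ext hy

theorem commute_addRoot (hg : Function.Commute g (σ.subtypePerm hσ)) :
    Function.Commute (addRoot g) σ := by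
  have hσr : σ r = r := not_not.1 fun h' => (hσ r).1 h' rfl
  intro y
  by_cases hy : y = r
  · rw [hy, hσr, addRoot_root, hσr]
  lift y to {y // y ≠ r} using hy
  change addRoot g (σ.subtypePerm hσ y) = _
  by_cases h : g y = y
  · rw [addRoot_of_fixed h, addRoot_of_fixed (by rw [hg, h]), hσr]
  · rw [addRoot_of_not_fixed h, addRoot_of_not_fixed, hg]
    · rfl
    · rw [hg]
      exact fun h' => h ((σ.subtypePerm hσ).injective h')

/-- Removing the root `r` identifies the fixed trees with root `r` and the fixed forests on the
other vertices. -/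
def removeRootEquiv :
    {f : FixedTree σ // f.1 r = r} ≃ FixedForest (σ.subtypePerm (p := (· ≠ r)) hσ) where
  toFun f := ⟨removeRoot r f.1.1, isForest_removeRoot f.1.2.1 f.2, commute_removeRoot hσ f.1.2.2⟩
  invFun g := ⟨⟨addRoot g.1, isTree_addRoot g.2.1, commute_addRoot hσ g.2.2⟩, addRoot_root⟩
  left_inv f := Subtype.ext (Subtype.ext (addRoot_removeRoot fun _ => f.1.2.1.fixed_iff f.2))
  right_inv _ := Subtype.ext removeRoot_addRoot

end Root

section RootSet

variable {α : Type} [Fintype α] [DecidableEq α] {σ : Perm α}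

/-- The set of roots of a fixed tree. -/
def FixedTree.rootSet (f : FixedTree σ) : StableFinset σ :=
  ⟨Finset.univ.filter fun y => f.1 y = y, fun y => by simp [f.2.2 y]⟩

theorem FixedTree.mem_rootSet (f : FixedTree σ) (y : α) : y ∈ f.rootSet.1 ↔ f.1 y = y :=
  Finset.mem_filter_univ y

theorem FixedTree.card_rootSet (f : FixedTree σ) : f.rootSet.1.card = 1 := by
  obtain ⟨r, hr, -⟩ := id f.2.1
  refine Finset.card_eq_one.2 ⟨r, Finset.ext fun y => ?_⟩
  rw [f.mem_rootSet, Finset.mem_singleton, f.2.1.fixed_iff hr]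

theorem natCard_rootSet_eq_singleton {r : α}
    (hr : ∀ y, σ y ∈ ({r} : Finset α) ↔ y ∈ ({r} : Finset α)) :
    (Nat.card {f : FixedTree σ // f.rootSet = ⟨{r}, hr⟩} : ℚ) =
      forestFun _ (StableFinset.complPerm ⟨{r}, hr⟩) := by
  have hσ : ∀ y, σ y ≠ r ↔ y ≠ r := fun y => by simpa using not_congr (hr y)
  let e : {y // y ≠ r} ≃ {y // y ∉ ({r} : Finset α)} := Equiv.subtypeEquivRight fun y => by simp
  have he : e.permCongr (σ.subtypePerm hσ) = StableFinset.complPerm ⟨{r}, hr⟩ :=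
    Equiv.ext fun y => rfl
  rw [← he, isClassFun_forestFun, forestFun, Nat.cast_inj]
  refine Nat.card_congr ((Equiv.subtypeEquivRight fun f => ?_).trans (removeRootEquiv hσ))
  rw [Subtype.ext_iff, Finset.ext_iff]
  simp only [f.mem_rootSet, Finset.mem_singleton]
  exact ⟨fun h => (h r).2 rfl, fun h y => f.2.1.fixed_iff h⟩

theorem treeFun_eq_prodFun (σ : Perm α) : treeFun α σ = prodFun pointFun forestFun σ := by
  refine natCard_eq_prodFun FixedTree.rootSet fun s => ?_
  by_cases hs : s.1.card = 1
  · obtain ⟨s, hσs⟩ := s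
    obtain ⟨r, rfl⟩ := Finset.card_eq_one.1 hs
    rw [natCard_rootSet_eq_singleton, pointFun, if_pos (by simp), one_mul]
  · have : IsEmpty {f : FixedTree σ // f.rootSet = s} := ⟨fun f => hs (f.2 ▸ f.1.card_rootSet)⟩
    rw [Nat.card_of_isEmpty, Nat.cast_zero, pointFun, if_neg (by simpa using hs), zero_mul]

end RootSet

theorem cycleIndex_treeFun : cycleIndex treeFun = p 1 * cycleIndex forestFun := by
  rw [← cycleIndex_pointFun]
  exact cycleIndex_eq_mul isClassFun_pointFun isClassFun_forestFun fun n σ =>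
    treeFun_eq_prodFun σ

/-! ### Splitting a forest along the orbits of its roots -/

namespace IsForest

variable {α : Type*} {f : α → α}

/-- The root of the component of `x` in a forest. -/
def root (h : IsForest f) (x : α) : α := f^[(h x).choose] x

theorem apply_root (h : IsForest f) (x : α) : f (h.root x) = h.root x := (h x).choose_spec

theorem exists_iterate_eq_root (h : IsForest f) (x : α) : ∃ k : ℕ, f^[k] x = h.root x := ⟨_, rfl⟩

theorem root_eq (h : IsForest f) {x r : α} {k : ℕ} (hk : f^[k] x = r) (hr : f r = r) :
    h.root x = r := by
  obtain ⟨l, hl⟩ := h.exists_iterate_eq_root x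
  calc h.root x = f^[k] (f^[l] x) := by rw [hl, Function.iterate_fixed (h.apply_root x)]
    _ = f^[l] (f^[k] x) := by rw [← Function.iterate_add_apply, add_comm,
        Function.iterate_add_apply]
    _ = r := by rw [hk, Function.iterate_fixed hr]

theorem root_of_fixed (h : IsForest f) {r : α} (hr : f r = r) : h.root r = r :=
  h.root_eq (k := 0) rfl hr

theorem root_apply (h : IsForest f) (x : α) : h.root (f x) = h.root x := by
  obtain ⟨k, hk⟩ := h.exists_iterate_eq_root (f x)
  exact (h.root_eq (k := k + 1) hk (h.apply_root _)).symm

theorem root_perm (h : IsForest f) {σ : Perm α} (hσ : Function.Commute f σ) (x : α) :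
    h.root (σ x) = σ (h.root x) := by
  obtain ⟨k, hk⟩ := h.exists_iterate_eq_root x
  exact h.root_eq (k := k) (by rw [hσ.iterate_left, hk]) (by rw [hσ, h.apply_root])

theorem map_root (h : IsForest f) {γ : Type*} {c : α → γ} (hc : ∀ y, c (f y) = c y) (x : α) :
    c (h.root x) = c x := by
  obtain ⟨k, hk⟩ := h.exists_iterate_eq_root x
  rw [← hk]
  exact Function.Semiconj.iterate_right (f := c) (ga := f) (gb := id) hc k x |>.trans (by simp)

end IsForest

section Glue

variable {α : Type*} {P : α → Prop}

/-- The restriction of a function to a stable subset. -/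
def restrictFun (f : α → α) (h : ∀ x, P (f x) ↔ P x) (x : {x // P x}) : {x // P x} :=
  ⟨f x, (h x).2 x.2⟩

theorem restrictFun_iterate {f : α → α} (h : ∀ x, P (f x) ↔ P x) (k : ℕ) (x : {x // P x}) :
    ((restrictFun f h)^[k] x : α) = f^[k] x := by
  have : Function.Semiconj Subtype.val (restrictFun f h) f := fun y => rfl
  exact (this.iterate_right k) x

theorem isForest_restrictFun {f : α → α} (hf : IsForest f) (h : ∀ x, P (f x) ↔ P x) :
    IsForest (restrictFun f h) := by
  intro x
  obtain ⟨k, hk⟩ := hf x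
  refine ⟨k, Subtype.ext ?_⟩
  change f _ = _
  rw [restrictFun_iterate, hk]

open scoped Classical in
/-- Glue a function on a subset and a function on its complement. -/
def glueFun (f : {x // P x} → {x // P x}) (g : {x // ¬ P x} → {x // ¬ P x}) (x : α) : α :=
  if h : P x then f ⟨x, h⟩ else g ⟨x, h⟩

variable (f : {x // P x} → {x // P x}) (g : {x // ¬ P x} → {x // ¬ P x})

theorem glueFun_left (x : {x // P x}) : glueFun f g x = f x := dif_pos x.2

theorem glueFun_right (x : {x // ¬ P x}) : glueFun f g x = g x := dif_neg x.2

theorem glueFun_mem (x : α) : P (glueFun f g x) ↔ P x := by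
  by_cases h : P x
  · rw [glueFun_left f g ⟨x, h⟩]
    exact iff_of_true (f _).2 h
  · rw [glueFun_right f g ⟨x, h⟩]
    exact iff_of_false (g _).2 h

theorem glueFun_restrictFun (f : α → α) (h : ∀ x, P (f x) ↔ P x) (h' : ∀ x, ¬ P (f x) ↔ ¬ P x) :
    glueFun (restrictFun f h) (restrictFun f h') = f := by
  funext x
  by_cases hx : P x
  · exact glueFun_left _ _ ⟨x, hx⟩
  · exact glueFun_right _ _ ⟨x, hx⟩

variable {f g}

theorem isForest_glueFun (hf : IsForest f) (hg : IsForest g) : IsForest (glueFun f g) := by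
  have hl : Function.Semiconj Subtype.val f (glueFun f g) := fun y => (glueFun_left f g y).symm
  have hr : Function.Semiconj Subtype.val g (glueFun f g) := fun y => (glueFun_right f g y).symm
  intro x
  by_cases hx : P x
  · obtain ⟨k, hk⟩ := hf ⟨x, hx⟩
    exact ⟨k, by rw [← (hl.iterate_right k) ⟨x, hx⟩, ← hl, hk]⟩
  · obtain ⟨k, hk⟩ := hg ⟨x, hx⟩
    exact ⟨k, by rw [← (hr.iterate_right k) ⟨x, hx⟩, ← hr, hk]⟩

variable {σ : Perm α} (hσ : ∀ x, P (σ x) ↔ P x)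

theorem commute_glueFun (hf : Function.Commute f (σ.subtypePerm hσ))
    (hg : Function.Commute g (σ.subtypePerm fun x => not_congr (hσ x))) :
    Function.Commute (glueFun f g) σ := by
  intro x
  by_cases hx : P x
  · rw [glueFun_left f g ⟨x, hx⟩]
    exact (glueFun_left f g ⟨σ x, (hσ x).2 hx⟩).trans (congrArg Subtype.val (hf ⟨x, hx⟩))
  · rw [glueFun_right f g ⟨x, hx⟩]
    exact (glueFun_right f g ⟨σ x, fun h => hx ((hσ x).1 h)⟩).trans
      (congrArg Subtype.val (hg ⟨x, hx⟩))

theorem hasOneRootOrbit_restrictFun {f : α → α} (h : ∀ x, P (f x) ↔ P x) :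
    HasOneRootOrbit (σ.subtypePerm hσ) (restrictFun f h) ↔
      ∀ r, P r → ∀ r', P r' → f r = r → f r' = r' → σ.SameCycle r r' := by
  simp only [HasOneRootOrbit, Subtype.forall, Perm.sameCycle_subtypePerm, restrictFun,
    Subtype.mk.injEq]

/-- A fixed forest with no edge between a stable set of vertices and its complement is a pair of
fixed forests. -/
def FixedForest.splitEquiv : {f : FixedForest σ // ∀ y, P (f.1 y) ↔ P y} ≃
    FixedForest (σ.subtypePerm hσ) ×
      FixedForest (σ.subtypePerm (p := fun x => ¬ P x) fun x => not_congr (hσ x)) where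
  toFun f :=
    (⟨restrictFun f.1.1 f.2, isForest_restrictFun f.1.2.1 _, fun y => Subtype.ext (f.1.2.2 y)⟩,
      ⟨restrictFun f.1.1 fun y => not_congr (f.2 y), isForest_restrictFun f.1.2.1 _,
        fun y => Subtype.ext (f.1.2.2 y)⟩)
  invFun f := ⟨⟨glueFun f.1.1 f.2.1, isForest_glueFun f.1.2.1 f.2.2.1,
    commute_glueFun hσ f.1.2.2 f.2.2.2⟩, glueFun_mem _ _⟩
  left_inv f := Subtype.ext (Subtype.ext (glueFun_restrictFun _ f.2 fun y => not_congr (f.2 y)))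
  right_inv _ := Prod.ext (Subtype.ext (funext fun _ => Subtype.ext (glueFun_left _ _ _)))
    (Subtype.ext (funext fun _ => Subtype.ext (glueFun_right _ _ _)))

end Glue

theorem iff_of_sameCycle {α : Type*} {σ : Perm α} {P : α → Prop} (hP : ∀ x, P (σ x) ↔ P x)
    {x y : α} (h : σ.SameCycle x y) : P x ↔ P y := by
  have main {x y : α} (h : σ.SameCycle x y) (hx : P x) : P y := by
    obtain ⟨i, rfl⟩ := h
    have := ((σ.subtypePerm hP ^ i) ⟨x, hx⟩).2
    rwa [Perm.subtypePerm_zpow] at this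
  exact ⟨main h, main h.symm⟩

section OrbitComponent

variable {α : Type} [Fintype α] [DecidableEq α] {σ : Perm α}

open scoped Classical in
/-- The vertices of a fixed forest whose roots are in the orbit of the root of `x`. -/
def FixedForest.orbitComponent (f : FixedForest σ) (x : α) : StableFinset σ :=
  ⟨Finset.univ.filter fun y => σ.SameCycle (f.2.1.root x) (f.2.1.root y), fun y => by
    simp [f.2.1.root_perm f.2.2]⟩

theorem FixedForest.mem_orbitComponent (f : FixedForest σ) (x y : α) :
    y ∈ (f.orbitComponent x).1 ↔ σ.SameCycle (f.2.1.root x) (f.2.1.root y) := by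
  simp [orbitComponent]

theorem FixedForest.orbitComponent_eq_iff (f : FixedForest σ) (x : α) (s : StableFinset σ) :
    f.orbitComponent x = s ↔ x ∈ s.1 ∧ (∀ y, f.1 y ∈ s.1 ↔ y ∈ s.1) ∧
      ∀ r ∈ s.1, ∀ r' ∈ s.1, f.1 r = r → f.1 r' = r' → σ.SameCycle r r' := by
  constructor
  · rintro rfl
    simp only [mem_orbitComponent, IsForest.root_apply, implies_true, true_and]
    refine ⟨.refl _ _, fun r hr r' hr' hfr hfr' => ?_⟩
    rw [f.2.1.root_of_fixed hfr] at hr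
    rw [f.2.1.root_of_fixed hfr'] at hr'
    exact hr.symm.trans hr'
  · rintro ⟨hx, hs, hO⟩
    have hroot (y : α) : f.2.1.root y ∈ s.1 ↔ y ∈ s.1 :=
      iff_of_eq (f.2.1.map_root (c := (· ∈ s.1)) (fun y => propext (hs y)) y)
    refine Subtype.ext (Finset.ext fun y => ?_)
    rw [mem_orbitComponent]
    refine ⟨fun h => ?_, fun hy => ?_⟩
    · rwa [← hroot, ← iff_of_sameCycle s.2 h, hroot]
    · exact hO _ ((hroot x).2 hx) _ ((hroot y).2 hy) (f.2.1.apply_root x) (f.2.1.apply_root y)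

/-- A pointed fixed forest whose point lies in the component `s` is a point of `s`, a fixed forest
on `s` with one orbit of roots, and a fixed forest on the complement of `s`. -/
def FixedForest.orbitComponentEquiv (s : StableFinset σ) :
    {x : α × FixedForest σ // x.2.orbitComponent x.1 = s} ≃
      {x // x ∈ s.1} × FixedOrbitForest s.perm × FixedForest s.complPerm :=
  calc {x : α × FixedForest σ // x.2.orbitComponent x.1 = s}
    _ ≃ {x : α × FixedForest σ // x.1 ∈ s.1 ∧ (∀ y, x.2.1 y ∈ s.1 ↔ y ∈ s.1) ∧
        ∀ r ∈ s.1, ∀ r' ∈ s.1, x.2.1 r = r → x.2.1 r' = r' → σ.SameCycle r r'} :=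
      Equiv.subtypeEquivRight fun x => x.2.orbitComponent_eq_iff x.1 s
    _ ≃ {x // x ∈ s.1} × {f : FixedForest σ // (∀ y, f.1 y ∈ s.1 ↔ y ∈ s.1) ∧
        ∀ r ∈ s.1, ∀ r' ∈ s.1, f.1 r = r → f.1 r' = r' → σ.SameCycle r r'} :=
      Equiv.subtypeProdEquivProd (p := (· ∈ s.1))
        (q := fun f : FixedForest σ => (∀ y, f.1 y ∈ s.1 ↔ y ∈ s.1) ∧
          ∀ r ∈ s.1, ∀ r' ∈ s.1, f.1 r = r → f.1 r' = r' → σ.SameCycle r r')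
    _ ≃ {x // x ∈ s.1} × {f : FixedForest s.perm × FixedForest s.complPerm //
        HasOneRootOrbit s.perm f.1.1} :=
      Equiv.prodCongrRight fun _ => (Equiv.subtypeSubtypeEquivSubtypeInter _ _).symm.trans
        ((FixedForest.splitEquiv s.2).subtypeEquiv fun f =>
          (hasOneRootOrbit_restrictFun s.2 f.2).symm)
    _ ≃ {x // x ∈ s.1} × FixedOrbitForest s.perm × FixedForest s.complPerm :=
      Equiv.prodCongrRight fun _ => Equiv.prodSubtypeFstEquivSubtypeProd
        (p := fun f : FixedForest s.perm => HasOneRootOrbit s.perm f.1)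

theorem card_mul_forestFun (σ : Perm α) : Nat.card α * forestFun α σ =
    prodFun (fun β τ => Nat.card β * orbitForestFun β τ) forestFun σ := by
  rw [forestFun, ← Nat.cast_mul, ← Nat.card_prod]
  refine natCard_eq_prodFun (fun x => x.2.orbitComponent x.1) fun s => ?_
  rw [Nat.card_congr (FixedForest.orbitComponentEquiv s), Nat.card_prod, Nat.card_prod,
    Nat.cast_mul, Nat.cast_mul, mul_assoc, forestFun, orbitForestFun]

end OrbitComponent

theorem euler_cycleIndex_forestFun : euler (cycleIndex forestFun) =
    cycleIndex (fun α σ => Nat.card α * orbitForestFun α σ) * cycleIndex forestFun := by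
  rw [euler_cycleIndex]
  exact cycleIndex_eq_mul isClassFun_orbitForestFun.card_mul isClassFun_forestFun fun n σ =>
    card_mul_forestFun σ

/-! ### Forests with one orbit of roots are orbits of trees -/

theorem zpow_apply_eq_iff {α : Type*} (σ : Perm α) (r : α) (a b : ℤ) :
    (σ ^ a) r = (σ ^ b) r ↔ (a : ZMod (Function.minimalPeriod σ r)) = b := by
  have h := MulAction.zpow_smul_eq_iff_minimalPeriod_dvd (a := σ) (b := r) (n := a - b)
  rw [ZMod.intCast_eq_intCast_iff_dvd_sub, ← dvd_neg, neg_sub]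
  refine Iff.trans ?_ h
  rw [sub_eq_neg_add, zpow_add, zpow_neg, Perm.smul_def, Perm.mul_apply, Perm.inv_eq_iff_eq]

theorem commute_perm_pow {α : Type*} {f : α → α} {σ : Perm α} (h : Function.Commute f σ) (n : ℕ) :
    Function.Commute f (σ ^ n : Perm α) := by
  rw [← Perm.iterate_eq_pow]
  exact h.iterate_right n

section Compatible

variable {α : Type*} {σ : Perm α} {d : ℕ+}

namespace CyclicColoring

/-- A coloring is compatible with a forest when it is constant on the trees of the forest and
distinguishes their roots; by cyclicity it suffices to distinguish the roots of color zero. -/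
def Compatible (c : CyclicColoring σ d) (f : α → α) : Prop :=
  (∀ y, c.1 (f y) = c.1 y) ∧
    ∀ r r', f r = r → f r' = r' → c.1 r = 0 → c.1 r' = 0 → r = r'

namespace Compatible

variable {c : CyclicColoring σ d} {f : α → α} {x : α}

theorem hasOneRootOrbit (h : c.Compatible f) (hfσ : Function.Commute f σ) :
    HasOneRootOrbit σ f := by
  have main {y : α} (hy : f y = y) : ∃ r, f r = r ∧ c.1 r = 0 ∧ σ.SameCycle r y := by
    obtain ⟨⟨i, j⟩, rfl⟩ := (c.coords (Equiv.refl _)).surjective y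
    refine ⟨i, (σ ^ j.val).injective ?_, i.2, Perm.sameCycle_pow_right.2 (.refl _ _)⟩
    rw [← commute_perm_pow hfσ]
    exact hy
  intro y y' hy hy'
  obtain ⟨r, hr, hr0, hry⟩ := main hy
  obtain ⟨r', hr', hr'0, hry'⟩ := main hy'
  obtain rfl := h.2 r r' hr hr' hr0 hr'0
  exact hry.symm.trans hry'

theorem apply_root (h : c.Compatible f) (hf : IsForest f) (hx : c.1 x = 0) :
    c.1 (hf.root x) = 0 := by rw [hf.map_root h.1, hx]

theorem apply_eq (h : c.Compatible f) (hf : IsForest f) (hx : c.1 x = 0) {y : α} {n : ℕ}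
    (hn : (σ ^ n) (hf.root x) = hf.root y) : c.1 y = n := by
  rw [← hf.map_root h.1 y, ← hn, c.pow_apply, h.apply_root hf hx, zero_add]

theorem pow_apply_eq_iff (h : c.Compatible f) (hf : IsForest f) (hx : c.1 x = 0)
    (hfσ : Function.Commute f σ) (n : ℕ) :
    (σ ^ n) (hf.root x) = hf.root x ↔ (d : ℕ) ∣ n := by
  have h0 := h.apply_root hf hx
  rw [← ZMod.natCast_eq_zero_iff]
  constructor
  · intro hn
    have hc := c.pow_apply n (hf.root x)
    rwa [hn, h0, zero_add, eq_comm] at hc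
  · intro hn
    refine h.2 _ _ ?_ (hf.apply_root x) (by rw [c.pow_apply, h0, hn, zero_add]) h0
    rw [commute_perm_pow hfσ, hf.apply_root]

theorem minimalPeriod_eq (h : c.Compatible f) (hf : IsForest f) (hx : c.1 x = 0)
    (hfσ : Function.Commute f σ) : (d : ℕ) = Function.minimalPeriod σ (hf.root x) :=
  Nat.dvd_right_iff_eq.1 fun n => by
    rw [← h.pow_apply_eq_iff hf hx hfσ, ← Function.isPeriodicPt_iff_minimalPeriod_dvd,
      Function.IsPeriodicPt, Function.IsFixedPt, Perm.iterate_eq_pow]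

end Compatible

theorem exists_compatible [Finite α] {f : α → α} (hf : IsForest f) (hfσ : Function.Commute f σ)
    (hO : HasOneRootOrbit σ f) (x : α) :
    ∃ c : CyclicColoring σ ⟨_, minimalPeriod_perm_pos σ (hf.root x)⟩,
      c.1 x = 0 ∧ c.Compatible f := by
  choose j hj using fun y => hO _ _ (hf.apply_root x) (hf.apply_root y)
  have hj_eq (y : α) (n : ℤ) : (j y : ZMod (Function.minimalPeriod σ (hf.root x))) = n ↔
      hf.root y = (σ ^ n) (hf.root x) := by
    rw [← zpow_apply_eq_iff, hj]
  have hj_zero {y : α} : (j y : ZMod (Function.minimalPeriod σ (hf.root x))) = 0 ↔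
      hf.root y = hf.root x := by
    rw [← Int.cast_zero, hj_eq, zpow_zero, Perm.one_apply]
  refine ⟨⟨fun y => (j y : ZMod (Function.minimalPeriod σ (hf.root x))), fun y => ?_⟩,
    hj_zero.2 rfl, fun y => (hj_eq _ _).2 (by rw [hf.root_apply, hj]), fun r r' hr hr' h h' => ?_⟩
  · have hstep : (j (σ y) : ZMod (Function.minimalPeriod σ (hf.root x))) = (j y + 1 : ℤ) := by
      rw [hj_eq, hf.root_perm hfσ, add_comm, zpow_add, zpow_one, Perm.mul_apply, hj]
    exact hstep.trans (by rw [Int.cast_add, Int.cast_one]; rfl)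
  · rw [← hf.root_of_fixed hr, ← hf.root_of_fixed hr', hj_zero.1 h, hj_zero.1 h']

variable (c : CyclicColoring σ d)

/-- Extend a function on the points of color zero to a function commuting with `σ`. -/
def spread (g : {x // c.1 x = 0} → {x // c.1 x = 0}) : α → α :=
  (c.coords (Equiv.refl _)).arrowCongr (c.coords (Equiv.refl _)) (Prod.map g id)

variable {g : {x // c.1 x = 0} → {x // c.1 x = 0}}

theorem spread_coords (i : {x // c.1 x = 0}) (j : ZMod d) :
    c.spread g (c.coords (Equiv.refl _) (i, j)) = c.coords (Equiv.refl _) (g i, j) := by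
  simp [spread]

theorem spread_coe (i : {x // c.1 x = 0}) : c.spread g i = g i := by
  simpa only [coords_apply, ZMod.val_zero, pow_zero, Perm.one_apply, refl_apply] using
    c.spread_coords i 0

theorem apply_spread (y : α) : c.1 (c.spread g y) = c.1 y := by
  obtain ⟨⟨i, j⟩, rfl⟩ := (c.coords (Equiv.refl _)).surjective y
  rw [spread_coords, apply_coords, apply_coords]

theorem isForest_spread (hg : IsForest g) : IsForest (c.spread g) := by
  rw [spread, ← isForest_arrowCongr]
  rintro ⟨i, j⟩
  obtain ⟨k, hk⟩ := hg i
  exact ⟨k, by rw [Prod.map_iterate, Prod.map_apply, Prod.map_apply, hk, Function.iterate_id, id]⟩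

theorem commute_spread (hg : Function.Commute g c.rootPerm) : Function.Commute (c.spread g) σ := by
  conv_rhs => rw [← c.permCongr_coords (Equiv.refl _)]
  rw [spread, ← commute_arrowCongr]
  rintro ⟨i, j⟩
  rw [Prod.map_apply, cyclicPerm_apply, cyclicPerm_apply, Prod.map_apply]
  refine Prod.ext ?_ rfl
  by_cases h : j + 1 = 0
  · exact (congrArg g (if_pos h)).trans ((hg i).trans (if_pos h).symm)
  · exact (congrArg g (if_neg h)).trans (if_neg h).symm

theorem compatible_spread (hg : IsTree g) : c.Compatible (c.spread g) := by
  refine ⟨fun y => c.apply_spread y, fun r r' hr hr' h h' => ?_⟩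
  lift r to {x // c.1 x = 0} using h
  lift r' to {x // c.1 x = 0} using h'
  rw [spread_coe, Subtype.coe_inj] at hr hr'
  exact congrArg Subtype.val (hg.eq_of_fixed hr hr')

theorem spread_restrictFun {f : α → α} (hf : Function.Commute f σ)
    (h : ∀ y, c.1 (f y) = 0 ↔ c.1 y = 0) :
    c.spread (restrictFun (P := fun y => c.1 y = 0) f h) = f := by
  funext y
  obtain ⟨⟨i, j⟩, rfl⟩ := (c.coords (Equiv.refl _)).surjective y
  rw [spread_coords, coords_apply, coords_apply, commute_perm_pow hf]
  rfl

theorem isTree_restrictFun {f : α → α} (hc : c.Compatible f) (hf : IsForest f) {x : α}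
    (hx : c.1 x = 0) (h : ∀ y, c.1 (f y) = 0 ↔ c.1 y = 0) :
    IsTree (restrictFun (P := fun y => c.1 y = 0) f h) := by
  refine ⟨⟨hf.root x, hc.apply_root hf hx⟩, Subtype.ext (hf.apply_root x), fun y => ?_⟩
  obtain ⟨k, hk⟩ := hf.exists_iterate_eq_root y.1
  refine ⟨k, Subtype.ext ?_⟩
  rw [restrictFun_iterate, hk]
  exact hc.2 _ _ (hf.apply_root y.1) (hf.apply_root x) (hc.apply_root hf y.2)
    (hc.apply_root hf hx)

/-- A fixed forest compatible with a cyclic coloring is determined by its tree of color zero. -/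
def compatibleEquiv {x : α} (hx : c.1 x = 0) :
    {f : FixedOrbitForest σ // c.Compatible f.1.1} ≃ FixedTree c.rootPerm where
  toFun f := ⟨restrictFun f.1.1.1 fun y => by rw [f.2.1], c.isTree_restrictFun f.2 f.1.1.2.1 hx _,
    fun y => Subtype.ext (commute_perm_pow f.1.1.2.2 d y)⟩
  invFun g := ⟨⟨⟨c.spread g.1, c.isForest_spread g.2.1.isForest, c.commute_spread g.2.2⟩,
    (c.compatible_spread g.2.1).hasOneRootOrbit (c.commute_spread g.2.2)⟩,
    c.compatible_spread g.2.1⟩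
  left_inv f := Subtype.ext (Subtype.ext (Subtype.ext (c.spread_restrictFun f.1.1.2.2 fun y => by
    rw [f.2.1])))
  right_inv g := Subtype.ext (funext fun i => Subtype.ext (c.spread_coe i))

end CyclicColoring

theorem existsUnique_compatible [Finite α] (D : Finset ℕ+)
    (hD : ∀ d : ℕ+, (d : ℕ) ≤ Nat.card α → d ∈ D) (x : α) (f : FixedOrbitForest σ) :
    ∃! c : Σ d : D, {c : CyclicColoring σ d.1 // c.1 x = 0}, c.2.1.Compatible f.1.1 := by
  classical
  have := Fintype.ofFinite α
  obtain ⟨⟨f, hf, hfσ⟩, hO⟩ := f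
  obtain ⟨c, hc0, hc⟩ := CyclicColoring.exists_compatible hf hfσ hO x
  refine ⟨⟨⟨_, hD _ ?_⟩, c, hc0⟩, hc, ?_⟩
  · rw [PNat.mk_coe, Nat.card_eq_fintype_card]
    exact Function.minimalPeriod_le_card
  · rintro ⟨⟨d, hd⟩, c', hc0'⟩ (hc' : c'.Compatible f)
    obtain rfl : d = ⟨_, minimalPeriod_perm_pos σ (hf.root x)⟩ :=
      PNat.coe_injective (hc'.minimalPeriod_eq hf hc0' hfσ)
    obtain rfl : c' = c := Subtype.ext <| funext fun y => by
      obtain ⟨n, -, hn⟩ := (hO _ _ (hf.apply_root x) (hf.apply_root y)).exists_pow_eq'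
      rw [hc'.apply_eq hf hc0' hn, hc.apply_eq hf hc0 hn]
    rfl

end Compatible

theorem natCard_eq_sum_of_existsUnique {X Y : Type*} [Finite X] [Fintype Y] (R : X → Y → Prop)
    (h : ∀ x, ∃! y, R x y) : Nat.card X = ∑ y, Nat.card {x // R x y} := by
  choose g hg hu using h
  rw [← Nat.card_congr (Equiv.sigmaFiberEquiv g), Nat.card_sigma]
  refine Finset.sum_congr rfl fun y _ => Nat.card_congr (Equiv.subtypeEquivRight fun x => ?_)
  exact ⟨fun hy => hy ▸ hg x, fun hy => (hu x y hy).symm⟩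

section CountOrbitForests

variable {α : Type} [Finite α] (σ : Perm α) (D : Finset ℕ+)

theorem orbitForestFun_eq_sum (hD : ∀ d : ℕ+, (d : ℕ) ≤ Nat.card α → d ∈ D) (x : α) :
    orbitForestFun α σ =
    ∑ d ∈ D, ∑ᶠ c : CyclicColoring σ d, if c.1 x = 0 then treeFun _ c.rootPerm else 0 := by
  classical
  have (d : ℕ+) : Fintype (CyclicColoring σ d) := Fintype.ofFinite _
  rw [orbitForestFun, natCard_eq_sum_of_existsUnique _ (existsUnique_compatible D hD x),
    Fintype.sum_sigma, Nat.cast_sum, ← Finset.sum_coe_sort D]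
  refine Finset.sum_congr rfl fun d _ => ?_
  rw [finsum_eq_sum_of_fintype, ← Finset.sum_filter, Nat.cast_sum,
    Finset.sum_subtype (p := fun c : CyclicColoring σ d.1 => c.1 x = 0) _ (by simp)]
  exact Finset.sum_congr rfl fun c _ =>
    congrArg Nat.cast (Nat.card_congr (c.1.compatibleEquiv c.2))

theorem card_mul_orbitForestFun (hD : ∀ d : ℕ+, (d : ℕ) ≤ Nat.card α → d ∈ D) :
    Nat.card α * orbitForestFun α σ =
    ∑ d ∈ D, adamsFun d (fun β τ => Nat.card β * treeFun β τ) α σ := by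
  classical
  have := Fintype.ofFinite α
  have (d : ℕ+) : Fintype (CyclicColoring σ d) := Fintype.ofFinite _
  rw [Nat.card_eq_fintype_card, ← nsmul_eq_mul, ← Finset.card_univ, ← Finset.sum_const,
    Finset.sum_congr rfl fun x _ => orbitForestFun_eq_sum σ D hD x, Finset.sum_comm]
  refine Finset.sum_congr rfl fun d _ => ?_
  simp only [adamsFun, finsum_eq_sum_of_fintype]
  rw [Finset.sum_comm]
  refine Finset.sum_congr rfl fun c _ => ?_
  rw [← Finset.sum_filter, Finset.sum_const, nsmul_eq_mul, Nat.card_eq_fintype_card,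
    Fintype.card_subtype]

end CountOrbitForests

theorem cycleIndex_card_mul_orbitForestFun :
    cycleIndex (fun α σ => Nat.card α * orbitForestFun α σ) = adamsSum (euler PreLie) := by
  classical
  ext m
  have hfin := finite_support_coeff_adamsHom (constantCoeff_euler PreLie) m
  let D : Finset ℕ+ := hfin.toFinset ∪ Finset.Iic (Nat.succPNat (degree m))
  have hD (d : ℕ+) (hd : (d : ℕ) ≤ degree m) : d ∈ D := by
    refine Finset.mem_union_right _ (Finset.mem_Iic.2 ?_)
    rw [← PNat.coe_le_coe, Nat.succPNat_coe]
    exact hd.trans (Nat.le_succ _)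
  have hcoeff : coeff m (cycleIndex fun α σ => Nat.card α * orbitForestFun α σ) =
      coeff m (cycleIndex fun α σ =>
        ∑ d ∈ D, adamsFun d (fun β τ => Nat.card β * treeFun β τ) α σ) := by
    rw [coeff_cycleIndex, coeff_cycleIndex, cycleTypeSum, cycleTypeSum]
    congr 1
    refine Finset.sum_congr rfl fun σ _ => ?_
    rw [card_mul_orbitForestFun σ D (by simpa using hD)]
  rw [hcoeff, cycleIndex_finset_sum, map_sum, coeff_adamsSum,
    finsum_eq_sum_of_support_subset (s := D) _ fun d hd =>
      Finset.mem_union_left _ (hfin.mem_toFinset.2 hd)]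
  refine Finset.sum_congr rfl fun d _ => ?_
  rw [cycleIndex_adamsFun isClassFun_treeFun.card_mul, ← euler_cycleIndex, PreLie_eq_cycleIndex]

theorem PreLie_eq_mul : PreLie = p 1 * cycleIndex forestFun := by
  rw [PreLie_eq_cycleIndex, cycleIndex_treeFun]

theorem constantCoeff_PreLie : constantCoeff PreLie = 0 := by
  rw [PreLie_eq_mul, map_mul, constantCoeff_X, zero_mul]

theorem constantCoeff_cycleIndex (F : PermFun) : constantCoeff (cycleIndex F) = F (Fin 0) 1 := by
  have h := factorial_mul_coeff_cycleIndex F (m := 0) (n := 0) (map_zero _)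
  rwa [Nat.factorial_zero, Nat.cast_one, one_mul, coeff_zero_eq_constantCoeff_apply, cycleTypeSum,
    Fintype.sum_subsingleton _ 1, cycleExponents_one, Nat.card_eq_fintype_card, Fintype.card_fin,
    Finsupp.single_zero, if_pos rfl] at h

theorem forestFun_of_isEmpty {α : Type} [IsEmpty α] (σ : Perm α) : forestFun α σ = 1 := by
  have : Unique (FixedForest σ) :=
    { default := ⟨id, fun x => isEmptyElim x, fun x => isEmptyElim x⟩
      uniq := fun f => Subtype.ext (Subsingleton.elim _ _) }
  rw [forestFun, Nat.card_unique, Nat.cast_one]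

theorem cycleIndex_forestFun : cycleIndex forestFun = plethysticExp PreLie := by
  refine eq_plethysticExp constantCoeff_PreLie ?_ ?_
  · rw [constantCoeff_cycleIndex, forestFun_of_isEmpty]
  · rw [euler_cycleIndex_forestFun, cycleIndex_card_mul_orbitForestFun, mul_comm]

theorem PreLie_eq_p_mul_plethysticExp : PreLie = p 1 * plethysticExp PreLie := by
  rw [← cycleIndex_forestFun, ← PreLie_eq_mul]

/-! ### Multilinear elements of free Lie algebras -/

section Relabel

section MapLie

variable {R : Type*} [CommRing R] {α β γ : Type*}

/-- The homomorphism of free Lie algebras induced by a map between the generators. -/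
def mapLie (f : α → β) : FreeLieAlgebra R α →ₗ⁅R⁆ FreeLieAlgebra R β :=
  FreeLieAlgebra.lift R fun i => FreeLieAlgebra.of R (f i)

theorem mapLie_of (f : α → β) (i : α) :
    mapLie f (FreeLieAlgebra.of R i) = FreeLieAlgebra.of R (f i) :=
  FreeLieAlgebra.lift_of_apply _ i

theorem mapLie_mapLie (g : β → γ) (f : α → β) (x : FreeLieAlgebra R α) :
    mapLie g (mapLie f x) = mapLie (g ∘ f) x := by
  have h : (mapLie g).comp (mapLie f) = mapLie (R := R) (g ∘ f) :=
    FreeLieAlgebra.hom_ext fun i => by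
      rw [LieHom.comp_apply, mapLie_of, mapLie_of, mapLie_of, Function.comp_apply]
  exact DFunLike.congr_fun h x

theorem mapLie_id (x : FreeLieAlgebra R α) : mapLie id x = x := by
  have h : mapLie (id : α → α) = LieHom.id (R := R) := FreeLieAlgebra.hom_ext fun i => mapLie_of ..
  exact DFunLike.congr_fun h x

end MapLie

variable {α β : Type}

theorem IsBracketing.mapLie [DecidableEq α] [DecidableEq β] (e : α ↪ β) {S : Finset α}
    {x : FreeLieAlgebra ℚ α} (h : IsBracketing S x) :
    IsBracketing (S.map e) (mapLie e x) := by
  induction h with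
  | of i =>
    rw [mapLie_of, Finset.map_singleton]
    exact .of _
  | lie h _ _ ihx ihy =>
    rw [LieHom.map_lie, Finset.map_union]
    exact .lie ((Finset.disjoint_map _).2 h) ihx ihy

/-- The multilinear part of a free Lie algebra: the analogue of `lieOperad` for an arbitrary type
of generators. The decidability instance is quantified so that the definition needs none. -/
def multilinearLie (α : Type) : Submodule ℚ (FreeLieAlgebra ℚ α) :=
  Submodule.span ℚ {x | ∃ (_ : DecidableEq α) (S : Finset α), (∀ a, a ∈ S) ∧ IsBracketing S x}

theorem IsBracketing.mem_multilinearLie [DecidableEq α] {S : Finset α} {x : FreeLieAlgebra ℚ α}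
    (h : IsBracketing S x) (hS : ∀ a, a ∈ S) : x ∈ multilinearLie α :=
  Submodule.subset_span ⟨_, S, hS, h⟩

theorem multilinearLie_le {N : Submodule ℚ (FreeLieAlgebra ℚ α)} [dec : DecidableEq α]
    (h : ∀ (S : Finset α) x, (∀ a, a ∈ S) → IsBracketing S x → x ∈ N) : multilinearLie α ≤ N := by
  refine Submodule.span_le.2 ?_
  rintro x ⟨dec', S, hS, hx⟩
  obtain rfl : dec = dec' := Subsingleton.elim _ _
  exact h S x hS hx

theorem mapLie_mem_multilinearLie (e : α ≃ β) {x : FreeLieAlgebra ℚ α}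
    (hx : x ∈ multilinearLie α) : mapLie e x ∈ multilinearLie β := by
  classical
  refine (multilinearLie_le (N := (multilinearLie β).comap
    (mapLie (R := ℚ) e).toLinearMap) fun S y hS hy => ?_) hx
  exact (hy.mapLie e.toEmbedding).mem_multilinearLie fun b => Finset.mem_map_equiv.2 (hS _)

/-- The action of a bijection on multilinear elements. -/
def multilinearLieEquiv (e : α ≃ β) : multilinearLie α ≃ₗ[ℚ] multilinearLie β where
  toFun x := ⟨mapLie e x.1, mapLie_mem_multilinearLie e x.2⟩
  invFun x := ⟨mapLie e.symm x.1, mapLie_mem_multilinearLie e.symm x.2⟩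
  map_add' x y := Subtype.ext (map_add (mapLie e) x.1 y.1)
  map_smul' c x := Subtype.ext (map_smul (mapLie e) c x.1)
  left_inv x := Subtype.ext ((mapLie_mapLie ..).trans (by rw [e.symm_comp_self, mapLie_id]))
  right_inv x := Subtype.ext ((mapLie_mapLie ..).trans (by rw [e.self_comp_symm, mapLie_id]))

theorem coe_multilinearLieEquiv (e : α ≃ β) (x : multilinearLie α) :
    (multilinearLieEquiv e x : FreeLieAlgebra ℚ β) = mapLie e x.1 := rfl

end Relabel

/-- The character of the multilinear part of the free Lie algebras. -/
def lieFun : PermFun := fun α σ =>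
  LinearMap.trace ℚ (multilinearLie α) (multilinearLieEquiv σ).toLinearMap

theorem isClassFun_lieFun : IsClassFun lieFun := fun α β e σ => by
  rw [lieFun, lieFun, ← LinearMap.trace_conj' _ (multilinearLieEquiv e)]
  congr 1
  ext x
  change mapLie (e.permCongr σ) x.1 = mapLie e (mapLie σ (mapLie e.symm x.1))
  rw [mapLie_mapLie, mapLie_mapLie]
  rfl

theorem lieOperad_eq_multilinearLie (n : ℕ) : lieOperad n = multilinearLie (Fin n) := by
  refine le_antisymm (Submodule.span_le.2 fun x hx =>
    IsBracketing.mem_multilinearLie hx Finset.mem_univ) (multilinearLie_le fun S x hS hx => ?_)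
  obtain rfl : S = Finset.univ := Finset.eq_univ_iff_forall.2 hS
  exact Submodule.subset_span hx

theorem Lie_eq_cycleIndex : Lie = cycleIndex lieFun := by
  refine frobeniusSeries_eq_cycleIndex _ fun n σ => ?_
  rw [Representation.character, lieFun,
    ← LinearMap.trace_conj' _ (LinearEquiv.ofEq _ _ (lieOperad_eq_multilinearLie n))]
  rfl

/-! ### Left-normed brackets -/

section LieRing

variable {R L : Type*} [CommRing R] [LieRing L] [LieAlgebra R L]

theorem lie_mem_of_mem_span_left {s : Set L} {N : Submodule R L} {x y : L}
    (h : ∀ z ∈ s, ⁅z, y⁆ ∈ N) (hx : x ∈ Submodule.span R s) : ⁅x, y⁆ ∈ N := by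
  induction hx using Submodule.span_induction with
  | mem x hx => exact h x hx
  | zero =>
    rw [zero_lie]
    exact N.zero_mem
  | add _ _ _ _ h h' =>
    rw [add_lie]
    exact N.add_mem h h'
  | smul a _ _ h =>
    rw [smul_lie]
    exact N.smul_mem a h

theorem lie_mem_of_mem_span {s t : Set L} {N : Submodule R L} {x y : L}
    (h : ∀ z ∈ s, ∀ w ∈ t, ⁅z, w⁆ ∈ N) (hx : x ∈ Submodule.span R s)
    (hy : y ∈ Submodule.span R t) : ⁅x, y⁆ ∈ N := by
  refine lie_mem_of_mem_span_left (fun z hz => ?_) hx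
  rw [← lie_skew]
  refine N.neg_mem (lie_mem_of_mem_span_left (fun w hw => ?_) hy)
  rw [← lie_skew]
  exact N.neg_mem (h z hz w hw)

end LieRing

section Bracketing

variable {α : Type} [DecidableEq α] {E : Finset α → Submodule ℚ (FreeLieAlgebra ℚ α)}
  {S : Finset α} {x : FreeLieAlgebra ℚ α}

-- The Jacobi identity turns the bracket with an iterated bracket into iterated brackets with
-- generators.
theorem IsBracketing.lie_mem (h : IsBracketing S x)
    (hE : ∀ b ∈ S, ∀ T, b ∉ T → ∀ w ∈ E T, ⁅w, FreeLieAlgebra.of ℚ b⁆ ∈ E (T ∪ {b})) :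
    ∀ T, Disjoint T S → ∀ w ∈ E T, ⁅w, x⁆ ∈ E (T ∪ S) := by
  induction h with
  | of b =>
    exact fun T hT => hE b (Finset.mem_singleton_self b) T (Finset.disjoint_singleton_right.1 hT)
  | @lie S S' x y hSS' _ _ ihx ihy =>
    intro T hT w hw
    replace ihx := ihx fun b hb => hE b (Finset.mem_union_left _ hb)
    replace ihy := ihy fun b hb => hE b (Finset.mem_union_right _ hb)
    obtain ⟨hTS, hTS'⟩ := Finset.disjoint_union_right.1 hT
    have hxy := ihy _ (Finset.disjoint_union_left.2 ⟨hTS', hSS'⟩) _ (ihx T hTS w hw)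
    have hyx := ihx _ (Finset.disjoint_union_left.2 ⟨hTS, hSS'.symm⟩) _ (ihy T hTS' w hw)
    rw [Finset.union_assoc] at hxy hyx
    rw [Finset.union_comm S' S] at hyx
    rw [leibniz_lie w x y, ← lie_skew x ⁅w, y⁆, ← sub_eq_add_neg]
    exact sub_mem hxy hyx

theorem IsBracketing.mem_of_lie_mem (h : IsBracketing S x) {P : α → Prop}
    (hof : ∀ c, P c → FreeLieAlgebra.of ℚ c ∈ E {c})
    (hE : ∀ b, ¬P b → ∀ T, b ∉ T → ∀ w ∈ E T, ⁅w, FreeLieAlgebra.of ℚ b⁆ ∈ E (T ∪ {b}))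
    (hlie : ∀ S T, Disjoint S T → (∃ c ∈ S, P c) → (∃ c ∈ T, P c) →
      ∀ x ∈ E S, ∀ y ∈ E T, ⁅x, y⁆ ∈ E (S ∪ T)) : (∃ c ∈ S, P c) → x ∈ E S := by
  induction h with
  | of b =>
    rintro ⟨c, hc, hPc⟩
    obtain rfl := Finset.mem_singleton.1 hc
    exact hof c hPc
  | @lie S T x y hST hx hy ihx ihy =>
    intro hP
    by_cases hS : ∃ c ∈ S, P c
    · by_cases hT : ∃ c ∈ T, P c
      · exact hlie S T hST hS hT x (ihx hS) y (ihy hT)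
      · exact hy.lie_mem (fun b hb => hE b fun hPb => hT ⟨b, hb, hPb⟩) S hST x (ihx hS)
    · have hT : ∃ c ∈ T, P c := by
        obtain ⟨c, hc, hPc⟩ := hP
        exact ⟨c, (Finset.mem_union.1 hc).resolve_left fun hcS => hS ⟨c, hcS, hPc⟩, hPc⟩
      rw [← lie_skew, Finset.union_comm]
      exact neg_mem (hx.lie_mem (fun b hb => hE b fun hPb => hS ⟨b, hb, hPb⟩) T hST.symm y (ihy hT))

end Bracketing

section LeftBracket

section General

variable {R : Type*} [CommRing R] {α β : Type*}

/-- The left-normed bracket `[[…[x, l₁], …], l_k]`. -/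
def leftBracket (x : FreeLieAlgebra R α) (l : List α) : FreeLieAlgebra R α :=
  l.foldl (fun y b => ⁅y, FreeLieAlgebra.of R b⁆) x

theorem leftBracket_nil (x : FreeLieAlgebra R α) : leftBracket x [] = x := rfl

theorem leftBracket_cons (x : FreeLieAlgebra R α) (b : α) (l : List α) :
    leftBracket x (b :: l) = leftBracket ⁅x, FreeLieAlgebra.of R b⁆ l := rfl

theorem leftBracket_append_singleton (x : FreeLieAlgebra R α) (l : List α) (b : α) :
    leftBracket x (l ++ [b]) = ⁅leftBracket x l, FreeLieAlgebra.of R b⁆ :=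
  List.foldl_append

theorem mapLie_leftBracket (f : α → β) (x : FreeLieAlgebra R α) (l : List α) :
    mapLie f (leftBracket x l) = leftBracket (mapLie f x) (l.map f) := by
  induction l generalizing x with
  | nil => rfl
  | cons b l ih => rw [leftBracket_cons, ih, LieHom.map_lie, mapLie_of, List.map_cons,
      leftBracket_cons]

/-- The enumerations of a type which start with a given element. -/
abbrev Arrangement (c : α) : Type _ := {l : List α // (c :: l).Nodup ∧ ∀ a, a ∈ c :: l}

instance [Finite α] (c : α) : Finite (Arrangement c) := by
  classical
  have := Fintype.ofFinite α
  exact Finite.of_injective (fun l : Arrangement c =>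
    (⟨l.1, (List.nodup_cons.1 l.2.1).2⟩ : {l : List α // l.Nodup})) fun l l' h =>
      Subtype.ext (Subtype.mk.inj h)

attribute [local instance] LieRing.ofAssociativeRing

/-- The action of the free Lie algebra on words for which each generator is prepended. -/
def wordAction : FreeLieAlgebra R α →ₗ⁅R⁆ Module.End R (List α →₀ R) :=
  FreeLieAlgebra.lift R fun a => Finsupp.lmapDomain R R (List.cons a)

theorem wordAction_of (a : α) (v : List α →₀ R) :
    wordAction (FreeLieAlgebra.of R a) v = Finsupp.mapDomain (List.cons a) v := by
  rw [wordAction, FreeLieAlgebra.lift_of_apply]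
  rfl

-- Among the words of a left-normed bracket, only one keeps the first letter in front.
open scoped Classical in
theorem wordAction_leftBracket {a : α} (l : List α) (ha : a ∉ l) (s w : List α) :
    wordAction (leftBracket (FreeLieAlgebra.of R a) l) (Finsupp.single s 1) (a :: w) =
      if w = l ++ s then 1 else 0 := by
  induction l using List.reverseRecOn generalizing s with
  | nil =>
    rw [leftBracket_nil, wordAction_of, Finsupp.mapDomain_single, Finsupp.single_apply,
      List.nil_append]
    exact if_congr (by rw [List.cons_inj_right, eq_comm]) rfl rfl
  | append_singleton l b ih =>
    rw [List.mem_append, not_or, List.mem_singleton] at ha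
    have hb : a :: w ∉ Set.range (List.cons b) := by
      rintro ⟨v, hv⟩
      exact ha.2 (List.cons.inj hv).1.symm
    rw [leftBracket_append_singleton, LieHom.map_lie, LieRing.of_associative_ring_bracket,
      LinearMap.sub_apply, Finsupp.sub_apply, Module.End.mul_apply, Module.End.mul_apply,
      wordAction_of, wordAction_of, Finsupp.mapDomain_single, ih ha.1,
      Finsupp.mapDomain_of_notMem_range _ _ hb, sub_zero, List.append_assoc, List.singleton_append]

theorem linearIndependent_leftBracket (c : α) : LinearIndependent R
    fun l : Arrangement c => leftBracket (FreeLieAlgebra.of R c) l.1 := by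
  classical
  rw [linearIndependent_iff']
  intro s g hg l hl
  have h := congrArg (fun x => wordAction x (Finsupp.single [] 1) (c :: l.1)) hg
  simp only [map_sum, map_smul, LinearMap.sum_apply, LinearMap.smul_apply, Finsupp.finsetSum_apply,
    Finsupp.smul_apply, map_zero, LinearMap.zero_apply, Finsupp.zero_apply] at h
  have hcoeff (l' : Arrangement c) : wordAction (leftBracket (FreeLieAlgebra.of R c) l'.1)
      (Finsupp.single [] 1) (c :: l.1) = if l = l' then 1 else 0 := by
    rw [wordAction_leftBracket _ (List.nodup_cons.1 l'.2.1).1, List.append_nil]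
    exact if_congr Subtype.ext_iff.symm rfl rfl
  simpa only [hcoeff, smul_eq_mul, mul_ite, mul_one, mul_zero, Finset.sum_ite_eq, if_pos hl]
    using h

end General

variable {α : Type}

theorem IsBracketing.leftBracket [DecidableEq α] {l : List α} : ∀ {S : Finset α}
    {x : FreeLieAlgebra ℚ α}, IsBracketing S x → l.Nodup → (∀ b ∈ l, b ∉ S) →
      IsBracketing (S ∪ l.toFinset) (leftBracket x l) := by
  induction l with
  | nil =>
    intro S x hx _ _
    rwa [List.toFinset_nil, Finset.union_empty]
  | cons b l ih =>
    intro S x hx hl hS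
    rw [List.nodup_cons] at hl
    rw [List.toFinset_cons, Finset.insert_eq, ← Finset.union_assoc, leftBracket_cons]
    refine ih (.lie ?_ hx (.of b)) hl.2 fun c hc => ?_
    · exact Finset.disjoint_singleton_right.2 (hS b List.mem_cons_self)
    · rw [Finset.mem_union, Finset.mem_singleton, not_or]
      exact ⟨hS c (List.mem_cons_of_mem _ hc), fun h => hl.1 (h ▸ hc)⟩

theorem leftBracket_mem_multilinearLie {c : α} (l : Arrangement c) :
    leftBracket (FreeLieAlgebra.of ℚ c) l.1 ∈ multilinearLie α := by
  classical
  have h := List.nodup_cons.1 l.2.1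
  refine ((IsBracketing.of c).leftBracket h.2 fun b hb => ?_).mem_multilinearLie fun a => ?_
  · rw [Finset.mem_singleton]
    rintro rfl
    exact h.1 hb
  · rw [Finset.mem_union, Finset.mem_singleton, List.mem_toFinset, ← List.mem_cons]
    exact l.2.2 a

/-- The span of the left-normed brackets starting with `c` whose letters are the elements
of `S`. -/
def leftBracketSpan (c : α) (S : Finset α) : Submodule ℚ (FreeLieAlgebra ℚ α) :=
  Submodule.span ℚ {x | ∃ l : List α, ((c :: l).Nodup ∧ ∀ a, a ∈ c :: l ↔ a ∈ S) ∧
    x = leftBracket (FreeLieAlgebra.of ℚ c) l}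

theorem lie_of_mem_leftBracketSpan [DecidableEq α] {c b : α} {S : Finset α} (hb : b ∉ S)
    {w : FreeLieAlgebra ℚ α} (hw : w ∈ leftBracketSpan c S) :
    ⁅w, FreeLieAlgebra.of ℚ b⁆ ∈ leftBracketSpan c (S ∪ {b}) := by
  refine lie_mem_of_mem_span_left ?_ hw
  rintro _ ⟨l, ⟨hl, hm⟩, rfl⟩
  refine Submodule.subset_span
    ⟨l ++ [b], ⟨?_, fun a => ?_⟩, (leftBracket_append_singleton _ _ _).symm⟩
  · rw [← List.cons_append, ← List.concat_eq_append]
    exact hl.concat ((hm b).not.2 hb)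
  · rw [← List.cons_append, List.mem_append, hm, Finset.mem_union, List.mem_singleton,
      Finset.mem_singleton]

theorem IsBracketing.mem_leftBracketSpan [DecidableEq α] {c : α} {S : Finset α}
    {x : FreeLieAlgebra ℚ α} (h : IsBracketing S x) (hc : c ∈ S) : x ∈ leftBracketSpan c S := by
  refine h.mem_of_lie_mem (P := (· = c)) ?_ (fun _ _ _ hb _ => lie_of_mem_leftBracketSpan hb)
    ?_ ⟨c, hc, rfl⟩
  · rintro _ rfl
    exact Submodule.subset_span ⟨[], ⟨List.nodup_singleton _, fun _ => by
      rw [List.mem_singleton, Finset.mem_singleton]⟩, rfl⟩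
  · rintro S T hST ⟨_, hS, rfl⟩ ⟨_, hT, rfl⟩
    exact absurd hT (Finset.disjoint_left.1 hST hS)

theorem multilinearLie_eq_span_leftBracket (c : α) : multilinearLie α =
    Submodule.span ℚ (Set.range fun l : Arrangement c =>
      leftBracket (FreeLieAlgebra.of ℚ c) l.1) := by
  classical
  refine le_antisymm (multilinearLie_le fun S x hS hx => ?_) (Submodule.span_le.2 ?_)
  · refine Submodule.span_mono ?_ (hx.mem_leftBracketSpan (hS c))
    rintro _ ⟨l, ⟨hl, hm⟩, rfl⟩
    exact ⟨⟨l, hl, fun a => (hm a).2 (hS a)⟩, rfl⟩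
  · rintro _ ⟨l, rfl⟩
    exact leftBracket_mem_multilinearLie l

theorem multilinearLie_eq_bot [IsEmpty α] : multilinearLie α = ⊥ := by
  classical
  rw [eq_bot_iff]
  refine multilinearLie_le fun S x hS hx => ?_
  exfalso
  induction hx with
  | of i => exact isEmptyElim i
  | lie _ _ _ ih _ => exact ih isEmptyElim

instance [Finite α] : Module.Finite ℚ (multilinearLie α) := by
  rcases isEmpty_or_nonempty α with h | ⟨⟨c⟩⟩
  · rw [multilinearLie_eq_bot]
    infer_instance
  · rw [multilinearLie_eq_span_leftBracket c]
    exact FiniteDimensional.span_of_finite ℚ (Set.finite_range _)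

theorem finrank_multilinearLie [Finite α] (c : α) :
    Module.finrank ℚ (multilinearLie α) = Nat.card (Arrangement c) := by
  have := Fintype.ofFinite (Arrangement c)
  rw [multilinearLie_eq_span_leftBracket c, Nat.card_eq_fintype_card]
  exact finrank_span_eq_card (linearIndependent_leftBracket c)

end LeftBracket

/-! ### Elimination in free Lie algebras -/

section Elimination

section ElimHom

variable {R : Type*} [CommRing R] {κ β : Type*}

/-- The homomorphism from the free Lie algebra on `κ` to the free Lie algebra on `κ ⊕ β` which
sends a generator `c` to the left-normed bracket of `c` and of the list `u c`. -/
def elimHom (u : κ → List β) : FreeLieAlgebra R κ →ₗ⁅R⁆ FreeLieAlgebra R (κ ⊕ β) :=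
  FreeLieAlgebra.lift R fun c =>
    leftBracket (FreeLieAlgebra.of R (Sum.inl c)) ((u c).map Sum.inr)

theorem elimHom_of (u : κ → List β) (c : κ) : elimHom u (FreeLieAlgebra.of R c) =
    leftBracket (FreeLieAlgebra.of R (Sum.inl c)) ((u c).map Sum.inr) :=
  FreeLieAlgebra.lift_of_apply _ c

end ElimHom

section AppendLetter

variable {κ β : Type*} [DecidableEq κ] (u : κ → List β) (b : β) {c c' : κ}

/-- Append a letter to one of the lists. -/
def appendLetter (c : κ) : κ → List β :=
  Function.update u c (u c ++ [b])

theorem appendLetter_self : appendLetter u b c c = u c ++ [b] :=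
  Function.update_self ..

theorem appendLetter_of_ne (h : c' ≠ c) : appendLetter u b c c' = u c' :=
  Function.update_of_ne h ..

theorem sum_count_appendLetter [DecidableEq β] {T : Finset κ} (hc : c ∈ T) (b' : β) :
    ∑ c' ∈ T, (appendLetter u b c c').count b' =
      ∑ c' ∈ T, (u c').count b' + if b = b' then 1 else 0 := by
  rw [← Finset.add_sum_erase _ _ hc, ← Finset.add_sum_erase _ (fun c' => (u c').count b') hc,
    appendLetter_self, List.count_append, List.count_singleton, add_right_comm, add_assoc,
    add_assoc]
  congr 1
  rw [Finset.sum_congr rfl fun c' hc' => by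
    rw [appendLetter_of_ne u b (Finset.ne_of_mem_erase hc')]]
  simp only [beq_iff_eq]

end AppendLetter

variable {κ β : Type} [DecidableEq κ]

theorem IsBracketing.elimHom_congr {T : Finset κ} {z : FreeLieAlgebra ℚ κ} (h : IsBracketing T z)
    {u u' : κ → List β} (hu : ∀ c ∈ T, u c = u' c) : elimHom u z = elimHom u' z := by
  induction h with
  | of c => rw [elimHom_of, elimHom_of, hu c (Finset.mem_singleton_self c)]
  | lie _ _ _ ihx ihy =>
    rw [LieHom.map_lie, LieHom.map_lie, ihx fun c hc => hu c (Finset.mem_union_left _ hc),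
      ihy fun c hc => hu c (Finset.mem_union_right _ hc)]

-- The derivation `⁅·, b⁆` acts on each factor of an iterated bracket in turn.
theorem IsBracketing.lie_elimHom {T : Finset κ} {z : FreeLieAlgebra ℚ κ} (h : IsBracketing T z)
    (u : κ → List β) (b : β) : ⁅elimHom u z, FreeLieAlgebra.of ℚ (Sum.inr b)⁆ =
      ∑ c ∈ T, elimHom (appendLetter u b c) z := by
  induction h with
  | of c =>
    rw [Finset.sum_singleton, elimHom_of, elimHom_of, appendLetter_self, List.map_append,
      List.map_singleton, leftBracket_append_singleton]
  | @lie S T x y hST hx hy ihx ihy =>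
    have hS : ∀ c ∈ S, elimHom (appendLetter u b c) ⁅x, y⁆ =
        ⁅elimHom (appendLetter u b c) x, elimHom u y⁆ := fun c hc => by
      rw [LieHom.map_lie, hy.elimHom_congr fun c' hc' => appendLetter_of_ne u b ?_]
      exact (Finset.disjoint_iff_ne.1 hST c hc c' hc').symm
    have hT : ∀ c ∈ T, elimHom (appendLetter u b c) ⁅x, y⁆ =
        ⁅elimHom u x, elimHom (appendLetter u b c) y⁆ := fun c hc => by
      rw [LieHom.map_lie, hx.elimHom_congr fun c' hc' => appendLetter_of_ne u b ?_]
      exact Finset.disjoint_iff_ne.1 hST c' hc' c hc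
    rw [LieHom.map_lie, Finset.sum_union hST, Finset.sum_congr rfl hS, Finset.sum_congr rfl hT,
      ← sum_lie, ← lie_sum, ← ihx, ← ihy, lie_lie, ← lie_skew (elimHom u y) ⁅elimHom u x, _⁆]
    abel

variable [DecidableEq β]

/-- The span of the images of bracketings under the homomorphisms `elimHom u`, where the letters
involved are those of `S`. -/
def elimSpan (S : Finset (κ ⊕ β)) : Submodule ℚ (FreeLieAlgebra ℚ (κ ⊕ β)) :=
  Submodule.span ℚ {w | ∃ (T : Finset κ) (u : κ → List β) (z : FreeLieAlgebra ℚ κ),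
    IsBracketing T z ∧ (∀ c, c ∈ T ↔ Sum.inl c ∈ S) ∧
      (∀ b, ∑ c ∈ T, (u c).count b = if Sum.inr b ∈ S then 1 else 0) ∧ w = elimHom u z}

theorem lie_mem_elimSpan {S S' : Finset (κ ⊕ β)} (hS : Disjoint S S')
    {w w' : FreeLieAlgebra ℚ (κ ⊕ β)} (hw : w ∈ elimSpan S) (hw' : w' ∈ elimSpan S') :
    ⁅w, w'⁆ ∈ elimSpan (S ∪ S') := by
  refine lie_mem_of_mem_span ?_ hw hw'
  rintro _ ⟨T, u, z, hz, hT, hu, rfl⟩ _ ⟨T', u', z', hz', hT', hu', rfl⟩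
  have hTT' : Disjoint T T' := Finset.disjoint_left.2 fun c hc hc' =>
    Finset.disjoint_left.1 hS ((hT c).1 hc) ((hT' c).1 hc')
  have hu_left : ∀ c ∈ T, T.piecewise u u' c = u c := fun c hc => T.piecewise_eq_of_mem _ _ hc
  have hu_right : ∀ c ∈ T', T.piecewise u u' c = u' c := fun c hc =>
    T.piecewise_eq_of_notMem _ _ (Finset.disjoint_right.1 hTT' hc)
  refine Submodule.subset_span ⟨T ∪ T', T.piecewise u u', ⁅z, z'⁆, .lie hTT' hz hz',
    fun c => by rw [Finset.mem_union, Finset.mem_union, hT, hT'], fun b => ?_, ?_⟩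
  · have hb : Sum.inr b ∈ S → Sum.inr b ∉ S' := fun h => Finset.disjoint_left.1 hS h
    rw [Finset.sum_union hTT', Finset.sum_congr rfl fun c hc => by rw [hu_left c hc],
      Finset.sum_congr (s₁ := T') rfl fun c hc => by rw [hu_right c hc], hu, hu']
    grind
  · rw [LieHom.map_lie, hz.elimHom_congr hu_left, hz'.elimHom_congr hu_right]

theorem lie_inr_mem_elimSpan {S : Finset (κ ⊕ β)} {b : β} (hb : Sum.inr b ∉ S)
    {w : FreeLieAlgebra ℚ (κ ⊕ β)} (hw : w ∈ elimSpan S) :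
    ⁅w, FreeLieAlgebra.of ℚ (Sum.inr b)⁆ ∈ elimSpan (S ∪ {Sum.inr b}) := by
  refine lie_mem_of_mem_span_left ?_ hw
  rintro _ ⟨T, u, z, hz, hT, hu, rfl⟩
  rw [hz.lie_elimHom]
  refine sum_mem fun c hc => Submodule.subset_span
    ⟨T, appendLetter u b c, z, hz, fun c => ?_, fun b' => ?_, rfl⟩
  · simp [hT]
  · rw [sum_count_appendLetter u b hc, hu]
    by_cases hbb' : b = b'
    · subst hbb'
      simp [hb]
    · simp [hbb', Ne.symm hbb']

theorem IsBracketing.mem_elimSpan {S : Finset (κ ⊕ β)} {x : FreeLieAlgebra ℚ (κ ⊕ β)}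
    (h : IsBracketing S x) (hS : ∃ a ∈ S, a.isLeft) : x ∈ elimSpan S := by
  refine h.mem_of_lie_mem ?_ ?_ (fun S T hST _ _ x hx y hy => lie_mem_elimSpan hST hx hy) hS
  · rintro (c | b) hc
    · exact Submodule.subset_span ⟨{c}, fun _ => [], FreeLieAlgebra.of ℚ c, .of c,
        by simp, by simp, by rw [elimHom_of, List.map_nil, leftBracket_nil]⟩
    · cases hc
  · rintro (c | b) hb S hbS w hw
    · exact absurd rfl hb
    · exact lie_inr_mem_elimSpan hbS hw

end Elimination

/-! ### Distributions of letters -/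

/-- The families of lists indexed by `κ` in which each element of `β` occurs exactly once. -/
abbrev Distribution (κ β : Type*) : Type _ :=
  {u : κ → List β // (∀ c, (u c).Nodup) ∧ ∀ b, ∃! c, b ∈ u c}

instance {κ β : Type*} [Finite κ] [Finite β] : Finite (Distribution κ β) := by
  classical
  have := Fintype.ofFinite β
  exact Finite.of_injective (fun (u : Distribution κ β) (c : κ) =>
    (⟨u.1 c, u.2.1 c⟩ : {l : List β // l.Nodup})) fun u u' h =>
      Subtype.ext (funext fun c => Subtype.mk.inj (congrFun h c))

theorem isDistribution_of_count {κ β : Type*} [Fintype κ] [DecidableEq β] {u : κ → List β}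
    (h : ∀ b, ∑ c, (u c).count b = 1) : (∀ c, (u c).Nodup) ∧ ∀ b, ∃! c, b ∈ u c := by
  classical
  refine ⟨fun c => List.nodup_iff_count_le_one.2 fun b => ?_, fun b => ?_⟩
  · rw [← h b]
    exact Finset.single_le_sum (f := fun c => (u c).count b) (fun _ _ => Nat.zero_le _)
      (Finset.mem_univ c)
  · obtain ⟨c, -, hc⟩ := Finset.exists_ne_zero_of_sum_ne_zero (h b ▸ one_ne_zero)
    refine ⟨c, List.count_pos_iff.1 (Nat.pos_of_ne_zero hc), fun c' hc' => ?_⟩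
    by_contra hne
    have hle := Finset.add_le_sum (f := fun c => (u c).count b) (fun _ _ => Nat.zero_le _)
      (Finset.mem_univ c) (Finset.mem_univ c') (Ne.symm hne)
    have hpos := List.count_pos_iff.2 hc'
    rw [h b] at hle
    omega

section ElimTensor

variable {κ β : Type}

theorem IsBracketing.elimHom [DecidableEq κ] [DecidableEq β] (u : Distribution κ β) {T : Finset κ}
    {z : FreeLieAlgebra ℚ κ} (h : IsBracketing T z) :
    IsBracketing (T.biUnion fun c => {Sum.inl c} ∪ ((u.1 c).map Sum.inr).toFinset)
      (elimHom u.1 z) := by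
  have eq_of_mem {a : κ ⊕ β} {c c' : κ} (h : a ∈ {Sum.inl c} ∪ ((u.1 c).map Sum.inr).toFinset)
      (h' : a ∈ {Sum.inl c'} ∪ ((u.1 c').map Sum.inr).toFinset) : c = c' := by
    obtain c'' | b := a
    · exact (show c'' = c by simpa using h).symm.trans (by simpa using h')
    · exact (u.2.2 b).unique (by simpa using h) (by simpa using h')
  induction h with
  | of c =>
    rw [Finset.singleton_biUnion, elimHom_of]
    exact (IsBracketing.of _).leftBracket ((u.2.1 c).map Sum.inr_injective) (by simp)
  | lie h _ _ ihx ihy =>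
    rw [LieHom.map_lie, Finset.union_biUnion]
    refine .lie (Finset.disjoint_left.2 fun a ha ha' => ?_) ihx ihy
    obtain ⟨c, hc, hac⟩ := Finset.mem_biUnion.1 ha
    obtain ⟨c', hc', hac'⟩ := Finset.mem_biUnion.1 ha'
    exact Finset.disjoint_iff_ne.1 h c hc c' hc' (eq_of_mem hac hac')

theorem elimHom_mem_multilinearLie (u : Distribution κ β) {z : FreeLieAlgebra ℚ κ}
    (hz : z ∈ multilinearLie κ) : elimHom u.1 z ∈ multilinearLie (κ ⊕ β) := by
  classical
  refine (multilinearLie_le (N := (multilinearLie (κ ⊕ β)).comap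
    (elimHom (R := ℚ) u.1).toLinearMap) fun S y hS hy => ?_) hz
  refine (hy.elimHom u).mem_multilinearLie fun a => Finset.mem_biUnion.2 ?_
  obtain c | b := a
  · exact ⟨c, hS c, by simp⟩
  · obtain ⟨c, hc, -⟩ := u.2.2 b
    exact ⟨c, hS c, by simpa using hc⟩

/-- The map `elimHom u`, on the multilinear parts. -/
def elimLinear (u : Distribution κ β) : multilinearLie κ →ₗ[ℚ] multilinearLie (κ ⊕ β) :=
  (elimHom (R := ℚ) u.1).toLinearMap.restrict fun _ hz => elimHom_mem_multilinearLie u hz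

theorem coe_elimLinear (u : Distribution κ β) (z : multilinearLie κ) :
    (elimLinear u z : FreeLieAlgebra ℚ (κ ⊕ β)) = elimHom u.1 z.1 := rfl

open scoped TensorProduct

/-- The maps `elimLinear u`, for all distributions `u`; they turn out to decompose the multilinear
part of the free Lie algebra on `κ ⊕ β`. -/
def elimTensor (κ β : Type) :
    ((Distribution κ β →₀ ℚ) ⊗[ℚ] multilinearLie κ) →ₗ[ℚ] multilinearLie (κ ⊕ β) :=
  TensorProduct.lift (Finsupp.lsum ℚ fun u => LinearMap.toSpanSingleton ℚ _ (elimLinear u))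

theorem elimTensor_single_tmul (u : Distribution κ β) (z : multilinearLie κ) :
    elimTensor κ β (Finsupp.single u 1 ⊗ₜ z) = elimLinear u z := by
  rw [elimTensor, TensorProduct.lift.tmul, Finsupp.lsum_single, LinearMap.toSpanSingleton_apply,
    one_smul]

theorem elimTensor_surjective [Finite κ] [Nonempty κ] : Function.Surjective (elimTensor κ β) := by
  classical
  have := Fintype.ofFinite κ
  have h : multilinearLie (κ ⊕ β) ≤
      (LinearMap.range (elimTensor κ β)).map (multilinearLie (κ ⊕ β)).subtype := by
    refine multilinearLie_le fun S x hS hx => Submodule.span_le.2 ?_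
      (hx.mem_elimSpan ⟨Sum.inl (Classical.arbitrary κ), hS _, rfl⟩)
    rintro _ ⟨T, u, z, hz, hT, hu, rfl⟩
    obtain rfl : T = Finset.univ := Finset.eq_univ_iff_forall.2 fun c => (hT c).2 (hS _)
    let u' : Distribution κ β := ⟨u, isDistribution_of_count fun b => by rw [hu, if_pos (hS _)]⟩
    have hz' := hz.mem_multilinearLie Finset.mem_univ
    exact ⟨elimLinear u' ⟨z, hz'⟩,
      ⟨Finsupp.single u' 1 ⊗ₜ ⟨z, hz'⟩, elimTensor_single_tmul ..⟩, rfl⟩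
  intro x
  obtain ⟨_, ⟨y, rfl⟩, hxy⟩ := h x.2
  exact ⟨y, Subtype.ext hxy⟩

end ElimTensor

section Merge

variable {κ β : Type*}

/-- Insert after each letter `c` of a list the list `u c`. -/
def mergeList (u : κ → List β) (l : List κ) : List (κ ⊕ β) :=
  l.flatMap fun c => Sum.inl c :: (u c).map Sum.inr

theorem mergeList_cons (u : κ → List β) (c : κ) (l : List κ) :
    mergeList u (c :: l) = Sum.inl c :: ((u c).map Sum.inr ++ mergeList u l) := rfl

theorem takeWhile_isRight_append_mergeList (a : List β) (u : κ → List β) (l : List κ) :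
    (a.map Sum.inr ++ mergeList u l).takeWhile Sum.isRight = a.map Sum.inr := by
  rw [List.takeWhile_append_of_pos (by simp)]
  cases l with
  | nil => exact List.append_nil _
  | cons c l => exact List.append_nil _

theorem mergeList_inj {u u' : κ → List β} (l l' : List κ) (h : mergeList u l = mergeList u' l') :
    l = l' ∧ ∀ c ∈ l, u c = u' c := by
  induction l generalizing l' with
  | nil =>
    cases l' with
    | nil => exact ⟨rfl, by simp⟩
    | cons c l' => simp [mergeList] at h
  | cons c l ih =>
    cases l' with
    | nil => simp [mergeList] at h
    | cons c' l' =>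
      obtain ⟨hc, htail⟩ := List.cons.inj h
      obtain rfl := Sum.inl_injective hc
      have hu : (u c).map Sum.inr = (u' c).map (Sum.inr (α := κ)) := by
        rw [← takeWhile_isRight_append_mergeList (u c) u l,
          ← takeWhile_isRight_append_mergeList (u' c) u' l']
        exact congrArg _ htail
      obtain ⟨rfl, hul⟩ := ih l' (List.append_cancel_left (htail.trans (by rw [hu]; rfl)))
      exact ⟨rfl, List.forall_mem_cons.2 ⟨List.map_injective_iff.2 Sum.inr_injective hu, hul⟩⟩

theorem inl_mem_mergeList {u : κ → List β} {l : List κ} {c : κ} :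
    Sum.inl c ∈ mergeList u l ↔ c ∈ l := by
  simp [mergeList]

theorem inr_mem_mergeList {u : κ → List β} {l : List κ} {b : β} :
    Sum.inr b ∈ mergeList u l ↔ ∃ c ∈ l, b ∈ u c := by
  simp [mergeList]

theorem nodup_mergeList (u : Distribution κ β) {l : List κ} (h : l.Nodup) :
    (mergeList u.1 l).Nodup := by
  induction l with
  | nil => exact List.nodup_nil
  | cons c l ih =>
    rw [List.nodup_cons] at h
    rw [mergeList_cons, List.nodup_cons, List.nodup_append]
    refine ⟨?_, (u.2.1 c).map Sum.inr_injective, ih h.2, ?_⟩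
    · rw [List.mem_append, inl_mem_mergeList, not_or]
      exact ⟨by simp, h.1⟩
    · rintro x hx _ hy rfl
      obtain ⟨b, hb, rfl⟩ := List.mem_map.1 hx
      obtain ⟨c', hc', hb'⟩ := inr_mem_mergeList.1 hy
      obtain rfl := (u.2.2 b).unique hb' hb
      exact h.1 hc'

/-- The enumeration of `κ ⊕ β` obtained from an enumeration of `κ` and a family of lists. -/
def mergeArrangement {c : κ} (x : Distribution κ β × Arrangement c) :
    Arrangement (Sum.inl c : κ ⊕ β) :=
  ⟨(x.1.1 c).map Sum.inr ++ mergeList x.1.1 x.2.1, by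
    rw [← mergeList_cons]
    refine ⟨nodup_mergeList x.1 x.2.2.1, ?_⟩
    rintro (c' | b)
    · exact inl_mem_mergeList.2 (x.2.2.2 c')
    · obtain ⟨c', hc', -⟩ := x.1.2.2 b
      exact inr_mem_mergeList.2 ⟨c', x.2.2.2 c', hc'⟩⟩

theorem mergeArrangement_injective {c : κ} :
    Function.Injective (mergeArrangement : Distribution κ β × Arrangement c → _) := by
  rintro ⟨u, l⟩ ⟨u', l'⟩ h
  have hmerge : mergeList u.1 (c :: l.1) = mergeList u'.1 (c :: l'.1) :=
    congrArg (Sum.inl c :: ·) (Subtype.mk.inj h)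
  obtain ⟨hl, hu⟩ := mergeList_inj _ _ hmerge
  exact Prod.ext (Subtype.ext (funext fun c' => hu c' (l.2.2 c')))
    (Subtype.ext (List.cons.inj hl).2)

end Merge

section Trace

variable {κ β : Type}

open scoped TensorProduct

theorem elimTensor_bijective [Finite κ] [Finite β] [hκ : Nonempty κ] :
    Function.Bijective (elimTensor κ β) := by
  have := Fintype.ofFinite (Distribution κ β)
  obtain ⟨c⟩ := id hκ
  have hle : Module.finrank ℚ ((Distribution κ β →₀ ℚ) ⊗[ℚ] multilinearLie κ) ≤
      Module.finrank ℚ (multilinearLie (κ ⊕ β)) := by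
    rw [Module.finrank_tensorProduct, Module.finrank_finsupp_self, ← Nat.card_eq_fintype_card,
      finrank_multilinearLie c, finrank_multilinearLie (Sum.inl c), ← Nat.card_prod]
    exact Nat.card_le_card_of_injective _ mergeArrangement_injective
  have hs : Function.Surjective (elimTensor κ β) := elimTensor_surjective
  have heq := hle.antisymm (LinearMap.finrank_le_finrank_of_surjective hs)
  exact ⟨(LinearMap.injective_iff_surjective_of_finrank_eq_finrank heq).2 hs, hs⟩

/-- The action of permutations of the indices and of the letters on families of lists. -/
def Distribution.relabel {κ β : Type*} (τ : Perm κ) (ρ : Perm β) (u : Distribution κ β) :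
    Distribution κ β :=
  ⟨fun c => (u.1 (τ.symm c)).map ρ, fun c => (u.2.1 _).map ρ.injective, fun b => by
    have h (c : κ) : b ∈ (u.1 (τ.symm c)).map ρ ↔ ρ.symm b ∈ u.1 (τ.symm c) := by
      rw [← ρ.apply_symm_apply b, List.mem_map_of_injective ρ.injective, ρ.symm_apply_apply]
    simp only [h]
    exact τ.symm.bijective.existsUnique_iff.1 (u.2.2 (ρ.symm b))⟩

theorem Distribution.relabel_apply {κ β : Type*} (τ : Perm κ) (ρ : Perm β) (u : Distribution κ β)
    (c : κ) : (u.relabel τ ρ).1 (τ c) = (u.1 c).map ρ := by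
  change (u.1 (τ.symm (τ c))).map ρ = _
  rw [τ.symm_apply_apply]

theorem mapLie_elimHom {R : Type*} [CommRing R] {κ β : Type*} (τ : Perm κ) (ρ : Perm β)
    (u : Distribution κ β) (z : FreeLieAlgebra R κ) :
    mapLie (Equiv.sumCongr τ ρ) (elimHom u.1 z) = elimHom (u.relabel τ ρ).1 (mapLie τ z) := by
  have h : (mapLie (Equiv.sumCongr τ ρ)).comp (elimHom u.1) =
      (elimHom (R := R) (u.relabel τ ρ).1).comp (mapLie τ) := FreeLieAlgebra.hom_ext fun c => by
    rw [LieHom.comp_apply, LieHom.comp_apply, elimHom_of, mapLie_leftBracket, mapLie_of, mapLie_of,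
      elimHom_of, Distribution.relabel_apply, List.map_map, List.map_map]
    rfl
  exact LieHom.congr_fun h z

theorem multilinearLieEquiv_sumCongr_comp_elimTensor (τ : Perm κ) (ρ : Perm β) :
    (multilinearLieEquiv (Equiv.sumCongr τ ρ)).toLinearMap ∘ₗ elimTensor κ β =
      elimTensor κ β ∘ₗ TensorProduct.map (Finsupp.lmapDomain ℚ ℚ (Distribution.relabel τ ρ))
        (multilinearLieEquiv τ).toLinearMap := by
  refine TensorProduct.ext (Finsupp.lhom_ext' fun u => LinearMap.ext_ring
    (LinearMap.ext fun z => Subtype.ext ?_))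
  change mapLie (Equiv.sumCongr τ ρ) (elimTensor κ β (Finsupp.single u 1 ⊗ₜ z)).1 =
    (elimTensor κ β (Finsupp.mapDomain (Distribution.relabel τ ρ) (Finsupp.single u 1) ⊗ₜ
      multilinearLieEquiv τ z)).1
  rw [Finsupp.mapDomain_single, elimTensor_single_tmul, elimTensor_single_tmul, coe_elimLinear,
    coe_elimLinear, coe_multilinearLieEquiv, mapLie_elimHom]

theorem lieFun_sumCongr [Finite κ] [Finite β] [Nonempty κ] (τ : Perm κ) (ρ : Perm β) :
    lieFun (κ ⊕ β) (Equiv.sumCongr τ ρ) =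
      Nat.card {u : Distribution κ β // u.relabel τ ρ = u} * lieFun κ τ := by
  have := Fintype.ofFinite (Distribution κ β)
  let e := LinearEquiv.ofBijective (elimTensor κ β) elimTensor_bijective
  have h : (multilinearLieEquiv (Equiv.sumCongr τ ρ)).toLinearMap =
      e.conj (TensorProduct.map (Finsupp.lmapDomain ℚ ℚ (Distribution.relabel τ ρ))
        (multilinearLieEquiv τ).toLinearMap) := by
    refine LinearMap.ext fun x => ?_
    obtain ⟨y, rfl⟩ := e.surjective x
    rw [LinearEquiv.conj_apply_apply, e.symm_apply_apply]
    exact LinearMap.congr_fun (multilinearLieEquiv_sumCongr_comp_elimTensor τ ρ) y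
  rw [lieFun, h, LinearMap.trace_conj', LinearMap.trace_tensorProduct', trace_lmapDomain, lieFun]

end Trace

/-! ### The recursion for the characters of the multilinear parts -/

/-- The enumerations of a set fixed by a permutation. -/
abbrev FixedEnumeration {α : Type*} (σ : Perm α) : Type _ :=
  {l : List α // (l.Nodup ∧ ∀ a, a ∈ l) ∧ l.map σ = l}

/-- The character of the permutation representation on the enumerations of a set. -/
def listFun : PermFun := fun _ σ => Nat.card (FixedEnumeration σ)

theorem map_perm_mul {α : Type*} (σ τ : Perm α) (l : List α) :
    l.map (σ * τ) = (l.map τ).map σ := by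
  rw [List.map_map]
  rfl

theorem isClassFun_listFun : IsClassFun listFun := fun α β e σ => by
  rw [listFun, listFun, Nat.cast_inj]
  refine (Nat.card_congr ((Equiv.listEquivOfEquiv e).subtypeEquiv fun l =>
    and_congr (and_congr (List.nodup_map_iff e.injective).symm ?_) ?_)).symm
  · rw [← e.forall_congr_right]
    exact forall_congr' fun a => (List.mem_map_of_injective e.injective).symm
  · change l.map σ = l ↔ (l.map e).map (e.permCongr σ) = l.map e
    have h : (l.map e).map (e.permCongr σ) = (l.map σ).map e := by
      rw [List.map_map, List.map_map]
      exact List.map_congr_left fun a _ => by simp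
    rw [h, (List.map_injective_iff.2 e.injective).eq_iff]

namespace Distribution

variable {κ β : Type*} {τ : Perm κ} {ρ : Perm β}

theorem relabel_eq_iff (u : Distribution κ β) :
    u.relabel τ ρ = u ↔ ∀ i, u.1 (τ i) = (u.1 i).map ρ := by
  refine ⟨fun h i => ?_, fun h => Subtype.ext (funext fun i => ?_)⟩
  · conv_lhs => rw [← h]
    exact u.relabel_apply τ ρ i
  · obtain ⟨i, rfl⟩ := τ.surjective i
    rw [relabel_apply, h]

theorem apply_pow {u : Distribution κ β} (hu : u.relabel τ ρ = u) (n : ℕ) (i : κ) :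
    u.1 ((τ ^ n) i) = (u.1 i).map (ρ ^ n) := by
  induction n with
  | zero => exact (List.map_id _).symm
  | succ n ih =>
    rw [pow_succ', Perm.mul_apply, (relabel_eq_iff u).1 hu, ih, pow_succ', map_perm_mul]

end Distribution

section FixedDistribution

variable {κ β : Type*} {τ : Perm κ} {ρ : Perm β} {d : ℕ+} (φ : κ ≃ ZMod d)

namespace CyclicColoring

variable (c : CyclicColoring ρ d) (l : FixedEnumeration c.rootPerm)

/-- The family of lists obtained by moving an enumeration of the points of color zero along the
powers of the permutation. -/
def spreadList (i : κ) : List β :=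
  (l.1.map Subtype.val).map (ρ ^ (φ i).val)

theorem mem_spreadList (i : κ) (b : β) : b ∈ c.spreadList φ l i ↔ c.1 b = φ i := by
  obtain ⟨b, rfl⟩ := (ρ ^ (φ i).val).surjective b
  rw [spreadList, List.mem_map_of_injective (Equiv.injective _), c.pow_apply,
    ZMod.natCast_zmod_val, add_eq_right, List.mem_map]
  exact ⟨fun ⟨b', _, hb⟩ => hb ▸ b'.2, fun h => ⟨⟨b, h⟩, l.2.1.2 _, rfl⟩⟩

/-- `CyclicColoring.spreadList` as a distribution. -/
def spreadDistribution : Distribution κ β :=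
  ⟨c.spreadList φ l, fun i => (l.2.1.1.map Subtype.val_injective).map (Equiv.injective _),
    fun b => by
      simp only [mem_spreadList, eq_comm (a := c.1 b)]
      exact φ.bijective.existsUnique _⟩

theorem relabel_spreadDistribution (hφ : ∀ i, φ (τ i) = φ i + 1) :
    (c.spreadDistribution φ l).relabel τ ρ = c.spreadDistribution φ l := by
  refine (Distribution.relabel_eq_iff _).2 fun i => ?_
  change c.spreadList φ l (τ i) = (c.spreadList φ l i).map ρ
  rw [spreadList, spreadList, hφ, ← map_perm_mul, ← pow_succ']
  by_cases h : φ i + 1 = 0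
  · rw [h, val_add_one_of_eq_zero h, ZMod.val_zero, pow_zero, Perm.coe_one, List.map_id]
    conv_lhs => rw [← l.2.2]
    rw [List.map_map, List.map_map]
    rfl
  · rw [val_add_one_of_ne_zero h]

theorem spreadDistribution_injective : Function.Injective (c.spreadDistribution φ) := by
  intro l l' h
  have h0 : c.spreadList φ l (φ.symm 0) = c.spreadList φ l' (φ.symm 0) :=
    congrArg (fun u : Distribution κ β => u.1 (φ.symm 0)) h
  rw [spreadList, spreadList, φ.apply_symm_apply, ZMod.val_zero, pow_zero, Perm.coe_one,
    List.map_id, List.map_id] at h0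
  exact Subtype.ext (List.map_injective_iff.2 Subtype.val_injective h0)

variable {φ c}

theorem exists_spreadDistribution_eq (hφ : ∀ i, φ (τ i) = φ i + 1) {u : Distribution κ β}
    (hu : u.relabel τ ρ = u) (hc : ∀ i, ∀ b ∈ u.1 i, c.1 b = φ i) :
    ∃ l : FixedEnumeration c.rootPerm, c.spreadDistribution φ l = u := by
  have hpow (n : ℕ) (i : κ) : φ ((τ ^ n) i) = φ i + n :=
    CyclicColoring.pow_apply (σ := τ) ⟨φ, hφ⟩ n i
  obtain ⟨l, hl⟩ : ∃ l : List {b // c.1 b = 0}, l.map Subtype.val = u.1 (φ.symm 0) :=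
    CanLift.prf (u.1 (φ.symm 0)) fun b hb => by rw [hc _ b hb, φ.apply_symm_apply]
  have hd : (τ ^ (d : ℕ)) (φ.symm 0) = φ.symm 0 := φ.injective (by
    rw [hpow, ZMod.natCast_self, add_zero])
  refine ⟨⟨l, ⟨?_, fun b => ?_⟩, ?_⟩, Subtype.ext (funext fun i => ?_)⟩
  · exact (hl ▸ u.2.1 (φ.symm 0)).of_map _
  · obtain ⟨i, hi, -⟩ := u.2.2 b
    have hi0 : i = φ.symm 0 := by rw [← b.2, hc i b hi, φ.symm_apply_apply]
    rwa [hi0, ← hl, List.mem_map_of_injective Subtype.val_injective] at hi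
  · have h := u.apply_pow hu d (φ.symm 0)
    rw [hd, ← hl, List.map_map] at h
    refine List.map_injective_iff.2 Subtype.val_injective ?_
    rw [List.map_map]
    exact h.symm
  · change (l.map Subtype.val).map (ρ ^ (φ i).val) = u.1 i
    rw [hl, ← u.apply_pow hu]
    refine congrArg u.1 (φ.injective ?_)
    rw [hpow, φ.apply_symm_apply, zero_add, ZMod.natCast_zmod_val]

end CyclicColoring

variable {φ}

theorem natCard_fixed_distribution_compatible (hφ : ∀ i, φ (τ i) = φ i + 1)
    (c : CyclicColoring ρ d) :
    Nat.card {u : {u : Distribution κ β // u.relabel τ ρ = u} // ∀ i, ∀ b ∈ u.1.1 i, c.1 b = φ i} =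
      Nat.card (FixedEnumeration c.rootPerm) := by
  refine (Nat.card_congr (Equiv.ofBijective (fun l =>
    ⟨⟨c.spreadDistribution φ l, c.relabel_spreadDistribution φ l hφ⟩,
      fun i b hb => (c.mem_spreadList φ l i b).1 hb⟩) ⟨fun l l' h => ?_, ?_⟩)).symm
  · exact c.spreadDistribution_injective φ (congrArg (fun u => u.1.1) h)
  · rintro ⟨⟨u, hu⟩, hc⟩
    obtain ⟨l, rfl⟩ := CyclicColoring.exists_spreadDistribution_eq hφ hu hc
    exact ⟨l, rfl⟩

theorem existsUnique_cyclicColoring (hφ : ∀ i, φ (τ i) = φ i + 1) {u : Distribution κ β}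
    (hu : u.relabel τ ρ = u) : ∃! c : CyclicColoring ρ d, ∀ i, ∀ b ∈ u.1 i, c.1 b = φ i := by
  rw [Distribution.relabel_eq_iff] at hu
  choose i hi hi' using u.2.2
  have hiρ (b : β) : i (ρ b) = τ (i b) := by
    refine (hi' (ρ b) _ ?_).symm
    dsimp only
    rw [hu]
    exact List.mem_map_of_mem (hi b)
  refine ⟨⟨fun b => φ (i b), fun b => ?_⟩, fun j b hb => ?_, fun c hc => ?_⟩
  · dsimp only
    rw [hiρ, hφ]
  · dsimp only
    rw [hi' b j hb]
  · exact Subtype.ext (funext fun b => hc _ b (hi b))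

end FixedDistribution

theorem natCard_fixed_distribution {κ β : Type} [Finite κ] [Finite β] {τ : Perm κ} {ρ : Perm β}
    {d : ℕ+} {φ : κ ≃ ZMod d} (hφ : ∀ i, φ (τ i) = φ i + 1) :
    (Nat.card {u : Distribution κ β // u.relabel τ ρ = u} : ℚ) = adamsFun d listFun β ρ := by
  have := Fintype.ofFinite (CyclicColoring ρ d)
  rw [natCard_eq_sum_of_existsUnique _ fun u => existsUnique_cyclicColoring hφ u.2, adamsFun,
    finsum_eq_sum_of_fintype, Nat.cast_sum]
  exact Finset.sum_congr rfl fun c _ => by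
    rw [natCard_fixed_distribution_compatible hφ, listFun]

section Transitive

variable {κ : Type*} {τ : Perm κ} (i₀ : κ)

theorem exists_equiv_zmod_minimalPeriod (h : ∀ i, τ.SameCycle i₀ i) :
    ∃ φ : κ ≃ ZMod (Function.minimalPeriod τ i₀), ∀ i, φ (τ i) = φ i + 1 := by
  choose j hj using h
  refine ⟨Equiv.ofBijective (fun i => (j i : ZMod _)) ⟨fun i i' hi => ?_, fun z => ?_⟩, fun i => ?_⟩
  · rwa [← zpow_apply_eq_iff, hj, hj] at hi
  · obtain ⟨n, rfl⟩ := ZMod.intCast_surjective z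
    refine ⟨(τ ^ n) i₀, ?_⟩
    dsimp only
    rw [← zpow_apply_eq_iff, hj]
  · have hτ : (j (τ i) : ZMod (Function.minimalPeriod τ i₀)) = ((j i + 1 : ℤ) : ZMod _) := by
      rw [← zpow_apply_eq_iff, hj, add_comm, zpow_add, zpow_one, Perm.mul_apply, hj]
    rwa [Int.cast_add, Int.cast_one] at hτ

theorem exists_equiv_zmod (h : ∀ i, τ.SameCycle i₀ i) {d : ℕ} (hd : Nat.card κ = d) :
    ∃ φ : κ ≃ ZMod d, ∀ i, φ (τ i) = φ i + 1 := by
  obtain ⟨φ, hφ⟩ := exists_equiv_zmod_minimalPeriod i₀ h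
  obtain rfl : Function.minimalPeriod τ i₀ = d := by rw [← hd, Nat.card_congr φ, Nat.card_zmod]
  exact ⟨φ, hφ⟩

end Transitive

open scoped Classical in
/-- The class function `σ ↦ d * lieFun σ` on the cycles of length `d`, extended by `0` to the other
permutations. -/
def cycleLieFun (d : ℕ+) : PermFun := fun α σ =>
  if Nat.card α = d ∧ ∀ x y, σ.SameCycle x y then d * lieFun α σ else 0

theorem isClassFun_cycleLieFun (d : ℕ+) : IsClassFun (cycleLieFun d) := fun α β e σ => by
  classical
  have h : (∀ x y, (e.permCongr σ).SameCycle x y) ↔ ∀ x y, σ.SameCycle x y := by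
    rw [← e.forall_congr_right]
    refine forall_congr' fun x => ?_
    rw [← e.forall_congr_right]
    exact forall_congr' fun y => sameCycle_permCongr e σ x y
  exact if_congr (and_congr (by rw [Nat.card_congr e]) h) (by rw [isClassFun_lieFun]) rfl

section CardMulLieFun

variable {α : Type} {σ : Perm α}

theorem lieFun_eq_mul [Finite α] (s : StableFinset σ) (h : ∀ x y, s.perm.SameCycle x y) {d : ℕ+}
    (hd : s.1.card = d) :
    lieFun α σ = lieFun _ s.perm * adamsFun d listFun _ s.complPerm := by
  classical
  let e : {y // y ∈ s.1} ⊕ {y // y ∉ s.1} ≃ α := Equiv.sumCompl (fun y => y ∈ s.1)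
  have hσ : σ = e.permCongr (Equiv.sumCongr s.perm s.complPerm) := by
    ext y
    obtain ⟨y, rfl⟩ := e.surjective y
    rw [Equiv.permCongr_apply, e.symm_apply_apply]
    obtain y | y := y <;> rfl
  obtain ⟨x⟩ : Nonempty {y // y ∈ s.1} := (Finset.card_pos.1 (hd ▸ d.pos)).to_subtype
  have : Nonempty {y // y ∈ s.1} := ⟨x⟩
  obtain ⟨φ, hφ⟩ := exists_equiv_zmod x (h x) (d := d) (by rw [Nat.card_eq_fintype_card,
    Fintype.card_coe, hd])
  conv_lhs => rw [hσ]
  rw [isClassFun_lieFun, lieFun_sumCongr, natCard_fixed_distribution hφ, mul_comm]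

theorem sum_cycleLieFun_mul_adamsFun [Finite α] (s : StableFinset σ)
    (h : ∀ x y, s.perm.SameCycle x y) {D : Finset ℕ+}
    (hD : ∀ d : ℕ+, (d : ℕ) ≤ Nat.card α → d ∈ D) :
    ∑ d ∈ D, cycleLieFun d _ s.perm * adamsFun d listFun _ s.complPerm =
      s.1.card * lieFun α σ := by
  have := Fintype.ofFinite α
  simp only [cycleLieFun, h, implies_true, and_true, Nat.card_eq_fintype_card, Fintype.card_coe]
  obtain hs | hs := s.1.card.eq_zero_or_pos
  · rw [hs, Nat.cast_zero, zero_mul]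
    exact Finset.sum_eq_zero fun d _ => by rw [if_neg d.ne_zero.symm, zero_mul]
  · let d : ℕ+ := ⟨s.1.card, hs⟩
    have hdD : d ∈ D := hD d (by
      rw [Nat.card_eq_fintype_card]
      exact Finset.card_le_univ _)
    rw [Finset.sum_eq_single d (fun d' _ hd' => ?_) fun hd => absurd hdD hd,
      if_pos (show s.1.card = (d : ℕ) from rfl), lieFun_eq_mul s h (d := d) rfl, mul_assoc]
    · rfl
    · rw [if_neg fun hd => hd' (PNat.coe_injective hd.symm), zero_mul]

theorem cycleLieFun_of_not_sameCycle {s : StableFinset σ} (h : ¬∀ x y, s.perm.SameCycle x y)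
    (d : ℕ+) : cycleLieFun d _ s.perm = 0 :=
  if_neg fun hd => h hd.2

variable [Fintype α] [DecidableEq α]

variable (σ) in
/-- The orbit of a point under a permutation. -/
def orbitFinset (x : α) : StableFinset σ :=
  ⟨Finset.univ.filter fun y => σ.SameCycle x y, fun y => by simp [Perm.sameCycle_apply_right]⟩

theorem mem_orbitFinset {x y : α} : y ∈ (orbitFinset σ x).1 ↔ σ.SameCycle x y := by
  simp [orbitFinset]

theorem sameCycle_orbitFinset (x : α) (y z : {y // y ∈ (orbitFinset σ x).1}) :
    (orbitFinset σ x).perm.SameCycle y z :=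
  Perm.sameCycle_subtypePerm.2 ((mem_orbitFinset.1 y.2).symm.trans (mem_orbitFinset.1 z.2))

theorem orbitFinset_eq_iff {s : StableFinset σ} (h : ∀ x y, s.perm.SameCycle x y) {x : α} :
    orbitFinset σ x = s ↔ x ∈ s.1 := by
  refine ⟨fun hx => hx ▸ mem_orbitFinset.2 (.refl _ _),
    fun hx => Subtype.ext (Finset.ext fun y => ?_)⟩
  rw [mem_orbitFinset]
  refine ⟨fun hy => ?_, fun hy => Perm.sameCycle_subtypePerm.1 (h ⟨x, hx⟩ ⟨y, hy⟩)⟩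
  exact (iff_of_sameCycle s.2 hy).1 hx

theorem card_mul_lieFun (σ : Perm α) {D : Finset ℕ+}
    (hD : ∀ d : ℕ+, (d : ℕ) ≤ Nat.card α → d ∈ D) :
    Nat.card α * lieFun α σ = ∑ d ∈ D, prodFun (cycleLieFun d) (adamsFun d listFun) σ := by
  simp only [prodFun]
  rw [Finset.sum_comm, Nat.card_eq_fintype_card, ← nsmul_eq_mul, ← Finset.card_univ,
    ← Finset.sum_const, ← Finset.sum_fiberwise Finset.univ (orbitFinset σ)]
  refine Finset.sum_congr rfl fun s _ => ?_
  rw [Finset.sum_const, nsmul_eq_mul]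
  by_cases h : ∀ x y, s.perm.SameCycle x y
  · simp only [sum_cycleLieFun_mul_adamsFun s h hD, orbitFinset_eq_iff h, Finset.filter_univ_mem]
  · have hs (x : α) : orbitFinset σ x ≠ s := fun hx => h (hx ▸ sameCycle_orbitFinset x)
    simp [cycleLieFun_of_not_sameCycle h, hs]

end CardMulLieFun

/-! ### Sums of geometric series in the power sums -/

section GeomSum

variable {R : Type} [CommRing R]

open scoped Classical in
/-- The series `∑_d c_d p_d / (1 - p_d)`. -/
def geomSum (c : ℕ+ → R) : SymFun R := fun m =>
  ∑ᶠ d, if ∃ a : ℕ, a ≠ 0 ∧ m = Finsupp.single d a then c d else 0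

theorem single_inj {d d' : ℕ+} {a a' : ℕ} (ha : a ≠ 0)
    (h : Finsupp.single d a = Finsupp.single d' a') : d = d' ∧ a = a' :=
  ((Finsupp.single_eq_single_iff ..).1 h).resolve_right fun h => ha h.1

theorem coeff_geomSum_single (c : ℕ+ → R) (d : ℕ+) {a : ℕ} (ha : a ≠ 0) :
    coeff (Finsupp.single d a) (geomSum c) = c d := by
  refine (finsum_eq_single _ d fun d' hd' => if_neg ?_).trans (if_pos ⟨a, ha, rfl⟩)
  rintro ⟨a', -, h⟩
  exact hd' (single_inj ha h).1.symm

theorem coeff_geomSum_eq_zero (c : ℕ+ → R) {m : ℕ+ →₀ ℕ}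
    (hm : ∀ d a, a ≠ 0 → m ≠ Finsupp.single d a) : coeff m (geomSum c) = 0 :=
  finsum_eq_zero_of_forall_eq_zero fun d => if_neg fun ⟨a, ha, h⟩ => hm d a ha h

theorem eq_geomSum {c : ℕ+ → R} {f : SymFun R}
    (h : ∀ d a, a ≠ 0 → coeff (Finsupp.single d a) f = c d)
    (h0 : ∀ m, (∀ d a, a ≠ 0 → m ≠ Finsupp.single d a) → coeff m f = 0) : f = geomSum c := by
  ext m
  by_cases! hm : ∀ d a, a ≠ 0 → m ≠ Finsupp.single d a
  · rw [h0 m hm, coeff_geomSum_eq_zero c hm]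
  · obtain ⟨d, a, ha, rfl⟩ := hm
    rw [h d a ha, coeff_geomSum_single c d ha]

theorem smul_geomSum (r : R) (c : ℕ+ → R) : r • geomSum c = geomSum (r • c) :=
  eq_geomSum (fun d a ha => by rw [coeff_smul, coeff_geomSum_single c d ha, Pi.smul_apply,
    smul_eq_mul]) fun m hm => by rw [coeff_smul, coeff_geomSum_eq_zero c hm, mul_zero]

theorem mapDomain_mulLeftEmbedding_single (k d : ℕ+) (a : ℕ) :
    (Finsupp.single d a).mapDomain (mulLeftEmbedding k) = Finsupp.single (k * d) a := by
  rw [Finsupp.mapDomain_single]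
  rfl

theorem adamsHom_geomSum (k : ℕ+) (c : ℕ+ → R) :
    adamsHom k (geomSum c) = geomSum (Function.extend (k * ·) c 0) := by
  have hk : Function.Injective (k * · : ℕ+ → ℕ+) := mul_right_injective k
  refine eq_geomSum (fun n a ha => ?_) fun m hm => ?_
  · by_cases hn : ∃ d, k * d = n
    · obtain ⟨d, rfl⟩ := hn
      rw [← mapDomain_mulLeftEmbedding_single, coeff_mapDomain_adamsHom,
        coeff_geomSum_single c d ha]
      exact (hk.extend_apply c 0 d).symm
    · rw [Function.extend_apply' _ _ _ hn, coeff_adamsHom_eq_zero]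
      · rfl
      · rintro ⟨y, hy⟩
        rw [← Finsupp.single_eq_same (a := n) (b := a), ← hy] at ha
        exact ha (Finsupp.mapDomain_of_notMem_range y n hn)
  · by_cases hm' : m ∈ Set.range (Finsupp.mapDomain (mulLeftEmbedding k))
    · obtain ⟨y, rfl⟩ := hm'
      rw [coeff_mapDomain_adamsHom, coeff_geomSum_eq_zero]
      rintro d a ha rfl
      exact hm (k * d) a ha (mapDomain_mulLeftEmbedding_single k d a)
    · exact coeff_adamsHom_eq_zero _ hm'

theorem adamsHom_geomSum_single (k : ℕ+) (r : R) :
    adamsHom k (geomSum (Pi.single 1 r)) = geomSum (Pi.single k r) := by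
  rw [adamsHom_geomSum]
  congr 1
  ext n
  by_cases hn : ∃ d, k * d = n
  · obtain ⟨d, rfl⟩ := hn
    simp only [(mul_right_injective k).extend_apply, Pi.single_apply, mul_eq_left]
  · rw [Function.extend_apply' _ _ _ hn, Pi.single_eq_of_ne fun h => hn ⟨1, by rw [mul_one, h]⟩]
    rfl

/-- The factorizations of `n` as a product of two positive integers. -/
def factorPairs (n : ℕ+) : Finset (ℕ+ × ℕ+) :=
  (Finset.Iic n ×ˢ Finset.Iic n).filter fun x => x.1 * x.2 = n

theorem mem_factorPairs {n : ℕ+} {x : ℕ+ × ℕ+} : x ∈ factorPairs n ↔ x.1 * x.2 = n := by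
  rw [factorPairs, Finset.mem_filter, Finset.mem_product, Finset.mem_Iic, Finset.mem_Iic,
    and_iff_right_iff_imp]
  rintro rfl
  simp only [← PNat.coe_le_coe, PNat.mul_coe]
  exact ⟨Nat.le_mul_of_pos_right _ x.2.pos, Nat.le_mul_of_pos_left _ x.1.pos⟩

theorem finsum_extend_mul_left (c : ℕ+ → R) (n : ℕ+) :
    ∑ᶠ k : ℕ+, Function.extend (k * ·) c 0 n = ∑ x ∈ factorPairs n, c x.2 := by
  have hinj : Set.InjOn Prod.fst (factorPairs n : Set (ℕ+ × ℕ+)) := fun x hx y hy hxy => by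
    have h := (mem_factorPairs.1 hx).trans (mem_factorPairs.1 hy).symm
    rw [hxy] at h
    exact Prod.ext hxy (mul_left_cancel h)
  rw [finsum_eq_sum_of_support_subset (s := (factorPairs n).image Prod.fst),
    Finset.sum_image hinj]
  · refine Finset.sum_congr rfl fun x hx => ?_
    rw [← mem_factorPairs.1 hx]
    exact (mul_right_injective x.1).extend_apply c 0 x.2
  · intro k hk
    by_cases hn : ∃ d, k * d = n
    · obtain ⟨d, hd⟩ := hn
      exact Finset.mem_coe.2 (Finset.mem_image.2 ⟨(k, d), mem_factorPairs.2 hd, rfl⟩)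
    · exact absurd (Function.extend_apply' c (0 : ℕ+ → R) n hn) hk

theorem adamsSum_geomSum (c : ℕ+ → R) :
    adamsSum (geomSum c) = geomSum fun n => ∑ x ∈ factorPairs n, c x.2 := by
  refine eq_geomSum (fun n a ha => ?_) fun m hm => ?_
  · simp only [coeff_adamsSum, adamsHom_geomSum, coeff_geomSum_single _ n ha,
      finsum_extend_mul_left]
  · simp only [coeff_adamsSum, adamsHom_geomSum, coeff_geomSum_eq_zero _ hm, finsum_zero]

theorem sum_coeff_geomSum (c : ℕ+ → R) {n : ℕ+} {S : Finset (ℕ+ →₀ ℕ)}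
    (hS : ∀ m ∈ S, degree m = n)
    (hS' : ∀ x ∈ factorPairs n, Finsupp.single x.2 (x.1 : ℕ) ∈ S) :
    ∑ m ∈ S, coeff m (geomSum c) = ∑ x ∈ factorPairs n, c x.2 := by
  refine (Finset.sum_of_injOn (fun x : ℕ+ × ℕ+ => Finsupp.single x.2 (x.1 : ℕ)) ?_ hS' ?_
    fun x _ => (coeff_geomSum_single c x.2 x.1.ne_zero).symm).symm
  · intro x _ y _ hxy
    obtain ⟨h, h'⟩ := single_inj x.1.ne_zero hxy
    exact Prod.ext (PNat.coe_injective h') h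
  · refine fun m hm hm' => coeff_geomSum_eq_zero c ?_
    rintro d a ha rfl
    refine hm' ⟨(⟨a, Nat.pos_of_ne_zero ha⟩, d), mem_factorPairs.2 (PNat.coe_injective ?_), rfl⟩
    rw [← hS _ hm, degree_single]
    rfl

end GeomSum

/-! ### The cycle index of enumerations -/

theorem natCard_enumerations (α : Type*) [Fintype α] :
    Nat.card {l : List α // l.Nodup ∧ ∀ a, a ∈ l} = (Fintype.card α).factorial := by
  classical
  have hn : (Finset.univ : Finset α).toList.Nodup := Finset.nodup_toList _
  have h (l : List α) : (l.Nodup ∧ ∀ a, a ∈ l) ↔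
      l ∈ (Finset.univ : Finset α).toList.permutations.toFinset := by
    rw [List.mem_toFinset, List.mem_permutations]
    exact ⟨fun h => (List.perm_ext_iff_of_nodup h.1 hn).2 fun a => by simp [h.2 a],
      fun h => ⟨h.nodup_iff.2 hn, fun a => h.mem_iff.2 (by simp)⟩⟩
  rw [Nat.card_congr (Equiv.subtypeEquivRight h), Nat.card_eq_fintype_card, Fintype.card_coe,
    List.toFinset_card_of_nodup (List.nodup_permutations _ hn), List.length_permutations,
    Finset.length_toList, Finset.card_univ]

open scoped Classical in
theorem listFun_eq {α : Type} [Fintype α] (σ : Perm α) :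
    listFun α σ = if σ = 1 then ((Fintype.card α).factorial : ℚ) else 0 := by
  rw [listFun]
  split_ifs with h
  · subst h
    rw [Nat.cast_inj, ← natCard_enumerations α]
    exact Nat.card_congr (Equiv.subtypeEquivRight fun l => by simp)
  · have : IsEmpty (FixedEnumeration σ) := ⟨fun l => h (by
      have hl := l.2.2
      conv_rhs at hl => rw [← List.map_id l.1]
      exact Equiv.ext fun a => List.map_inj_left.1 hl a (l.2.1.2 a))⟩
    rw [Nat.card_of_isEmpty, Nat.cast_zero]

open scoped Classical in
theorem coeff_cycleIndex_listFun (m : ℕ+ →₀ ℕ) :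
    coeff m (cycleIndex listFun) = if Finsupp.single 1 (degree m) = m then 1 else 0 := by
  rw [coeff_cycleIndex, cycleTypeSum, Finset.sum_eq_single 1]
  · rw [listFun_eq, if_pos rfl, cycleExponents_one, Nat.card_eq_fintype_card, Fintype.card_fin,
      mul_ite, mul_zero, inv_mul_cancel₀ (Nat.cast_ne_zero.2 (Nat.factorial_ne_zero _))]
  · intro σ _ hσ
    rw [listFun_eq, if_neg hσ, ite_self]
  · exact fun h => absurd (Finset.mem_univ _) h

theorem coeff_cycleIndex_listFun_single (n : ℕ) :
    coeff (Finsupp.single 1 n) (cycleIndex listFun) = 1 := by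
  classical
  rw [coeff_cycleIndex_listFun, degree_single, PNat.one_coe, mul_one, if_pos rfl]

theorem coeff_cycleIndex_listFun_eq_zero {m : ℕ+ →₀ ℕ} (hm : ∀ n, m ≠ Finsupp.single 1 n) :
    coeff m (cycleIndex listFun) = 0 := by
  classical
  rw [coeff_cycleIndex_listFun, if_neg (hm _).symm]

theorem p_mul_cycleIndex_listFun :
    p 1 * cycleIndex listFun = geomSum (Pi.single 1 1) := by
  refine eq_geomSum (fun d a ha => ?_) fun m hm => ?_
  · rw [p, X, coeff_monomial_mul, one_mul]
    by_cases hd : d = 1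
    · subst hd
      rw [if_pos (Finsupp.single_le_single.2 (Nat.one_le_iff_ne_zero.2 ha)),
        ← Finsupp.single_tsub, coeff_cycleIndex_listFun_single, Pi.single_eq_same]
    · rw [if_neg, Pi.single_eq_of_ne hd]
      intro h
      simpa [hd] using h 1
  · rw [p, X, coeff_monomial_mul, one_mul]
    split_ifs with h
    · refine coeff_cycleIndex_listFun_eq_zero fun n hn => hm 1 (n + 1) n.succ_ne_zero ?_
      rw [Finsupp.single_add, ← hn, tsub_add_cancel_of_le h]
    · rfl

theorem cycleIndex_listFun : cycleIndex listFun = 1 + geomSum (Pi.single 1 1) := by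
  classical
  rw [← sub_eq_iff_eq_add']
  refine eq_geomSum (fun d a ha => ?_) fun m hm => ?_
  · rw [map_sub, coeff_one, if_neg (Finsupp.single_ne_zero.2 ha), sub_zero]
    by_cases hd : d = 1
    · rw [hd, coeff_cycleIndex_listFun_single, Pi.single_eq_same]
    · rw [Pi.single_eq_of_ne hd,
        coeff_cycleIndex_listFun_eq_zero fun n hn => hd (single_inj ha hn).1]
  · rw [map_sub, coeff_one]
    split_ifs with h0
    · rw [h0, ← Finsupp.single_zero 1, coeff_cycleIndex_listFun_single, sub_self]
    · rw [sub_zero, coeff_cycleIndex_listFun_eq_zero]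
      rintro n rfl
      exact hm 1 n (fun hn => h0 (by rw [hn, Finsupp.single_zero])) rfl

theorem cycleIndex_listFun_eq_one_add_mul : cycleIndex listFun = 1 + p 1 * cycleIndex listFun := by
  rw [p_mul_cycleIndex_listFun, cycleIndex_listFun]

/-! ### The cycle index of the multilinear parts -/

/-- The coefficient of `p_d` in the cycle index series of `cycleLieFun d`. -/
def cycleCoeff (d : ℕ+) : ℚ := coeff (Finsupp.single d 1) (cycleIndex (cycleLieFun d))

theorem cycleExponents_of_transitive {α : Type*} [Finite α] {σ : Perm α} {d : ℕ+}
    (hd : Nat.card α = d) (h : ∀ x y, σ.SameCycle x y) :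
    cycleExponents σ = Finsupp.single d 1 := by
  have hperiod (x : α) : Function.minimalPeriod σ x = d := by
    obtain ⟨φ, -⟩ := exists_equiv_zmod_minimalPeriod x (h x)
    rw [← hd, Nat.card_congr φ, Nat.card_zmod]
  refine cycleExponents_eq fun k => ?_
  rw [periodCount]
  simp only [hperiod]
  rw [Finsupp.single_apply]
  split_ifs with hk
  · subst hk
    simp [hd]
  · rw [mul_zero, Nat.card_eq_zero]
    exact .inl ⟨fun x => hk (PNat.coe_injective x.2)⟩

theorem cycleIndex_cycleLieFun (d : ℕ+) : cycleIndex (cycleLieFun d) = cycleCoeff d • p d := by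
  classical
  ext m
  rw [coeff_smul, p, coeff_X]
  split_ifs with h
  · rw [h, cycleCoeff, mul_one]
  · rw [mul_zero, coeff_cycleIndex, cycleTypeSum, Finset.sum_eq_zero, mul_zero]
    intro σ _
    split_ifs with hσ
    · exact if_neg fun hd => h (hσ.symm.trans (cycleExponents_of_transitive hd.1 hd.2))
    · rfl

theorem cycleIndex_cycleLieFun_mul (d : ℕ+) :
    cycleIndex (cycleLieFun d) * cycleIndex (adamsFun d listFun) =
      geomSum (Pi.single d (cycleCoeff d)) := by
  have hp : p d = adamsHom d (p 1 : SymFun ℚ) := by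
    rw [p, p, adamsHom, rename_X]
    exact congrArg X (mul_one d).symm
  rw [cycleIndex_adamsFun isClassFun_listFun, cycleIndex_cycleLieFun, smul_mul_assoc, hp,
    ← map_mul, p_mul_cycleIndex_listFun, adamsHom_geomSum_single, smul_geomSum, ← Pi.single_smul,
    smul_eq_mul, mul_one]

theorem coeff_euler_Lie (m : ℕ+ →₀ ℕ) {D : Finset ℕ+}
    (hD : ∀ d : ℕ+, (d : ℕ) ≤ degree m → d ∈ D) :
    coeff m (euler Lie) = ∑ d ∈ D, coeff m (geomSum (Pi.single d (cycleCoeff d))) := by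
  refine mul_left_cancel₀ (Nat.cast_ne_zero.2 (Nat.factorial_ne_zero (degree m))) ?_
  rw [Finset.mul_sum, Lie_eq_cycleIndex, euler_cycleIndex, factorial_mul_coeff_cycleIndex _ rfl,
    cycleTypeSum]
  simp only [← cycleIndex_cycleLieFun_mul,
    factorial_mul_coeff_cycleIndex_mul (isClassFun_cycleLieFun _) (isClassFun_listFun.adamsFun _)]
  rw [Finset.sum_comm]
  refine Finset.sum_congr rfl fun σ _ => ?_
  rw [card_mul_lieFun σ (D := D) (by simpa using hD)]
  split_ifs
  · rfl
  · rw [Finset.sum_const_zero]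

theorem euler_Lie : euler Lie = geomSum cycleCoeff := by
  have hD (m : ℕ+ →₀ ℕ) (d : ℕ+) (hd : (d : ℕ) ≤ degree m) :
      d ∈ Finset.Iic (Nat.succPNat (degree m)) := by
    rw [Finset.mem_Iic, ← PNat.coe_le_coe, Nat.succPNat_coe]
    exact hd.trans (Nat.le_succ _)
  refine eq_geomSum (fun d a ha => ?_) fun m hm => ?_
  · rw [coeff_euler_Lie _ (hD _)]
    simp only [coeff_geomSum_single _ d ha]
    rw [Finset.sum_pi_single, if_pos]
    refine hD _ _ ?_
    rw [degree_single]
    exact Nat.le_mul_of_pos_left _ (Nat.pos_of_ne_zero ha)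
  · rw [coeff_euler_Lie m (hD m)]
    exact Finset.sum_eq_zero fun d _ => coeff_geomSum_eq_zero _ hm

theorem sum_lieFun (n : ℕ+) : (n : ℚ) * ∑ σ : Perm (Fin n), lieFun _ σ =
    ((n : ℕ).factorial : ℚ) * ∑ x ∈ factorPairs n, cycleCoeff x.2 := by
  classical
  let S : Finset (ℕ+ →₀ ℕ) := Finset.univ.image (fun σ : Perm (Fin n) => cycleExponents σ) ∪
    (factorPairs n).image fun x => Finsupp.single x.2 (x.1 : ℕ)
  have hS : ∀ m ∈ S, degree m = n := fun m hm => by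
    rcases Finset.mem_union.1 hm with hm | hm
    · obtain ⟨σ, -, rfl⟩ := Finset.mem_image.1 hm
      rw [degree_cycleExponents, Nat.card_eq_fintype_card, Fintype.card_fin]
    · obtain ⟨x, hx, rfl⟩ := Finset.mem_image.1 hm
      rw [degree_single, ← mem_factorPairs.1 hx, PNat.mul_coe]
  rw [← sum_coeff_geomSum cycleCoeff hS fun x hx =>
      Finset.mem_union_right _ (Finset.mem_image_of_mem _ hx),
    sum_eq_factorial_mul_sum_coeff_cycleIndex lieFun hS fun σ =>
      Finset.mem_union_left _ (Finset.mem_image_of_mem _ (Finset.mem_univ σ)),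
    ← euler_Lie, mul_left_comm, Finset.mul_sum]
  exact congrArg _ (Finset.sum_congr rfl fun m hm => by
    rw [coeff_euler, hS m hm, Lie_eq_cycleIndex])

/-! ### Invariants of the multilinear parts of free Lie algebras -/

theorem IsBracketing.mapLie_eq_self {α : Type} [DecidableEq α] {S : Finset α}
    {x : FreeLieAlgebra ℚ α} (h : IsBracketing S x) {f : α → α} (hf : ∀ i ∈ S, f i = i) :
    PreLieHAL.mapLie f x = x := by
  induction h with
  | of i => rw [mapLie_of, hf i (Finset.mem_singleton_self i)]
  | lie _ _ _ ihx ihy =>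
    rw [LieHom.map_lie, ihx fun c hc => hf c (Finset.mem_union_left _ hc),
      ihy fun c hc => hf c (Finset.mem_union_right _ hc)]

theorem IsBracketing.exists_mapLie_swap_eq_neg {α : Type} [DecidableEq α] {S : Finset α}
    {x : FreeLieAlgebra ℚ α} (h : IsBracketing S x) :
    (∃ i, S = {i} ∧ x = FreeLieAlgebra.of ℚ i) ∨
      ∃ i ∈ S, ∃ j ∈ S, PreLieHAL.mapLie (Equiv.swap i j) x = -x := by
  induction h with
  | of i => exact .inl ⟨i, rfl, rfl⟩
  | @lie S T x y hST hx hy ihx ihy =>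
    right
    have hfix {U : Finset α} {i j : α} (hi : i ∉ U) (hj : j ∉ U) :
        ∀ l ∈ U, Equiv.swap i j l = l := fun l hl =>
      Equiv.swap_apply_of_ne_of_ne (fun h => hi (h ▸ hl)) fun h => hj (h ▸ hl)
    rcases ihx with ⟨i, rfl, rfl⟩ | ⟨i, hi, j, hj, hij⟩
    · rcases ihy with ⟨j, rfl, rfl⟩ | ⟨j, hj, k, hk, hjk⟩
      · refine ⟨i, by simp, j, by simp, ?_⟩
        rw [LieHom.map_lie, mapLie_of, mapLie_of, Equiv.swap_apply_left, Equiv.swap_apply_right,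
          lie_skew]
      · refine ⟨j, Finset.mem_union_right _ hj, k, Finset.mem_union_right _ hk, ?_⟩
        rw [LieHom.map_lie, hjk, lie_neg, hx.mapLie_eq_self (hfix
          (Finset.disjoint_right.1 hST hj) (Finset.disjoint_right.1 hST hk))]
    · refine ⟨i, Finset.mem_union_left _ hi, j, Finset.mem_union_left _ hj, ?_⟩
      rw [LieHom.map_lie, hij, neg_lie, hy.mapLie_eq_self (hfix
        (Finset.disjoint_left.1 hST hi) (Finset.disjoint_left.1 hST hj))]

theorem sum_mapLie_eq_zero {α : Type} [Fintype α] [DecidableEq α] {x : FreeLieAlgebra ℚ α}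
    {τ : Perm α} (h : mapLie τ x = -x) : ∑ σ : Perm α, mapLie σ x = 0 := by
  have hσ (σ : Perm α) : mapLie (σ * τ : Perm α) x = -mapLie σ x := by
    rw [Perm.coe_mul, ← mapLie_mapLie, h, map_neg]
  have hneg : ∑ σ : Perm α, mapLie σ x = -∑ σ : Perm α, mapLie σ x :=
    calc ∑ σ : Perm α, mapLie σ x = ∑ σ : Perm α, mapLie (σ * τ : Perm α) x :=
          (Equiv.sum_comp (Equiv.mulRight τ) fun σ : Perm α => mapLie σ x).symm
      _ = -∑ σ : Perm α, mapLie σ x := by simp only [hσ, Finset.sum_neg_distrib]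
  refine (smul_eq_zero.1 (?_ : (2 : ℚ) • ∑ σ : Perm α, mapLie σ x = 0)).resolve_left two_ne_zero
  rw [two_smul]
  exact add_eq_zero_iff_eq_neg.2 hneg

theorem sum_mapLie_eq_zero_of_mem_multilinearLie {α : Type} [Fintype α] [DecidableEq α]
    [Nontrivial α] {x : FreeLieAlgebra ℚ α} (hx : x ∈ multilinearLie α) :
    ∑ σ : Perm α, mapLie σ x = 0 := by
  suffices h : multilinearLie α ≤ LinearMap.ker
      (∑ σ : Perm α, (mapLie (R := ℚ) (σ : α → α)).toLinearMap) by
    simpa only [LinearMap.mem_ker, LinearMap.sum_apply, LieHom.coe_toLinearMap] using h hx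
  refine multilinearLie_le fun S y hS hy => ?_
  rw [LinearMap.mem_ker, LinearMap.sum_apply]
  rcases hy.exists_mapLie_swap_eq_neg with ⟨i, rfl, -⟩ | ⟨i, -, j, -, hij⟩
  · obtain ⟨j, hj⟩ := exists_ne i
    exact absurd (Finset.mem_singleton.1 (hS j)) hj
  · exact sum_mapLie_eq_zero hij

theorem sum_lieFun_eq_zero {α : Type} [Fintype α] [DecidableEq α] [Nontrivial α] :
    ∑ σ : Perm α, lieFun α σ = 0 := by
  have h : ∑ σ : Perm α, (multilinearLieEquiv σ).toLinearMap = 0 := by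
    refine LinearMap.ext fun x => Subtype.ext ?_
    rw [LinearMap.sum_apply, Submodule.coe_sum]
    exact sum_mapLie_eq_zero_of_mem_multilinearLie x.2
  simp only [lieFun]
  rw [← map_sum, h, map_zero]

theorem lieFun_one (α : Type) [Finite α] :
    lieFun α 1 = Module.finrank ℚ (multilinearLie α) := by
  have h : (multilinearLieEquiv (1 : Perm α)).toLinearMap = LinearMap.id :=
    LinearMap.ext fun x => Subtype.ext (mapLie_id x.1)
  rw [lieFun, h, LinearMap.trace_id]

theorem lieFun_one_of_unique (α : Type) [Unique α] : lieFun α 1 = 1 := by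
  have : Unique (Arrangement (default : α)) :=
    { default := ⟨[], List.nodup_singleton _, fun a => by simp [Subsingleton.elim a default]⟩
      uniq := fun ⟨l, hl, _⟩ => Subtype.ext <| List.eq_nil_iff_forall_not_mem.2 fun a ha =>
        (List.nodup_cons.1 hl).1 (Subsingleton.elim a default ▸ ha) }
  rw [lieFun_one, finrank_multilinearLie default, Nat.card_unique, Nat.cast_one]

theorem sum_cycleCoeff (n : ℕ+) :
    ∑ x ∈ factorPairs n, cycleCoeff x.2 = if n = 1 then 1 else 0 := by
  refine mul_left_cancel₀ (Nat.cast_ne_zero.2 (n : ℕ).factorial_ne_zero) ?_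
  rw [← sum_lieFun]
  split_ifs with h
  · subst h
    rw [PNat.one_coe, Fintype.sum_unique, Perm.default_eq, lieFun_one_of_unique,
      Nat.factorial_one]
  · have : Nontrivial (Fin n) := Fin.nontrivial_iff_two_le.2 <|
      Nat.lt_of_le_of_ne n.pos fun hn => h (PNat.coe_injective hn.symm)
    rw [sum_lieFun_eq_zero, mul_zero, mul_zero]

theorem one_add_adamsSum_euler_Lie : 1 + adamsSum (euler Lie) = cycleIndex listFun := by
  rw [euler_Lie, adamsSum_geomSum, cycleIndex_listFun]
  congr 2
  ext n
  rw [sum_cycleCoeff, Pi.single_apply]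

theorem constantCoeff_Lie : constantCoeff Lie = 0 := by
  rw [Lie_eq_cycleIndex, constantCoeff_cycleIndex, lieFun_one, multilinearLie_eq_bot, finrank_bot,
    Nat.cast_zero]

theorem plethysm_Comm_suspension_Lie : plethysm Comm (suspension Lie) = p 1 := by
  have h0 := constantCoeff_suspension constantCoeff_Lie
  have hneg : negVars (adamsSum (euler Lie)) =
      -p 1 - p 1 * negVars (adamsSum (euler Lie)) := by
    have h := congrArg negVars cycleIndex_listFun_eq_one_add_mul
    rw [← one_add_adamsSum_euler_Lie] at h
    simp only [map_add, map_mul, map_one, negVars_p] at h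
    linear_combination h
  suffices h : 1 + p 1 = plethysticExp (suspension Lie) from (add_left_cancel h).symm
  refine eq_plethysticExp h0 ?_ ?_
  · rw [map_add, constantCoeff_X, add_zero, map_one]
  · rw [euler_suspension, adamsSum_suspension, suspension_eq_neg_negVars, map_add, euler_p,
      Derivation.map_one_eq_zero, PNat.one_coe, Nat.cast_one, one_smul]
    linear_combination hneg

/-! ### Specialization at `t = 1` -/

section Specialization

theorem atOne_add (f g : SymFun (Polynomial ℚ)) : atOne (f + g) = atOne f + atOne g :=
  map_add _ f g

theorem atOne_sub (f g : SymFun (Polynomial ℚ)) : atOne (f - g) = atOne f - atOne g :=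
  map_sub _ f g

theorem atOne_mul (f g : SymFun (Polynomial ℚ)) : atOne (f * g) = atOne f * atOne g :=
  map_mul _ f g

theorem atOne_p (k : ℕ+) : atOne (p k) = p k := by
  rw [atOne, map_X]

theorem atOne_t : atOne t = 1 := by
  rw [atOne, t, map_C, Polynomial.coe_evalRingHom, Polynomial.eval_X, map_one]

theorem atOne_extend (f : SymFun ℚ) : atOne (extend f) = f := by
  ext m
  rw [atOne, extend, coeff_map, coeff_map, Polynomial.coe_evalRingHom, Polynomial.eval_C]

theorem atOne_adams (k : ℕ+) (g : SymFun (Polynomial ℚ)) :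
    atOne (adams (fun k => (Polynomial.expand ℚ k).toRingHom) k g) =
      adams (fun _ => RingHom.id ℚ) k (atOne g) := by
  rw [adams, adams, atOne, ← rename_map]
  congr 1
  ext m
  simp [atOne, coeff_map, Polynomial.expand_eval]

theorem atOne_plethysmT (f : SymFun (Polynomial ℚ)) {g : SymFun (Polynomial ℚ)}
    (hg : constantCoeff g = 0) : atOne (plethysmT f g) = plethysm (atOne f) (atOne g) := by
  rw [atOne, plethysmT, plethysmWith, map_subst (hasSubst_adams _ hg)]
  exact congrArg (subst · (atOne f)) (funext fun k => atOne_adams k g)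

theorem eval_one_divX {R : Type*} [Semiring R] {q : Polynomial R} (hq : q.coeff 0 = 0) :
    q.divX.eval 1 = q.eval 1 := by
  conv_rhs => rw [← Polynomial.divX_mul_X_add q, hq]
  simp

theorem atOne_suspensionT {f : SymFun ℚ} (hf : constantCoeff f = 0) :
    atOne (suspensionT f) = suspension f := by
  ext m
  set q := coeff m (rescale (fun k : ℕ+ => -(Polynomial.X : Polynomial ℚ) ^ (k : ℕ)) (extend f))
    with hq
  have hcoeff : coeff m (atOne (suspensionT f)) = -(q.divX.eval 1) := by
    rw [atOne, coeff_map, Polynomial.coe_evalRingHom]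
    exact Polynomial.eval_neg _ _
  have hprod : q = (m.prod fun k e => (-(Polynomial.X : Polynomial ℚ) ^ (k : ℕ)) ^ e) *
      Polynomial.C (coeff m f) := by
    rw [hq, coeff_rescale, extend, coeff_map]
  have hq0 : q.coeff 0 = 0 := by
    rw [Polynomial.coeff_zero_eq_eval_zero, hprod, Polynomial.eval_mul, Polynomial.eval_C]
    by_cases hm : m = 0
    · rw [hm, coeff_zero_eq_constantCoeff_apply, hf, mul_zero]
    · obtain ⟨k, hk⟩ := Finsupp.support_nonempty_iff.2 hm
      rw [Finsupp.prod, Polynomial.eval_prod, Finset.prod_eq_zero hk, zero_mul]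
      simp [Finsupp.mem_support_iff.1 hk]
  rw [hcoeff, eval_one_divX hq0, hprod, suspension_eq_neg_negVars, map_neg, coeff_negVars,
    Finsupp.prod, Finsupp.prod, Polynomial.eval_mul, Polynomial.eval_prod]
  simp

end Specialization

/-! ### Free pre-Lie algebras as Lie algebras -/

theorem plethysm_Comm_plethysm_suspension_Lie {Y : SymFun ℚ} (hY : constantCoeff Y = 0) :
    plethysm Comm (plethysm (suspension Lie) Y) = Y := by
  rw [plethysm_assoc _ (constantCoeff_suspension constantCoeff_Lie) hY,
    plethysm_Comm_suspension_Lie, plethysm_p_one hY]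

theorem plethysm_suspension_Lie_plethysm_Comm {Y : SymFun ℚ} (hY : constantCoeff Y = 0) :
    plethysm (suspension Lie) (plethysm Comm Y) = Y :=
  have hC := constantCoeff_plethysm constantCoeff_Comm hY
  plethysm_Comm_injOn (constantCoeff_plethysm (constantCoeff_suspension constantCoeff_Lie) hC) hY
    (plethysm_Comm_plethysm_suspension_Lie hC)

theorem plethysm_Lie_eq_iff {T G : SymFun ℚ} (hT : constantCoeff T = 0)
    (hG : constantCoeff G = 0) :
    plethysm Lie G = T ↔ suspension G = plethysm Comm (suspension T) := by
  rw [← suspension_injective.eq_iff, suspension_plethysm _ hG]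
  constructor <;> intro h
  · rw [← h, plethysm_Comm_plethysm_suspension_Lie (constantCoeff_suspension hG)]
  · rw [h, plethysm_suspension_Lie_plethysm_Comm (constantCoeff_suspension hT)]

/-! ### The series `HAL` at `t = 1` -/

theorem Assoc_mul_one_sub_p : Assoc * (1 - p 1) = p 1 := by
  rw [Assoc, mul_assoc, MvPowerSeries.inv_mul_cancel _ (by simp), mul_one]

theorem constantCoeff_Assoc : constantCoeff Assoc = 0 := by
  rw [Assoc, map_mul, constantCoeff_X, zero_mul]

theorem suspension_Assoc_mul_one_add_p : suspension Assoc * (1 + p 1) = p 1 := by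
  have h := congrArg negVars Assoc_mul_one_sub_p
  rw [map_mul, map_sub, map_one, negVars_p, sub_neg_eq_add] at h
  rw [suspension_eq_neg_negVars, neg_mul, h, neg_neg]

theorem plethysm_suspension_Assoc_mul_one_add {Y : SymFun ℚ} (hY : constantCoeff Y = 0) :
    plethysm (suspension Assoc) Y * (1 + Y) = Y := by
  have h := congrArg (substAlgHom (R := ℚ) (hasSubst_adamsHom hY)) suspension_Assoc_mul_one_add_p
  rwa [map_mul, map_add, map_one, coe_substAlgHom, ← plethysm_eq, ← plethysm_eq,
    plethysm_p_one hY] at h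

theorem constantCoeff_HALpa : constantCoeff HALpa = 0 := existsUnique_HALpa.choose_spec.1.1

theorem HALpa_eq : HALpa = p 1 * plethysmT (suspensionT Assoc)
    (plethysmT (extend Comm) (p 1 - t * HALpa)) := existsUnique_HALpa.choose_spec.1.2

theorem constantCoeff_p_sub_t_mul_HALpa :
    constantCoeff ((p 1 : SymFun (Polynomial ℚ)) - t * HALpa) = 0 := by
  rw [map_sub, map_mul, constantCoeff_HALpa, mul_zero, constantCoeff_X, sub_zero]

theorem atOne_p_sub_t_mul_HALpa : atOne (p 1 - t * HALpa) = p 1 - atOne HALpa := by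
  rw [atOne_sub, atOne_mul, atOne_p, atOne_t, one_mul]

theorem atOne_plethysmT_plethysmT_HALpa (f : SymFun (Polynomial ℚ)) :
    atOne (plethysmT f (plethysmT (extend Comm) (p 1 - t * HALpa))) =
      plethysm (atOne f) (plethysm Comm (p 1 - atOne HALpa)) := by
  have hComm : constantCoeff (extend Comm) = 0 := by
    rw [extend, constantCoeff_map, constantCoeff_Comm, map_zero]
  have hinner : constantCoeff (plethysmT (extend Comm) (p 1 - t * HALpa)) = 0 :=
    constantCoeff_plethysmWith _ hComm constantCoeff_p_sub_t_mul_HALpa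
  rw [atOne_plethysmT _ hinner, atOne_plethysmT _ constantCoeff_p_sub_t_mul_HALpa, atOne_extend,
    atOne_p_sub_t_mul_HALpa]

theorem atOne_HALpa_eq : atOne HALpa =
    p 1 * plethysm (suspension Assoc) (plethysm Comm (p 1 - atOne HALpa)) := by
  conv_lhs => rw [HALpa_eq]
  rw [atOne_mul, atOne_p, atOne_plethysmT_plethysmT_HALpa, atOne_suspensionT constantCoeff_Assoc]

section PreLieEquation

variable {P : SymFun ℚ}

theorem p_sub_eq_mul_plethysm_of_mul_plethysticExp (hP0 : constantCoeff P = 0)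
    (hP : P * plethysticExp P = p 1) :
    p 1 - P = p 1 * plethysm (suspension Assoc) (plethysm Comm P) := by
  have hA := plethysm_suspension_Assoc_mul_one_add (constantCoeff_plethysm constantCoeff_Comm hP0)
  refine mul_right_cancel₀ (plethysticExp_ne_zero hP0) ?_
  rw [sub_mul, hP, mul_assoc, plethysticExp, hA]
  ring

theorem p_sub_atOne_HALpa (hP0 : constantCoeff P = 0) (hP : P * plethysticExp P = p 1) :
    p 1 - atOne HALpa = P := by
  have hu := existsUnique_plethystic (fun _ => RingHom.id ℚ) (suspension Assoc) Comm 1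
    constantCoeff_Comm
  simp only [one_mul] at hu
  rw [sub_eq_iff_eq_add, ← sub_eq_iff_eq_add']
  refine hu.unique ⟨?_, ?_⟩ ⟨?_, atOne_HALpa_eq⟩
  · rw [map_sub, hP0, constantCoeff_X, sub_zero]
  · rw [sub_sub_cancel]
    exact p_sub_eq_mul_plethysm_of_mul_plethysticExp hP0 hP
  · rw [atOne, constantCoeff_map, constantCoeff_HALpa, map_zero]

theorem atOne_HALp (hP0 : constantCoeff P = 0) (hP : P * plethysticExp P = p 1) :
    atOne HALp = p 1 * P := by
  rw [HALp, atOne_mul, atOne_p, atOne_plethysmT_plethysmT_HALpa,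
    atOne_suspensionT constantCoeff_Lie, p_sub_atOne_HALpa hP0 hP,
    plethysm_suspension_Lie_plethysm_Comm hP0]

theorem atOne_HALa (hP0 : constantCoeff P = 0) (hP : P * plethysticExp P = p 1) :
    atOne HALa = plethysm Comm P - P := by
  rw [HALa, atOne_plethysmT _ constantCoeff_p_sub_t_mul_HALpa, atOne_p_sub_t_mul_HALpa,
    p_sub_atOne_HALpa hP0 hP, atOne_sub, atOne_p, atOne_extend, plethysm_eq,
    subst_sub (hasSubst_adamsHom hP0), ← plethysm_eq, ← plethysm_eq, plethysm_p_one hP0]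

theorem HALbar_eq (hP0 : constantCoeff P = 0) (hP : P * plethysticExp P = p 1) :
    HALbar = p 1 * P + plethysm Comm P - p 1 := by
  rw [HALbar, HAL, atOne_sub, atOne_add, atOne_HALp hP0 hP, atOne_HALa hP0 hP]
  linear_combination p_sub_atOne_HALpa hP0 hP

theorem plethysm_Comm_eq_p_sub (hP0 : constantCoeff P = 0) (hP : P * plethysticExp P = p 1) :
    plethysm Comm P = p 1 - (p 1 * pderiv ℚ 1 HALbar - HALbar) := by
  have hExp : pderiv ℚ 1 (plethysm Comm P) = plethysticExp P * pderiv ℚ 1 P := by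
    rw [← pderiv_one_plethysticExp hP0, plethysticExp, map_add, Derivation.map_one_eq_zero,
      zero_add]
  have hderiv := congrArg (pderiv ℚ (1 : ℕ+)) hP
  rw [Derivation.leibniz, pderiv_one_plethysticExp hP0, pderiv_X_self, smul_eq_mul,
    smul_eq_mul] at hderiv
  rw [HALbar_eq hP0 hP, map_sub, map_add, Derivation.leibniz, hExp, pderiv_X_self, smul_eq_mul,
    smul_eq_mul]
  linear_combination (p 1) * hderiv - (p 1) * pderiv ℚ 1 P * hP

end PreLieEquation

end

end PreLieHAL

theorem mainTheorem8 :
    plethysm Comm (suspension PreLie)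
        = p 1 - (p 1 * MvPowerSeries.pderiv ℚ 1 HALbar - HALbar) ∧
      ∀ G : SymFun ℚ, MvPowerSeries.constantCoeff G = 0 →
        (plethysm Lie G = PreLie ↔ suspension G = plethysm Comm (suspension PreLie)) :=
  ⟨plethysm_Comm_eq_p_sub (constantCoeff_suspension constantCoeff_PreLie)
      (suspension_mul_plethysticExp constantCoeff_PreLie PreLie_eq_p_mul_plethysticExp),
    fun _ hG => plethysm_Lie_eq_iff constantCoeff_PreLie hG⟩
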